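/- Let $E$ be a real vector space with a reduced, crystallographic, irreducible finite root system $\Phi$ (with coroots $\alpha^*$), a base $\Delta$ and Weyl group $W$. Let $P\subset E$ be the lattice of integral weights. Let $\omega_\alpha$ ($\alpha\in\Delta$) be the fundamental weights, write $\lambda=\sum_{\alpha\in\Delta}m_\alpha(\lambda)\omega_\alpha$ for $\lambda\in P$, and call $\lambda$ dominant regular if all $m_\alpha(\lambda)>0$. A regular weight $\mu$ divides $\lambda$ if $m_\alpha(\mu)\mid m_\alpha(\lambda)$ for all $\alpha\in\Delta$. Put $\rho=\sum_{\alpha\in\Delta}\omega_\alpha$ and $$\tilde\rho=\sum_{\alpha\in\Delta\text{ short}}m(\Phi)\,\omega_\alpha+\sum_{\alpha\in\Delta\text{ long}}\omega_\alpha,$$ where $m(\Phi)$ is the ratio of the squared lengths of a long and a short root (so $\tilde\rho=\rho$ if $\Phi$ is simply laced). A weight is of generalized Weyl denominator type if it is an integral multiple of $\rho$ or of $\tilde\rho$. For $\lambda\in P$ let $$S(\lambda)=\sum_{w\in W}\epsilon(w)\,e^{w\lambda}\in\mathbb Z[P],\qquad \epsilon(w)=(-1)^{\ell(w)}.$$ An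 element $f\in\mathbb Z[P]$ is called alternating if $wf=\epsilon(w)f$ for all $w\in W$. For $\lambda\ne\rho$ dominant regular let $D(\lambda)$ be the least common multiple (among alternating elements of $\mathbb Z[P]$, with divisibility over the ring of invariants $\mathbb Z[P]^W$, and normalized to have leading coefficient $1$ in the dominance order) of the elements $S(\mu)$, where $\mu$ runs over the dominant regular weights of generalized Weyl denominator type with $\mu\mid\lambda$ and $\mu\ne\lambda$; and let $C(\lambda)=S(\lambda)/D(\lambda)$. **Theorem.** (1) Let $\lambda_1,\lambda_2,\mu_1,\mu_2$ be dominant regular weights such that $\mu_1$ and $\mu_2$ are of generalized Weyl denominator type and $\mu_i$ divides $\lambda_i$ for $i=1,2$. If $$S(\lambda_1)/S(\mu_1)=S(\lambda_2)/S(\mu_2)\neq1,$$ then $\lambda_1=\lambda_2$ and $\mu_1=\mu_2$. (2) In particular, let $\lambda_1$ and $\lambda_2\neq\rho$ be dominant regular weights such that $\lambda_1$ is neither a multiple of $\rho$ nor of $\tilde\rho$. If $C(\lambda_1)=C(\lambda_2)$, then $\lambda_1=\lambda_2$. -/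

import Mathlib

noncomputable section

namespace SchurWeyl

open Module

variable {ι M N : Type*} [AddCommGroup M] [Module ℝ M] [AddCommGroup N] [Module ℝ N]

/-- The lattice of integral weights of a root system in the real vector space `M`: the vectors
whose pairings with all coroots are integers. -/
def weightLattice (P : RootPairing ι ℝ M N) : AddSubgroup M where
  carrier := {x | ∀ i, ∃ n : ℤ, P.toLinearMap x (P.coroot i) = n}
  zero_mem' := fun _ => ⟨0, by simp⟩
  add_mem' := by
    intro x y hx hy i
    obtain ⟨m, hm⟩ := hx i
    obtain ⟨n, hn⟩ := hy i
    exact ⟨m + n, by simp [hm, hn]⟩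
  neg_mem' := by
    intro x hx i
    obtain ⟨m, hm⟩ := hx i
    exact ⟨-m, by simp [hm]⟩

/-- The integer `⟨α*, x⟩`, where `α` is the root with index `i`; for a simple root it is the
coefficient of the weight `x` at the fundamental weight of `α`. -/
def mult {P : RootPairing ι ℝ M N} (x : weightLattice P) (i : ι) : ℤ := (x.2 i).choose

theorem mult_spec {P : RootPairing ι ℝ M N} (x : weightLattice P) (i : ι) :
    P.toLinearMap (x : M) (P.coroot i) = (mult x i : ℝ) := (x.2 i).choose_spec

/-- Dominant regular weights: all coefficients at the fundamental weights are positive. -/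
def IsDominantRegular {P : RootPairing ι ℝ M N} (b : P.Base) (x : weightLattice P) : Prop :=
  (∀ i ∈ b.support, 0 ≤ mult x i) ∧ ∀ i ∈ b.support, mult x i ≠ 0

/-- The weight `μ` divides the weight `x`: every coefficient of `μ` at a fundamental weight
divides the corresponding coefficient of `x`. -/
def WeightDvd {P : RootPairing ι ℝ M N} (b : P.Base) (μ x : weightLattice P) : Prop :=
  ∀ i ∈ b.support, mult μ i ∣ mult x i

/-! ### The Weyl group -/

instance finite_weylGroup [Finite ι] (P : RootPairing ι ℝ M N) [P.IsRootSystem] :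
    Finite P.weylGroup := by
  refine Finite.of_injective (fun w : P.weylGroup => P.weylGroupToPerm w) ?_
  intro w w' h
  apply Subtype.ext
  apply RootPairing.Equiv.weightHom_injective P
  apply LinearEquiv.toLinearMap_injective
  apply LinearMap.ext_on_range (v := P.root)
  · exact RootPairing.IsRootSystem.span_root_eq_top
  · intro i
    have h1 := P.weylGroup_apply_root w i
    have h2 := P.weylGroup_apply_root w' i
    have h3 : P.weylGroupToPerm w = P.weylGroupToPerm w' := h
    rw [h3, ← h2] at h1
    exact h1

/-- The weight lattice is stable under the Weyl group. -/
theorem smul_mem_weightLattice (P : RootPairing ι ℝ M N) (w : P.weylGroup) {x : M}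
    (hx : x ∈ weightLattice P) : w • x ∈ weightLattice P := by
  intro i
  obtain ⟨n, hn⟩ := hx ((w : P.Aut).indexEquiv.symm i)
  refine ⟨n, ?_⟩
  have h1 := RootPairing.Hom.weight_coweight_transpose_apply P P (P.coroot i)
    (w : P.Aut).toHom
  have h2 := LinearMap.congr_fun h1 x
  rw [RootPairing.Hom.coroot_coweightMap_apply] at h2
  exact h2.trans hn

/-- The action of an element of the Weyl group on the weight lattice. -/
def weylAct (P : RootPairing ι ℝ M N) (w : P.weylGroup) : weightLattice P →+ weightLattice P where
  toFun x := ⟨w • (x : M), smul_mem_weightLattice P w x.2⟩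
  map_zero' := by ext; simp
  map_add' x y := by ext; simp

/-- The length of an element of the Weyl group: the least length of a word in the reflections
in the simple roots which represents it. -/
def length {P : RootPairing ι ℝ M N} (b : P.Base) (w : P.weylGroup) : ℕ :=
  sInf {n | ∃ l : List ι, (∀ i ∈ l, i ∈ b.support) ∧ l.length = n ∧
    (l.map (RootPairing.weylGroup.ofIdx P)).prod = w}

/-- The sign character `ε(w) = (-1) ^ l(w)`. -/
def sign {P : RootPairing ι ℝ M N} (b : P.Base) (w : P.weylGroup) : ℤ := (-1) ^ length b w

/-! ### The group algebra of the weight lattice and the Schur-Weyl elements -/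

/-- The integral group algebra of the weight lattice. -/
abbrev WeightAlgebra (P : RootPairing ι ℝ M N) : Type _ := AddMonoidAlgebra ℤ (weightLattice P)

instance twoUniqueSums_weightLattice (P : RootPairing ι ℝ M N) :
    TwoUniqueSums (weightLattice P) := by
  let : Module ℚ M := Module.compHom M (algebraMap ℚ ℝ)
  exact TwoUniqueSums.of_injective_addHom (weightLattice P).subtype.toAddHom
    Subtype.val_injective inferInstance

instance isDomain_weightAlgebra (P : RootPairing ι ℝ M N) : IsDomain (WeightAlgebra P) :=
  NoZeroDivisors.to_isDomain _

/-- The quotient field of the integral group algebra of the weight lattice. -/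
abbrev WeightField (P : RootPairing ι ℝ M N) : Type _ := FractionRing (WeightAlgebra P)

/-- The action of an element of the Weyl group on the group algebra,
`w e^x = e^{w x}`. -/
def weylActAlg (P : RootPairing ι ℝ M N) (w : P.weylGroup) (f : WeightAlgebra P) :
    WeightAlgebra P :=
  AddMonoidAlgebra.mapDomain (weylAct P w) f

/-- The Schur-Weyl element `S(x) = ∑ w, ε(w) e^{w x}`. -/
def schurWeyl [Finite ι] {P : RootPairing ι ℝ M N} [P.IsRootSystem] (b : P.Base)
    (x : weightLattice P) : WeightAlgebra P :=
  letI : Fintype P.weylGroup := Fintype.ofFinite _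
  ∑ w : P.weylGroup, AddMonoidAlgebra.single (weylAct P w x) (sign b w)

/-- Elements of the group algebra which are invariant under the Weyl group. -/
def IsInvariant {P : RootPairing ι ℝ M N} (f : WeightAlgebra P) : Prop :=
  ∀ w : P.weylGroup, weylActAlg P w f = f

/-- Elements of the group algebra which are alternating under the Weyl group. -/
def IsAlternating {P : RootPairing ι ℝ M N} (b : P.Base) (f : WeightAlgebra P) : Prop :=
  ∀ w : P.weylGroup, weylActAlg P w f = sign b w • f

/-! ### Weights of generalized Weyl denominator type -/

/-- The fundamental weight of the simple root with index `i`, i.e. the vector dual to the basis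
of simple coroots. -/
def fundamentalWeight {P : RootPairing ι ℝ M N} [P.IsRootSystem] (b : P.Base)
    (i : b.support) : M :=
  P.toPerfPair.symm (b.toCoweightBasis.coord i)

open Classical in
theorem fundamentalWeight_spec {P : RootPairing ι ℝ M N} [P.IsRootSystem] (b : P.Base)
    (i j : b.support) :
    P.toLinearMap (fundamentalWeight b i) (P.coroot j) = if j = i then 1 else 0 := by
  have h : P.toPerfPair (fundamentalWeight b i) = b.toCoweightBasis.coord i := by
    simp [fundamentalWeight]
  have h2 := LinearMap.congr_fun h (P.coroot j)
  rw [Basis.coord_apply, RootPairing.Base.toCoweightBasis_repr_coroot,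
    Finsupp.single_apply] at h2
  exact h2

/-- The Weyl weight `ρ`, the sum of the fundamental weights. -/
def rho {P : RootPairing ι ℝ M N} [P.IsRootSystem] (b : P.Base) : M :=
  ∑ i : b.support, fundamentalWeight b i

/-- The square of the length of the root with index `i`, for the canonical Weyl group invariant
inner product. For an irreducible root system all invariant inner products are proportional, so
that ratios of such squares do not depend on this choice. -/
def rootNormSq [Fintype ι] (P : RootPairing ι ℝ M N) (i : ι) : ℝ :=
  P.RootForm (P.root i) (P.root i)

/-- The root with index `i` is long: it has maximal length (in a simply laced root system, all
roots are long in this sense). -/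
def IsLong [Fintype ι] (P : RootPairing ι ℝ M N) (i : ι) : Prop :=
  ∀ j, rootNormSq P j ≤ rootNormSq P i

/-- The ratio `m(Φ)` of the squares of the lengths of a long root and of a short root. -/
def lengthRatio [Fintype ι] (P : RootPairing ι ℝ M N) : ℝ :=
  (⨆ i, rootNormSq P i) / (⨅ i, rootNormSq P i)

open Classical in
/-- The dual Weyl weight: the sum of `m(Φ) ω_α` over the short simple roots and of `ω_α` over the
long simple roots. It equals `ρ` for a simply laced root system. -/
def rhoTilde [Fintype ι] {P : RootPairing ι ℝ M N} [P.IsRootSystem] (b : P.Base) : M :=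
  ∑ i : b.support, (if IsLong P i then 1 else lengthRatio P) • fundamentalWeight b i

/-- Weights of generalized Weyl denominator type: the integral multiples of `ρ` and of the dual
Weyl weight. -/
def IsWeylDenominatorType [Fintype ι] {P : RootPairing ι ℝ M N} [P.IsRootSystem] (b : P.Base)
    (x : weightLattice P) : Prop :=
  (∃ d : ℤ, (x : M) = d • rho b) ∨ ∃ d : ℤ, (x : M) = d • rhoTilde b

/-! ### The elements `D` and `C` -/

/-- Divisibility over the ring of invariants: `g = q f` with `q` invariant. -/
def InvDvd {P : RootPairing ι ℝ M N} (f g : WeightAlgebra P) : Prop :=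
  ∃ q : WeightAlgebra P, IsInvariant q ∧ g = q * f

/-- The coefficient of the leading monomial of `f` for the dominance ordering is `1`: there is a
largest weight occurring in `f`, and its coefficient is `1`. -/
def HasLeadingCoeffOne {P : RootPairing ι ℝ M N} (b : P.Base) (f : WeightAlgebra P) : Prop :=
  ∃ x : weightLattice P, f.coeff x = 1 ∧
    ∀ y ∈ f.coeff.support, (x : M) - (y : M) ∈ AddSubmonoid.closure (P.root '' b.support)

/-- The weights `dρ`, and the multiples of the dual Weyl weight, which are dominant regular,
divide `x` and are different from `x`. -/
def properWeylFactors [Fintype ι] {P : RootPairing ι ℝ M N} [P.IsRootSystem] (b : P.Base)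
    (x : weightLattice P) : Set (weightLattice P) :=
  {μ | IsDominantRegular b μ ∧ IsWeylDenominatorType b μ ∧ WeightDvd b μ x ∧ μ ≠ x}

/-- `f` is the normalized least common multiple, over the ring of invariants and among
alternating elements, of the Schur-Weyl elements `S(μ)` for `μ ≠ x` of generalized Weyl
denominator type dividing `x`. -/
def IsWeylLcm [Fintype ι] {P : RootPairing ι ℝ M N} [P.IsRootSystem] (b : P.Base)
    (x : weightLattice P) (f : WeightAlgebra P) : Prop :=
  IsAlternating b f ∧
  (∀ μ ∈ properWeylFactors b x, InvDvd (schurWeyl b μ) f) ∧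
  (∀ g, IsAlternating b g → (∀ μ ∈ properWeylFactors b x, InvDvd (schurWeyl b μ) g) →
    InvDvd f g) ∧
  HasLeadingCoeffOne b f

open Classical in
/-- The element `D(x)`, the normalized least common multiple. -/
def weylLcm [Fintype ι] {P : RootPairing ι ℝ M N} [P.IsRootSystem] (b : P.Base)
    (x : weightLattice P) : WeightAlgebra P :=
  if h : ∃ f, IsWeylLcm b x f then h.choose else 0

/-- The quotient `S(x) / S(μ)`. -/
def schurWeylQuot [Finite ι] {P : RootPairing ι ℝ M N} [P.IsRootSystem] (b : P.Base)
    (x μ : weightLattice P) : WeightField P :=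
  algebraMap (WeightAlgebra P) (WeightField P) (schurWeyl b x) /
    algebraMap (WeightAlgebra P) (WeightField P) (schurWeyl b μ)

/-- The generalized character `C(x) = S(x) / D(x)`. -/
def genCharacter [Fintype ι] {P : RootPairing ι ℝ M N} [P.IsRootSystem] (b : P.Base)
    (x : weightLattice P) : WeightField P :=
  algebraMap (WeightAlgebra P) (WeightField P) (schurWeyl b x) /
    algebraMap (WeightAlgebra P) (WeightField P) (weylLcm b x)

end SchurWeyl

end

set_option linter.unusedSectionVars false

/-! Dividing S(λ) by its leading monomial gives a polynomial in the variables e^{-α}, α simple, with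
constant term 1 (`schurPoly`). Regularity makes the weights wλ distinct, so nothing cancels, and a
monomial e^{-n} occurs exactly when λ - n lies in the orbit of λ. Comparing lengths of λ and λ - n
then describes all monomials in the box n_α ≤ m_α(λ): they belong to sets of pairwise orthogonal
simple roots with n_α = m_α(λ) (`coeff_schurPoly_of_le`, `exists_smul_eq_of_orthogonal`).

Part (1) is a statement about S(λ₁)S(μ₂) = S(λ₂)S(μ₁). Setting all variables but one to zero turns
each factor into 1 - X^m, so at every simple root the coefficients of λ₁, μ₂ agree with those of λ₂,
μ₁ up to order. If the matching is not uniform, a shortest path in the connected Dynkin diagram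
joins a vertex where λ₁ and λ₂ differ to one where λ₁ and μ₁ differ. All four weights agree in its
interior. The path monomial, with the smallest coefficients as exponents, can only be split
alternately between two factors, and by parity this is possible on exactly one side
(`false_of_path`).

For part (2), among the weights of generalized denominator type dividing λ₁ one is divisible by all
others (`exists_maximal_weylScaling`). The denominator formula for scaled roots
(`schurPoly_eq_denomPoly`) turns divisibility of such weights into divisibility of Schur-Weyl
elements, so D(λ₁) is again some S(μ₁) (`exists_weylLcm_eq`). If λ₂ is not of denominator type
either, the argument of part (1) applies.

If λ₂ is of denominator type, S(λ₁)D(λ₂) = S(λ₂)S(μ₁), and over ℂ the right side is, up to a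
monomial, a product of factors 1 - ζe^{-γ}. These are prime in the group algebra of the root
lattice, so S(λ₁) is also such a product. Weyl symmetry makes its polynomial ∏(1 - e^{-a(γ)γ}) with
a Weyl invariant function a (`exists_eq_denomPoly_of_mul_eq`). The coefficient at an adjacent long
and short simple root leaves only a constant or a multiple of the dual scaling
(`scale_eq_or_of_adjacent`), so λ₁ would be of denominator type. -/

noncomputable section

namespace SchurWeyl

open Module

variable {ι M N : Type*} [AddCommGroup M] [Module ℝ M] [AddCommGroup N] [Module ℝ N]

/-! ### The Weyl group, its sign character, and the cone and form of the root system -/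

section WeylGroup

variable (P : RootPairing ι ℝ M N)

/-- The reflection in the root with index `i`, as an element of the Weyl group. -/
abbrev refl (i : ι) : P.weylGroup := RootPairing.weylGroup.ofIdx P i

theorem refl_smul (i : ι) (x : M) :
    refl P i • x = x - P.toLinearMap x (P.coroot i) • P.root i := rfl

theorem refl_smul_root (i j : ι) : refl P i • P.root j = P.root (P.reflectionPerm i j) :=
  (P.root_reflectionPerm i j).symm

variable {P}

theorem weyl_ext {w w' : P.weylGroup} (h : ∀ x : M, w • x = w' • x) : w = w' := by
  apply Subtype.ext
  apply RootPairing.Equiv.weightHom_injective P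
  exact LinearEquiv.ext h

theorem refl_mul_self (i : ι) : refl P i * refl P i = 1 := by
  apply weyl_ext
  intro x
  rw [mul_smul, one_smul]
  exact P.reflection_same i x

theorem refl_refl_smul (i : ι) (x : M) : refl P i • refl P i • x = x :=
  P.reflection_same i x

theorem refl_reflectionPerm (i j : ι) :
    refl P (P.reflectionPerm j i) = refl P j * refl P i * refl P j := by
  apply weyl_ext
  intro x
  rw [mul_smul, mul_smul]
  exact congrArg (fun f => f x) P.reflection_reflectionPerm

theorem weyl_smul_smul (w : P.weylGroup) (c : ℝ) (x : M) : w • (c • x) = c • (w • x) :=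
  smul_comm w c x

variable (P) in
/-- The determinant of an element of the Weyl group acting on the weight space. -/
def weylDet : P.weylGroup →* ℝ :=
  LinearMap.det.comp ((LinearEquiv.automorphismGroup.toLinearMapMonoidHom (R := ℝ) (M := M)).comp
    ((RootPairing.Equiv.weightHom P).comp P.weylGroup.subtype))

section Finite

variable [Fintype ι] {P : RootPairing ι ℝ M N} [P.IsRootSystem] [P.IsCrystallographic]
  [P.IsReduced]

theorem finite_weightSpace (b : P.Base) : Module.Finite ℝ M :=
  Module.Finite.of_basis b.toWeightBasis

theorem weylDet_refl (b : P.Base) (i : ι) : weylDet P (refl P i) = -1 := by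
  have := finite_weightSpace b
  have h : weylDet P (refl P i) =
      LinearMap.det (LinearMap.transvection (P.coroot' i) (-P.root i)) := by
    refine congrArg LinearMap.det (LinearMap.ext fun x => ?_)
    change refl P i • x = _
    rw [refl_smul, LinearMap.transvection.apply, smul_neg, sub_eq_add_neg]
    rfl
  rw [h, LinearMap.transvection.det, map_neg, P.root_coroot'_eq_pairing, P.pairing_same]
  norm_num

variable (P) in
/-- The product of the reflections with the given indices. -/
def wordProd (l : List ι) : P.weylGroup := (l.map (refl P)).prod

@[simp] theorem wordProd_nil : wordProd P [] = 1 := rfl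

@[simp] theorem wordProd_cons (i : ι) (l : List ι) :
    wordProd P (i :: l) = refl P i * wordProd P l := by simp [wordProd]

@[simp] theorem wordProd_append (l l' : List ι) :
    wordProd P (l ++ l') = wordProd P l * wordProd P l' := by simp [wordProd]

theorem exists_word (b : P.Base) (w : P.weylGroup) :
    ∃ l : List ι, (∀ i ∈ l, i ∈ b.support) ∧ wordProd P l = w := by
  obtain ⟨g, hg⟩ := w
  induction hg using RootPairing.weylGroup.induction with
  | mem i =>
    change ∃ l : List ι, (∀ i ∈ l, i ∈ b.support) ∧ wordProd P l = refl P i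
    refine b.induction_reflect i (p := fun i => ∃ l : List ι, (∀ i ∈ l, i ∈ b.support) ∧
      wordProd P l = refl P i) ?_ ?_ ?_
    · rintro i ⟨l, hl, h⟩
      -- Passing to the opposite root does not change the reflection, so the same word serves.
      refine ⟨l, hl, ?_⟩
      rw [refl_reflectionPerm, h, refl_mul_self, one_mul]
    · intro i hi
      exact ⟨[i], by simpa using hi, by simp⟩
    · rintro i j ⟨l, hl, h⟩ hj
      refine ⟨j :: l ++ [j], ?_, ?_⟩
      · intro k hk
        simp only [List.cons_append, List.mem_cons, List.mem_append, List.not_mem_nil,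
          or_false] at hk
        rcases hk with rfl | hk | rfl
        exacts [hj, hl _ hk, hj]
      · simp [refl_reflectionPerm, h, mul_assoc]
  | one => exact ⟨[], by simp, rfl⟩
  | mul x y hx hy h₁ h₂ =>
    obtain ⟨l, hl, h⟩ := h₁
    obtain ⟨l', hl', h'⟩ := h₂
    refine ⟨l ++ l', ?_, ?_⟩
    · intro k hk
      rcases List.mem_append.1 hk with hk | hk
      exacts [hl _ hk, hl' _ hk]
    · rw [wordProd_append, h, h']
      rfl

theorem weylDet_wordProd (b : P.Base) (l : List ι) :
    weylDet P (wordProd P l) = (-1) ^ l.length := by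
  induction l with
  | nil => simp
  | cons i l ih => rw [wordProd_cons, map_mul, ih, weylDet_refl b, List.length_cons, pow_succ']

/-- Each letter of a word contributes -1 to the determinant, so a word of minimal length computes
both sides. This makes ε multiplicative without any theory of reduced words. -/
theorem cast_sign (b : P.Base) (w : P.weylGroup) : (sign b w : ℝ) = weylDet P w := by
  obtain ⟨l, hl, h⟩ := exists_word b w
  have hne : {n | ∃ l : List ι, (∀ i ∈ l, i ∈ b.support) ∧ l.length = n ∧
    (l.map (RootPairing.weylGroup.ofIdx P)).prod = w}.Nonempty := ⟨l.length, l, hl, rfl, h⟩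
  obtain ⟨l', -, h₁, h₂⟩ := Nat.sInf_mem hne
  rw [← h₂]
  change _ = weylDet P (wordProd P l')
  rw [weylDet_wordProd b, h₁, h₂]
  simp [sign, length]

theorem sign_mul (b : P.Base) (w w' : P.weylGroup) :
    sign b (w * w') = sign b w * sign b w' := by
  have : (sign b (w * w') : ℝ) = (sign b w * sign b w' : ℤ) := by
    push_cast
    rw [cast_sign, cast_sign, cast_sign, map_mul]
  exact_mod_cast this

theorem sign_one (b : P.Base) : sign b (1 : P.weylGroup) = 1 := by
  have : (sign b (1 : P.weylGroup) : ℝ) = (1 : ℤ) := by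
    rw [cast_sign, map_one, Int.cast_one]
  exact_mod_cast this

theorem sign_refl (b : P.Base) (i : ι) : sign b (refl P i) = -1 := by
  have : (sign b (refl P i) : ℝ) = (-1 : ℤ) := by
    rw [cast_sign, weylDet_refl b, Int.cast_neg, Int.cast_one]
  exact_mod_cast this

theorem sign_mul_self (b : P.Base) (w : P.weylGroup) : sign b w * sign b w = 1 := by
  rw [sign, ← mul_pow]
  simp

/-! ### The cone of nonnegative integral combinations of simple roots -/

/-- The nonnegative integral combinations of the simple roots. -/
abbrev posCone (b : P.Base) : AddSubmonoid M := AddSubmonoid.closure (P.root '' b.support)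

/-- The coefficient of a vector at a simple root. -/
abbrev coord (b : P.Base) (i : b.support) : M →ₗ[ℝ] ℝ := b.toWeightBasis.coord i

/-- The sum of the coefficients of a vector at the simple roots. -/
def ht (b : P.Base) : M →ₗ[ℝ] ℝ := ∑ i, coord b i

/-- The combination of simple roots with the given coefficients. -/
def coneVec (b : P.Base) : (b.support →₀ ℕ) →+ M where
  toFun n := ∑ i, n i • P.root i
  map_zero' := by simp
  map_add' m n := by simp [add_smul, Finset.sum_add_distrib]

theorem coneVec_apply (b : P.Base) (n : b.support →₀ ℕ) :
    coneVec b n = ∑ i, n i • P.root i := rfl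

theorem coneVec_single (b : P.Base) (i : b.support) (n : ℕ) :
    coneVec b (Finsupp.single i n) = n • P.root i := by
  rw [coneVec_apply, Finset.sum_eq_single i]
  · simp
  · intro j _ hj
    simp [hj.symm]
  · simp

theorem mem_posCone_iff (b : P.Base) (x : M) : x ∈ posCone b ↔ ∃ n, coneVec b n = x := by
  constructor
  · intro h
    induction h using AddSubmonoid.closure_induction with
    | mem x hx =>
      obtain ⟨i, hi, rfl⟩ := hx
      exact ⟨Finsupp.single ⟨i, hi⟩ 1, by rw [coneVec_single, one_smul]⟩
    | zero => exact ⟨0, map_zero _⟩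
    | add x y _ _ hx hy =>
      obtain ⟨m, rfl⟩ := hx
      obtain ⟨n, rfl⟩ := hy
      exact ⟨m + n, map_add _ _ _⟩
  · rintro ⟨n, rfl⟩
    exact sum_mem fun i _ => nsmul_mem (AddSubmonoid.subset_closure (Set.mem_image_of_mem _ i.2)) _

theorem coord_root (b : P.Base) (i j : b.support) [Decidable (j = i)] :
    coord b i (P.root j) = if j = i then 1 else 0 := by
  rw [Basis.coord_apply, RootPairing.Base.toWeightBasis_repr_root, Finsupp.single_apply]

theorem coord_coneVec (b : P.Base) (n : b.support →₀ ℕ) (i : b.support) :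
    coord b i (coneVec b n) = n i := by
  classical
  simp only [coneVec_apply, map_sum, map_nsmul, coord_root, nsmul_eq_mul]
  simp

theorem coneVec_injective (b : P.Base) : Function.Injective (coneVec b) := by
  intro m n h
  ext i
  have := coord_coneVec b m i
  rw [h, coord_coneVec] at this
  exact_mod_cast this.symm

theorem coord_nonneg (b : P.Base) {x : M} (hx : x ∈ posCone b) (i : b.support) :
    0 ≤ coord b i x := by
  obtain ⟨n, rfl⟩ := (mem_posCone_iff b x).1 hx
  rw [coord_coneVec]
  positivity

theorem ht_apply (b : P.Base) (x : M) : ht b x = ∑ i, coord b i x := by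
  simp [ht]

theorem ht_nonneg (b : P.Base) {x : M} (hx : x ∈ posCone b) : 0 ≤ ht b x := by
  rw [ht_apply]
  exact Finset.sum_nonneg fun i _ => coord_nonneg b hx i

theorem eq_zero_of_ht_nonpos (b : P.Base) {x : M} (hx : x ∈ posCone b) (h : ht b x ≤ 0) :
    x = 0 := by
  have h0 : ∑ i, coord b i x = 0 := by
    rw [← ht_apply]
    exact le_antisymm h (ht_nonneg b hx)
  rw [Finset.sum_eq_zero_iff_of_nonneg fun i _ => coord_nonneg b hx i] at h0
  exact b.toWeightBasis.ext_elem fun i => by simpa using h0 i (Finset.mem_univ i)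

theorem posCone_antisymm (b : P.Base) {x : M} (hx : x ∈ posCone b) (h : -x ∈ posCone b) :
    x = 0 := by
  apply eq_zero_of_ht_nonpos b hx
  have := ht_nonneg b h
  rw [map_neg] at this
  linarith

theorem posCone_add_eq_zero (b : P.Base) {x y : M} (hx : x ∈ posCone b) (hy : y ∈ posCone b)
    (h : x + y = 0) : x = 0 :=
  posCone_antisymm b hx (by rwa [neg_eq_of_add_eq_zero_right h])

theorem height_eq_ht (b : P.Base) (i : ι) : (b.height i : ℝ) = ht b (P.root i) := by
  classical
  obtain ⟨f, -, -, h⟩ := b.exists_root_eq_sum_int i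
  rw [RootPairing.Base.height_eq_sum h, h, map_sum, Int.cast_sum]
  refine Finset.sum_congr rfl fun j hj => ?_
  have h1 : ht b (P.root j) = 1 := by
    rw [ht_apply, Finset.sum_congr rfl fun i _ => coord_root b i ⟨j, hj⟩]
    simp
  rw [map_zsmul, h1]
  simp

theorem isPos_iff_mem (b : P.Base) (i : ι) : b.IsPos i ↔ P.root i ∈ posCone b := by
  rw [b.isPos_iff, ← Int.cast_pos (R := ℝ), height_eq_ht]
  constructor
  · intro h
    refine (b.root_mem_or_neg_mem i).resolve_right fun h' => ?_
    have := ht_nonneg b h'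
    rw [map_neg] at this
    linarith
  · intro h
    refine (ht_nonneg b h).lt_of_ne fun h0 => P.ne_zero i (eq_zero_of_ht_nonpos b h h0.symm.le)

theorem not_isPos_iff_mem (b : P.Base) (i : ι) : ¬ b.IsPos i ↔ -P.root i ∈ posCone b := by
  rw [isPos_iff_mem]
  constructor
  · exact (b.root_mem_or_neg_mem i).resolve_left
  · intro h h'
    exact P.ne_zero i (posCone_antisymm b h' h)

theorem simple_mem_posCone (b : P.Base) {i : ι} (hi : i ∈ b.support) : P.root i ∈ posCone b :=
  AddSubmonoid.subset_closure (Set.mem_image_of_mem _ hi)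

/-! ### The invariant form -/

/-- This is ⟨x, α*⟩ = 2(x, α)/(α, α) cleared of denominators, the bridge between pairings and
lengths. -/
theorem two_form_root (x : M) (i : ι) :
    2 * P.RootForm x (P.root i) =
      P.toLinearMap x (P.coroot i) * P.RootForm (P.root i) (P.root i) := by
  have h := congrArg (P.toLinearMap x) (P.rootForm_self_smul_coroot i)
  rw [map_smul, map_nsmul, P.toLinearMap_apply_apply_Polarization, smul_eq_mul, nsmul_eq_mul] at h
  rw [mul_comm (P.toLinearMap x _), h, ← P.rootForm_symmetric.eq]
  simp

theorem form_smul (w : P.weylGroup) (x y : M) :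
    P.RootForm (w • x) (w • y) = P.RootForm x y :=
  RootPairing.InvariantForm.apply_weylGroup_smul P (B := P.toInvariantForm) w x y

theorem rootNormSq_pos (i : ι) : 0 < rootNormSq P i :=
  P.rootForm_pos_of_ne_zero (by simp) (P.ne_zero i)

theorem form_pos {x : M} (hx : x ≠ 0) : 0 < P.RootForm x x :=
  P.rootForm_pos_of_ne_zero (by simp) hx

theorem pairing_smul {w : P.weylGroup} {i j : ι} (h : w • P.root i = P.root j) (x : M) :
    P.toLinearMap (w • x) (P.coroot j) = P.toLinearMap x (P.coroot i) := by
  have h₁ := two_form_root (P := P) (w • x) j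
  rw [← h, form_smul, form_smul, two_form_root] at h₁
  exact (mul_right_cancel₀ (rootNormSq_pos (P := P) i).ne' h₁).symm

theorem rootNormSq_eq {w : P.weylGroup} {i j : ι} (h : w • P.root i = P.root j) :
    rootNormSq P j = rootNormSq P i := by
  rw [rootNormSq, ← h, form_smul, rootNormSq]

theorem mul_refl {w : P.weylGroup} {i j : ι} (h : w • P.root i = P.root j) :
    w * refl P i = refl P j * w := by
  apply weyl_ext
  intro x
  rw [mul_smul, mul_smul, refl_smul, refl_smul, smul_sub, weyl_smul_smul, pairing_smul h, h]

end Finite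
end WeylGroup

/-! ### Orbits of dominant weights and conjugacy of roots of equal length -/

section Dominance

variable [Fintype ι] {P : RootPairing ι ℝ M N} [P.IsRootSystem] [P.IsCrystallographic]
  [P.IsReduced]

theorem exists_smul_root (w : P.weylGroup) (i : ι) : ∃ j, w • P.root i = P.root j :=
  ⟨_, P.weylGroup_apply_root w i⟩

/-- The exchange property: a word which makes a simple root negative can be shortened. -/
theorem exists_shorter_word (b : P.Base) {i : ι} (hi : i ∈ b.support) (l : List ι)
    (hl : ∀ j ∈ l, j ∈ b.support) (h : -(wordProd P l • P.root i) ∈ posCone b) :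
    ∃ l' : List ι, (∀ j ∈ l', j ∈ b.support) ∧ l'.length + 1 = l.length ∧
      wordProd P l' = wordProd P l * refl P i := by
  induction l with
  | nil =>
    rw [wordProd_nil, one_smul] at h
    exact absurd (posCone_antisymm b (simple_mem_posCone b hi) h) (P.ne_zero i)
  | cons j t ih =>
    obtain ⟨hj, ht⟩ := List.forall_mem_cons.1 hl
    obtain ⟨k, hk⟩ := exists_smul_root (wordProd P t) i
    -- If the tail t keeps α_i positive, the letter j is the one that changes the sign. As s_j
    -- permutes the positive roots other than α_j, this forces tα_i = α_j, so s_j can be moved to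
    -- the end and cancels there. Otherwise the deletion takes place inside t.
    by_cases hpos : b.IsPos k
    · have hkj : k = j := by
        by_contra hne
        have h1 := (isPos_iff_mem b _).1 (hpos.reflectionPerm hj hne)
        rw [wordProd_cons, mul_smul, hk, refl_smul_root] at h
        exact P.ne_zero _ (posCone_antisymm b h1 h)
      subst hkj
      refine ⟨t, ht, rfl, ?_⟩
      rw [wordProd_cons, ← mul_refl hk, mul_assoc, refl_mul_self, mul_one]
    · obtain ⟨l', h1, h2, h3⟩ := ih ht (by rw [hk]; exact (not_isPos_iff_mem b k).1 hpos)
      refine ⟨j :: l', List.forall_mem_cons.2 ⟨hj, h1⟩, by simp [h2], ?_⟩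
      rw [wordProd_cons, wordProd_cons, h3, mul_assoc]

/-- A word in the simple reflections all of whose proper suffixes are reduced in the sense that
the simple roots they are applied to stay positive. -/
theorem weyl_induction (b : P.Base) {p : P.weylGroup → Prop} (one : p 1)
    (mul : ∀ (w : P.weylGroup), ∀ i ∈ b.support, w • P.root i ∈ posCone b → p w →
      p (w * refl P i)) (w : P.weylGroup) : p w := by
  -- Induction on the length of a word of minimal length; minimality is inherited by prefixes.
  suffices h : ∀ (n : ℕ) (l : List ι), l.length = n → (∀ j ∈ l, j ∈ b.support) →
      (∀ l' : List ι, (∀ j ∈ l', j ∈ b.support) → wordProd P l' = wordProd P l →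
        l.length ≤ l'.length) → p (wordProd P l) by
    have hne : {n | ∃ l : List ι, (∀ i ∈ l, i ∈ b.support) ∧ l.length = n ∧
        wordProd P l = w}.Nonempty := by
      obtain ⟨l, hl, hw⟩ := exists_word b w
      exact ⟨l.length, l, hl, rfl, hw⟩
    obtain ⟨l, hl, hn, rfl⟩ := Nat.sInf_mem hne
    exact h _ l rfl hl fun l' hl' hw => hn ▸ Nat.sInf_le ⟨l', hl', rfl, hw⟩
  intro n
  induction n with
  | zero =>
    intro l hl _ _
    rw [List.length_eq_zero_iff.1 hl]
    exact one
  | succ n ih =>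
    intro l hn hl hmin
    obtain rfl | ⟨t, i, rfl⟩ := List.eq_nil_or_concat' l
    · simp at hn
    have ht : ∀ j ∈ t, j ∈ b.support := fun j hj => hl j (by simp [hj])
    have hi : i ∈ b.support := hl i (by simp)
    have htn : t.length = n := by simpa using hn
    rw [wordProd_append, wordProd_cons, wordProd_nil, mul_one]
    refine mul _ i hi ?_ (ih t htn ht fun l' hl' hw => ?_)
    · obtain ⟨k, hk⟩ := exists_smul_root (wordProd P t) i
      rw [hk, ← isPos_iff_mem]
      -- If t made α_i negative, the exchange property would represent the product by a word two
      -- letters shorter.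
      by_contra hneg
      obtain ⟨l', h1, h2, h3⟩ := exists_shorter_word b hi t ht
        (by rw [hk]; exact (not_isPos_iff_mem b k).1 hneg)
      have := hmin l' h1 (by simp [h3])
      rw [hn] at this
      omega
    · have := hmin (l' ++ [i]) (by
        intro j hj
        rcases List.mem_append.1 hj with hj | hj
        · exact hl' j hj
        · simp at hj
          exact hj ▸ hi) (by simp [hw])
      simpa using this

theorem mult_eq_natCast {b : P.Base} {x : weightLattice P}
    (hx : ∀ i ∈ b.support, 0 ≤ mult x i) {i : ι} (hi : i ∈ b.support) :
    ∃ n : ℕ, mult x i = n := Int.eq_ofNat_of_zero_le (hx i hi)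

/-- A dominant weight is the largest weight of its orbit. -/
theorem sub_smul_mem_posCone (b : P.Base) (x : weightLattice P)
    (hx : ∀ i ∈ b.support, 0 ≤ mult x i) (w : P.weylGroup) : (x : M) - w • (x : M) ∈ posCone b := by
  induction w using weyl_induction b with
  | one => rw [one_smul, sub_self]; exact zero_mem _
  | mul w i hi hw ih =>
    obtain ⟨n, hn⟩ := mult_eq_natCast hx hi
    have : (x : M) - (w * refl P i) • (x : M) = (x - w • (x : M)) + n • (w • P.root i) := by
      rw [mul_smul, refl_smul, mult_spec, hn, smul_sub, weyl_smul_smul, Int.cast_natCast,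
        Nat.cast_smul_eq_nsmul]
      abel
    rw [this]
    exact add_mem ih (nsmul_mem hw _)

/-- The stabilizer of a dominant regular weight is trivial. -/
theorem eq_one_of_smul_eq (b : P.Base) {x : weightLattice P} (hx : IsDominantRegular b x)
    {w : P.weylGroup} (h : w • (x : M) = x) : w = 1 := by
  revert h
  induction w using weyl_induction b with
  | one => exact fun _ => rfl
  | mul w i hi hw ih =>
    intro h
    obtain ⟨n, hn⟩ := mult_eq_natCast hx.1 hi
    have hn0 : n ≠ 0 := fun h0 => hx.2 i hi (by rw [hn, h0]; rfl)
    have h1 : n • (w • P.root i) + ((x : M) - w • (x : M)) = 0 := by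
      have : (x : M) - (w * refl P i) • (x : M) = (x - w • (x : M)) + n • (w • P.root i) := by
        rw [mul_smul, refl_smul, mult_spec, hn, smul_sub, weyl_smul_smul, Int.cast_natCast,
          Nat.cast_smul_eq_nsmul]
        abel
      rw [add_comm, ← this, h, sub_self]
    -- Two elements of the pointed cone with sum zero both vanish, but n > 0 and wα_i is a root; so
    -- ws_i cannot fix x.
    have h2 := posCone_add_eq_zero b (nsmul_mem hw n) (sub_smul_mem_posCone b x hx.1 w) h1
    obtain ⟨j, hj⟩ := exists_smul_root w i
    rw [hj, ← Nat.cast_smul_eq_nsmul ℝ, smul_eq_zero] at h2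
    rcases h2 with h2 | h2
    · exact absurd (by exact_mod_cast h2) hn0
    · exact absurd h2 (P.ne_zero j)

theorem exists_simple_smul_eq (b : P.Base) (j : ι) :
    ∃ i ∈ b.support, ∃ w : P.weylGroup, w • P.root i = P.root j := by
  refine b.induction_reflect j
    (p := fun j => ∃ i ∈ b.support, ∃ w : P.weylGroup, w • P.root i = P.root j) ?_ ?_ ?_
  · rintro j ⟨i, hi, w, hw⟩
    exact ⟨i, hi, refl P j * w, by rw [mul_smul, hw, refl_smul_root]⟩
  · intro i hi
    exact ⟨i, hi, 1, one_smul _ _⟩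
  · rintro j k ⟨i, hi, w, hw⟩ -
    exact ⟨i, hi, refl P k * w, by rw [mul_smul, hw, refl_smul_root]⟩

/-- Roots of the same length of an irreducible root system are conjugate. -/
theorem exists_smul_eq_of_rootNormSq_eq [P.IsIrreducible] {i j : ι}
    (h : rootNormSq P i = rootNormSq P j) : ∃ w : P.weylGroup, w • P.root i = P.root j := by
  -- By irreducibility the orbit of a root spans the space, so some conjugate is not orthogonal to
  -- the target.
  obtain ⟨w, hw⟩ : ∃ w : P.weylGroup, P.RootForm (P.root j) (w • P.root i) ≠ 0 := by
    by_contra! hc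
    have : Submodule.span ℝ (MulAction.orbit P.weylGroup (P.root i)) ≤
        LinearMap.ker (P.RootForm (P.root j)) := by
      refine Submodule.span_le.2 ?_
      rintro v ⟨g, rfl⟩
      exact hc g
    rw [P.span_orbit_eq_top] at this
    exact (rootNormSq_pos (P := P) j).ne' (this (Submodule.mem_top (x := P.root j)))
  obtain ⟨k, hk⟩ := exists_smul_root w i
  rw [hk] at hw
  suffices h' : ∃ w : P.weylGroup, w • P.root k = P.root j by
    obtain ⟨w', hw'⟩ := h'
    exact ⟨w' * w, by rw [mul_smul, hk, hw']⟩
  have hnorm : P.RootForm (P.root k) (P.root k) = P.RootForm (P.root j) (P.root j) := by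
    rw [← rootNormSq, ← rootNormSq, rootNormSq_eq hk, h]
  by_cases h1 : k = j
  · exact ⟨1, by rw [one_smul, h1]⟩
  by_cases h2 : P.root k = -P.root j
  · exact ⟨refl P j, by
      rw [h2, smul_neg, refl_smul_root, P.root_reflectionPerm, P.reflection_apply_self, neg_neg]⟩
  -- Roots of equal length that are neither equal nor opposite nor orthogonal have both pairings 1
  -- or both -1; a product of the two reflections then carries one root to the other.
  have h3 := P.pairingIn_pairingIn_mem_set_of_length_eq_of_ne (B := P.toInvariantForm) hnorm h1 h2
  have h4 : P.pairingIn ℤ k j ≠ 0 := by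
    intro h0
    have h5 := two_form_root (P := P) (P.root k) j
    rw [P.root_coroot_eq_pairing, ← P.algebraMap_pairingIn ℤ, h0, map_zero, zero_mul] at h5
    apply hw
    rw [← P.rootForm_symmetric.eq]
    simpa using h5
  have key (a c : ι) : refl P a • P.root c = P.root c - (P.pairingIn ℤ c a : ℝ) • P.root a := by
    rw [refl_smul, P.root_coroot_eq_pairing, ← P.algebraMap_pairingIn ℤ]
    rfl
  simp only [Set.mem_insert_iff, Set.mem_singleton_iff, Prod.mk.injEq] at h3
  rcases h3 with h3 | h3 | h3
  · exact absurd h3.1 h4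
  · refine ⟨refl P j * (refl P k * refl P j), ?_⟩
    rw [mul_smul, mul_smul, key j k, h3.1, smul_sub, weyl_smul_smul, key k j, h3.2, key k k]
    simp
    module
  · refine ⟨refl P k * refl P j, ?_⟩
    rw [mul_smul, key j k, h3.1, smul_sub, weyl_smul_smul, key k j, h3.2, key k k]
    simp
    module

end Dominance

/-! ### Schur-Weyl elements as polynomials in the exponentials of negative simple roots -/

section Algebra

variable [Fintype ι] {P : RootPairing ι ℝ M N} [P.IsRootSystem] [P.IsCrystallographic]
  [P.IsReduced]

instance fintype_weylGroup : Fintype P.weylGroup := Fintype.ofFinite _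

section Ambient

variable (k : Type*) [CommRing k]

variable (M) in
instance twoUniqueSums_real : TwoUniqueSums M := by
  let : Module ℚ M := Module.compHom M (algebraMap ℚ ℝ)
  infer_instance

variable (P) in
/-- The embedding of the group algebra of the weight lattice into that of the whole space. -/
def toAmbient : WeightAlgebra P →+* AddMonoidAlgebra k M :=
  (AddMonoidAlgebra.mapRingHom M (Int.castRingHom k)).comp
    (AddMonoidAlgebra.mapDomainRingHom ℤ (weightLattice P).subtype)

theorem toAmbient_single (x : weightLattice P) (n : ℤ) :
    toAmbient P k (AddMonoidAlgebra.single x n) = AddMonoidAlgebra.single (x : M) (n : k) := by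
  simp [toAmbient]

theorem toAmbient_injective [CharZero k] : Function.Injective (toAmbient P k) := by
  rw [toAmbient, RingHom.coe_comp]
  apply Function.Injective.comp
  · exact AddMonoidAlgebra.map_injective _ (Int.cast_injective)
  · exact AddMonoidAlgebra.mapDomain_injective Subtype.val_injective

/-- The image of a Schur-Weyl element in the group algebra of the whole space. -/
def schurAmbient (b : P.Base) (x : M) : AddMonoidAlgebra k M :=
  ∑ w : P.weylGroup, AddMonoidAlgebra.single (w • x) (sign b w : k)

theorem toAmbient_schurWeyl (b : P.Base) (x : weightLattice P) :
    toAmbient P k (schurWeyl b x) = schurAmbient k b (x : M) := by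
  rw [schurWeyl, map_sum, schurAmbient]
  exact Finset.sum_congr rfl fun w _ => toAmbient_single k _ _

/-- The embedding of the polynomial ring into the group algebra which maps the variables to the
exponentials of the negatives of the simple roots. -/
def incl (b : P.Base) : MvPolynomial b.support k →+* AddMonoidAlgebra k M :=
  AddMonoidAlgebra.mapDomainRingHom k (-coneVec b)

variable {k}

theorem incl_monomial (b : P.Base) (n : b.support →₀ ℕ) (c : k) :
    incl k b (MvPolynomial.monomial n c) = AddMonoidAlgebra.single (-coneVec b n) c :=
  AddMonoidAlgebra.mapDomain_single

theorem incl_injective (b : P.Base) : Function.Injective (incl k b) := by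
  refine AddMonoidAlgebra.mapDomain_injective fun _ _ h => ?_
  exact coneVec_injective b (neg_injective h)

theorem coeff_incl (b : P.Base) (p : MvPolynomial b.support k) (n : b.support →₀ ℕ) :
    (incl k b p).coeff (-coneVec b n) = p.coeff n :=
  Finsupp.mapDomain_apply (f := (-coneVec b : (b.support →₀ ℕ) →+ M))
    (fun _ _ h => coneVec_injective b (neg_injective h)) _ _

theorem exists_of_coeff_incl_ne_zero (b : P.Base) (p : MvPolynomial b.support k) {x : M}
    (h : (incl k b p).coeff x ≠ 0) : ∃ n, x = -coneVec b n := by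
  by_contra! hc
  exact h (Finsupp.mapDomain_of_notMem_range _ _ fun ⟨n, hn⟩ => hc n hn.symm)

theorem coeff_single_mul' (x z : M) (c : k) (f : AddMonoidAlgebra k M) :
    (AddMonoidAlgebra.single x c * f).coeff z = c * f.coeff (z - x) := by
  rw [AddMonoidAlgebra.coeff_single_mul_eq_mul_coeff (z - x)]
  intro y _
  rw [add_comm, eq_sub_iff_add_eq]

/-- Comparison of leading monomials. -/
theorem leading_cancel [Nontrivial k] (b : P.Base) {x y : M} {c : k} (hc : c ≠ 0)
    {p q : MvPolynomial b.support k} (hp : MvPolynomial.constantCoeff p = 1)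
    (hq : MvPolynomial.constantCoeff q = 1)
    (h : AddMonoidAlgebra.single x c * incl k b p = AddMonoidAlgebra.single y 1 * incl k b q) :
    x = y ∧ c = 1 ∧ p = q := by
  have hp0 : (incl k b p).coeff 0 = 1 := by
    have := coeff_incl b p 0
    rwa [map_zero, neg_zero, ← MvPolynomial.constantCoeff_eq, hp] at this
  have hq0 : (incl k b q).coeff 0 = 1 := by
    have := coeff_incl b q 0
    rwa [map_zero, neg_zero, ← MvPolynomial.constantCoeff_eq, hq] at this
  have h1 := congrArg (fun f => f.coeff x) h
  have h2 := congrArg (fun f => f.coeff y) h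
  simp only [coeff_single_mul', sub_self, hp0, hq0, mul_one, one_mul] at h1 h2
  -- Each of the two leading weights occurs on the other side, so their difference and its negative
  -- both lie in the pointed cone.
  obtain ⟨m, hm⟩ := exists_of_coeff_incl_ne_zero b q (h1 ▸ hc)
  obtain ⟨n, hn⟩ := exists_of_coeff_incl_ne_zero b p
    (show (incl k b p).coeff (y - x) ≠ 0 from fun h0 => by simp [h0] at h2)
  have hxy : x = y := by
    have h3 : y - x = 0 := by
      apply posCone_antisymm b
      · exact (mem_posCone_iff b _).2 ⟨m, by rw [← neg_sub, hm, neg_neg]⟩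
      · exact (mem_posCone_iff b _).2 ⟨n, by rw [hn, neg_neg]⟩
    exact (sub_eq_zero.1 h3).symm
  subst hxy
  have hc1 : c = 1 := by rw [h1, sub_self, hq0]
  refine ⟨rfl, hc1, incl_injective b ?_⟩
  rw [hc1] at h
  have h4 := congrArg (fun f => AddMonoidAlgebra.single (-x) (1 : k) * f) h
  simpa [← mul_assoc, AddMonoidAlgebra.single_mul_single, ← AddMonoidAlgebra.one_def] using h4

end Ambient

/-! ### The polynomial attached to a Schur-Weyl element -/

/-- The coefficients of an element of the cone at the simple roots. -/
def coneCoeff (b : P.Base) : M → b.support →₀ ℕ := Function.invFun (coneVec b)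

theorem coneVec_coneCoeff (b : P.Base) {x : M} (hx : x ∈ posCone b) :
    coneVec b (coneCoeff b x) = x :=
  Function.invFun_eq ((mem_posCone_iff b x).1 hx)

variable (k : Type*) [CommRing k]

/-- The polynomial in the exponentials of the negatives of the simple roots obtained from a
Schur-Weyl element on dividing by the leading monomial. -/
def schurPoly (b : P.Base) (x : weightLattice P) : MvPolynomial b.support k :=
  ∑ w : P.weylGroup, MvPolynomial.monomial (coneCoeff b ((x : M) - w • (x : M))) (sign b w : k)

theorem schurAmbient_eq (b : P.Base) {x : weightLattice P} (hx : IsDominantRegular b x) :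
    schurAmbient k b (x : M) =
      AddMonoidAlgebra.single (x : M) 1 * incl k b (schurPoly k b x) := by
  rw [schurAmbient, schurPoly, map_sum, Finset.mul_sum]
  refine Finset.sum_congr rfl fun w _ => ?_
  rw [incl_monomial, coneVec_coneCoeff b (sub_smul_mem_posCone b x hx.1 w),
    AddMonoidAlgebra.single_mul_single, one_mul]
  congr 1
  abel

theorem map_schurPoly {l : Type*} [CommRing l] (f : k →+* l) (b : P.Base) (x : weightLattice P) :
    MvPolynomial.map f (schurPoly k b x) = schurPoly l b x := by
  simp [schurPoly]

variable {k}

theorem coneCoeff_sub_eq_iff (b : P.Base) {x : weightLattice P} (hx : IsDominantRegular b x)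
    (w : P.weylGroup) (n : b.support →₀ ℕ) :
    coneCoeff b ((x : M) - w • (x : M)) = n ↔ w • (x : M) = x - coneVec b n := by
  rw [← (coneVec_injective b).eq_iff, coneVec_coneCoeff b (sub_smul_mem_posCone b x hx.1 w)]
  constructor
  · intro h
    rw [← h]
    abel
  · intro h
    rw [h]
    abel

theorem smul_injective_of_regular (b : P.Base) {x : weightLattice P} (hx : IsDominantRegular b x)
    {w w' : P.weylGroup} (h : w • (x : M) = w' • (x : M)) : w = w' := by
  have : (w'⁻¹ * w) • (x : M) = x := by rw [mul_smul, h, inv_smul_smul]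
  have := eq_one_of_smul_eq b hx this
  rwa [inv_mul_eq_one, eq_comm] at this

/-- The weights wx are distinct because the stabilizer of x is trivial, so a single Weyl group
element contributes. -/
theorem coeff_schurPoly (b : P.Base) {x : weightLattice P} (hx : IsDominantRegular b x)
    {w : P.weylGroup} {n : b.support →₀ ℕ} (h : w • (x : M) = x - coneVec b n) :
    (schurPoly k b x).coeff n = sign b w := by
  classical
  rw [schurPoly, MvPolynomial.coeff_sum, Finset.sum_eq_single w]
  · rw [MvPolynomial.coeff_monomial, if_pos ((coneCoeff_sub_eq_iff b hx w n).2 h)]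
  · intro w' _ hw'
    rw [MvPolynomial.coeff_monomial, if_neg]
    intro h'
    exact hw' (smul_injective_of_regular b hx (((coneCoeff_sub_eq_iff b hx w' n).1 h').trans h.symm))
  · simp

theorem exists_of_coeff_schurPoly_ne_zero (b : P.Base) {x : weightLattice P}
    (hx : IsDominantRegular b x) {n : b.support →₀ ℕ} (h : (schurPoly k b x).coeff n ≠ 0) :
    ∃ w : P.weylGroup, w • (x : M) = x - coneVec b n := by
  classical
  by_contra! hc
  apply h
  rw [schurPoly, MvPolynomial.coeff_sum]
  refine Finset.sum_eq_zero fun w _ => ?_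
  rw [MvPolynomial.coeff_monomial, if_neg]
  exact fun h' => hc w ((coneCoeff_sub_eq_iff b hx w n).1 h')

theorem constantCoeff_schurPoly (b : P.Base) {x : weightLattice P} (hx : IsDominantRegular b x) :
    MvPolynomial.constantCoeff (schurPoly k b x) = 1 := by
  rw [MvPolynomial.constantCoeff_eq, coeff_schurPoly b hx (w := 1) (by simp), sign_one,
    Int.cast_one]

/-- Expand (x - n, x - n) = (x, x), which holds since x - n is in the orbit of x. This quadratic
condition is what controls the low monomials. -/
theorem form_coneVec_eq (b : P.Base) {x : weightLattice P} (hx : IsDominantRegular b x)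
    {n : b.support →₀ ℕ} (h : (schurPoly k b x).coeff n ≠ 0) :
    P.RootForm (coneVec b n) (coneVec b n) = 2 * P.RootForm x (coneVec b n) := by
  obtain ⟨w, hw⟩ := exists_of_coeff_schurPoly_ne_zero b hx h
  have h1 := form_smul w (x : M) (x : M)
  rw [hw] at h1
  simp only [map_sub, LinearMap.sub_apply] at h1
  have h2 : P.RootForm (coneVec b n) x = P.RootForm x (coneVec b n) := P.rootForm_symmetric.eq _ _
  linarith

theorem simple_form_nonpos (b : P.Base) {i j : b.support} (hij : i ≠ j) :
    P.RootForm (P.root i) (P.root j) ≤ 0 := by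
  have h1 := two_form_root (P := P) (P.root i) j
  have h2 := b.pairingIn_le_zero_of_ne (Subtype.coe_injective.ne hij) i.2 j.2
  have h3 : (P.pairingIn ℤ i j : ℝ) ≤ 0 := by exact_mod_cast h2
  rw [P.root_coroot_eq_pairing, ← P.algebraMap_pairingIn ℤ] at h1
  have h4 := mul_nonpos_of_nonpos_of_nonneg h3 (rootNormSq_pos (P := P) j).le
  change _ = (P.pairingIn ℤ i j : ℝ) * rootNormSq P j at h1
  linarith

/-- A coefficient in the box bounded by the coefficients of the weight can only be nonzero at an
independent set of simple roots. -/
theorem coeff_schurPoly_of_le (b : P.Base) {x : weightLattice P} (hx : IsDominantRegular b x)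
    {n : b.support →₀ ℕ} (h : (schurPoly k b x).coeff n ≠ 0) (hn : ∀ i, (n i : ℤ) ≤ mult x i) :
    (∀ i, n i = 0 ∨ (n i : ℤ) = mult x i) ∧
      ∀ i j, i ≠ j → n i ≠ 0 → n j ≠ 0 → P.RootForm (P.root i) (P.root j) = 0 := by
  classical
  have h1 := form_coneVec_eq b hx h
  have h2 : 2 * P.RootForm (x : M) (coneVec b n) =
      ∑ i, (n i : ℝ) * mult x i * rootNormSq P i := by
    rw [coneVec_apply, map_sum, Finset.mul_sum]
    refine Finset.sum_congr rfl fun i _ => ?_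
    rw [map_nsmul, nsmul_eq_mul, mul_left_comm, two_form_root, mult_spec, mul_assoc]
    rfl
  have h3 : P.RootForm (coneVec b n) (coneVec b n) =
      ∑ i, ∑ j, (n i : ℝ) * n j * P.RootForm (P.root i) (P.root j) := by
    rw [coneVec_apply, map_sum, Finset.sum_comm]
    refine Finset.sum_congr rfl fun j _ => ?_
    rw [map_sum P.RootForm, LinearMap.sum_apply]
    refine Finset.sum_congr rfl fun i _ => ?_
    simp only [map_nsmul, LinearMap.smul_apply, nsmul_eq_mul]
    ring
  have h4 : ∑ i, ∑ j, (n i : ℝ) * n j * P.RootForm (P.root i) (P.root j) =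
      ∑ i, (n i : ℝ) * n i * rootNormSq P i +
        ∑ i, ∑ j ∈ Finset.univ.erase i, (n i : ℝ) * n j * P.RootForm (P.root i) (P.root j) := by
    rw [← Finset.sum_add_distrib]
    refine Finset.sum_congr rfl fun i _ => ?_
    rw [← Finset.add_sum_erase _ _ (Finset.mem_univ i)]
    rfl
  -- The length condition is now a vanishing sum whose terms are all nonnegative: the diagonal ones
  -- because n lies in the box, the others because distinct simple roots have nonpositive inner
  -- product. Hence every term vanishes.
  have h5 : ∑ i, (n i : ℝ) * ((mult x i : ℝ) - n i) * rootNormSq P i +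
      ∑ i, ∑ j ∈ Finset.univ.erase i,
        -((n i : ℝ) * n j * P.RootForm (P.root i) (P.root j)) = 0 := by
    have : ∑ i : b.support, (n i : ℝ) * ((mult x i : ℝ) - n i) * rootNormSq P i =
        ∑ i : b.support, (n i : ℝ) * mult x i * rootNormSq P i -
          ∑ i : b.support, (n i : ℝ) * n i * rootNormSq P i := by
      rw [← Finset.sum_sub_distrib]
      exact Finset.sum_congr rfl fun i _ => by ring
    rw [this]
    simp only [Finset.sum_neg_distrib]
    linarith
  have hA : ∀ i : b.support, 0 ≤ (n i : ℝ) * ((mult x i : ℝ) - n i) * rootNormSq P i := by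
    intro i
    have : (n i : ℝ) ≤ mult x i := by exact_mod_cast hn i
    exact mul_nonneg (mul_nonneg (Nat.cast_nonneg _) (by linarith)) (rootNormSq_pos _).le
  have hB : ∀ i : b.support, ∀ j ∈ Finset.univ.erase i,
      0 ≤ -((n i : ℝ) * n j * P.RootForm (P.root i) (P.root j)) := by
    intro i j hj
    have := simple_form_nonpos b (Finset.ne_of_mem_erase hj).symm
    rw [← mul_neg]
    exact mul_nonneg (by positivity) (by linarith)
  have hB' := fun i => Finset.sum_nonneg (hB i)
  rw [add_eq_zero_iff_of_nonneg (Finset.sum_nonneg fun i _ => hA i)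
    (Finset.sum_nonneg fun i _ => hB' i),
    Finset.sum_eq_zero_iff_of_nonneg fun i _ => hA i,
    Finset.sum_eq_zero_iff_of_nonneg fun i _ => hB' i] at h5
  constructor
  · intro i
    have := h5.1 i (Finset.mem_univ i)
    rw [mul_eq_zero, mul_eq_zero] at this
    rcases this with (h | h) | h
    · exact Or.inl (by exact_mod_cast h)
    · right
      have : (mult x i : ℝ) = n i := by linarith
      exact_mod_cast this.symm
    · exact absurd h (rootNormSq_pos _).ne'
  · intro i j hij hi hj
    have := h5.2 i (Finset.mem_univ i)
    rw [Finset.sum_eq_zero_iff_of_nonneg (hB i)] at this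
    have := this j (Finset.mem_erase.2 ⟨hij.symm, Finset.mem_univ j⟩)
    simpa [hi, hj] using this

/-- The coefficient at an independent set of simple roots does not vanish. -/
theorem exists_smul_eq_of_orthogonal (b : P.Base) (x : weightLattice P) (T : Finset b.support)
    (hT : ∀ i ∈ T, ∀ j ∈ T, i ≠ j → P.RootForm (P.root i) (P.root j) = 0) :
    ∃ w : P.weylGroup, w • (x : M) = x - ∑ i ∈ T, mult x i • P.root i := by
  classical
  induction T using Finset.induction with
  | empty => exact ⟨1, by simp⟩
  | insert j T hj ih =>
    obtain ⟨w, hw⟩ := ih fun i hi i' hi' => hT i (Finset.mem_insert_of_mem hi) i'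
      (Finset.mem_insert_of_mem hi')
    refine ⟨refl P j * w, ?_⟩
    -- The earlier subtractions are orthogonal to α_j, so s_j still subtracts exactly m_j α_j.
    have h0 : P.toLinearMap (∑ i ∈ T, mult x i • P.root i) (P.coroot j) = 0 := by
      rw [map_sum, LinearMap.sum_apply]
      refine Finset.sum_eq_zero fun i hi => ?_
      rw [map_zsmul, LinearMap.smul_apply, P.root_coroot_eq_pairing]
      have := hT i (Finset.mem_insert_of_mem hi) j (Finset.mem_insert_self _ _)
        (by rintro rfl; exact hj hi)
      rw [RootPairing.InvariantForm.apply_root_root_zero_iff P.toInvariantForm i j |>.1 this,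
        smul_zero]
    rw [mul_smul, hw, refl_smul, map_sub, LinearMap.sub_apply, h0, mult_spec,
      Finset.sum_insert hj, sub_zero, Int.cast_smul_eq_zsmul]
    abel

end Algebra

/-! ### Multiplicative relations and restriction to one simple root -/

section Quotients

variable [Fintype ι] {P : RootPairing ι ℝ M N} [P.IsRootSystem] [P.IsCrystallographic]
  [P.IsReduced]

theorem mult_add (x y : weightLattice P) (i : ι) : mult (x + y) i = mult x i + mult y i := by
  have : (mult (x + y) i : ℝ) = (mult x i + mult y i : ℤ) := by
    rw [← mult_spec, Int.cast_add, ← mult_spec, ← mult_spec]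
    simp
  exact_mod_cast this

theorem eq_of_mult_eq (b : P.Base) {x y : weightLattice P}
    (h : ∀ i ∈ b.support, mult x i = mult y i) : x = y := by
  apply Subtype.ext
  apply P.toPerfPair.injective
  refine b.toCoweightBasis.ext fun i => ?_
  rw [RootPairing.Base.toCoweightBasis_apply]
  change P.toLinearMap x _ = P.toLinearMap y _
  rw [mult_spec, mult_spec, h i i.2]

/-- The multiplication of Schur-Weyl elements in terms of the associated polynomials. -/
theorem schurPoly_mul_eq (b : P.Base) {x₁ x₂ x₃ x₄ : weightLattice P}
    (h₁ : IsDominantRegular b x₁) (h₂ : IsDominantRegular b x₂) (h₃ : IsDominantRegular b x₃)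
    (h₄ : IsDominantRegular b x₄)
    (h : schurWeyl b x₁ * schurWeyl b x₂ = schurWeyl b x₃ * schurWeyl b x₄) :
    x₁ + x₂ = x₃ + x₄ ∧ schurPoly ℤ b x₁ * schurPoly ℤ b x₂ =
      schurPoly ℤ b x₃ * schurPoly ℤ b x₄ := by
  have h' := congrArg (toAmbient P ℤ) h
  simp only [map_mul, toAmbient_schurWeyl, schurAmbient_eq ℤ b h₁, schurAmbient_eq ℤ b h₂,
    schurAmbient_eq ℤ b h₃, schurAmbient_eq ℤ b h₄] at h'
  rw [mul_mul_mul_comm, mul_mul_mul_comm (AddMonoidAlgebra.single (x₃ : M) 1),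
    AddMonoidAlgebra.single_mul_single, AddMonoidAlgebra.single_mul_single, one_mul,
    ← map_mul, ← map_mul] at h'
  have := leading_cancel b one_ne_zero
    (by rw [map_mul, constantCoeff_schurPoly b h₁, constantCoeff_schurPoly b h₂, one_mul])
    (by rw [map_mul, constantCoeff_schurPoly b h₃, constantCoeff_schurPoly b h₄, one_mul]) h'
  exact ⟨Subtype.ext this.1, this.2.2⟩

open Classical in
/-- The specialization which retains only the powers of one variable. -/
def edgeHom (k : Type*) [CommRing k] {σ : Type*} (i : σ) :
    MvPolynomial σ k →ₐ[k] Polynomial k :=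
  MvPolynomial.aeval fun j => if j = i then Polynomial.X else 0

theorem coeff_edgeHom {k : Type*} [CommRing k] {σ : Type*} (i : σ) (p : MvPolynomial σ k)
    (n : ℕ) : (edgeHom k i p).coeff n = p.coeff (Finsupp.single i n) := by
  classical
  induction p using MvPolynomial.induction_on' with
  | monomial u a =>
    rw [edgeHom, MvPolynomial.aeval_monomial, MvPolynomial.coeff_monomial,
      Polynomial.algebraMap_eq, Polynomial.coeff_C_mul]
    by_cases hu : ∃ m, u = Finsupp.single i m
    · obtain ⟨m, rfl⟩ := hu
      rw [Finsupp.prod_single_index (by simp), if_pos rfl, Polynomial.coeff_X_pow]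
      by_cases hmn : m = n
      · simp [hmn]
      · rw [if_neg (Ne.symm hmn), if_neg fun h => hmn (Finsupp.single_injective i h), mul_zero]
    · rw [if_neg fun h => hu ⟨n, h⟩]
      have : ∃ j ∈ u.support, j ≠ i := by
        by_contra! hc
        refine hu ⟨u i, ?_⟩
        ext j
        by_cases hj : j = i
        · simp [hj]
        · rw [Finsupp.single_eq_of_ne hj]
          by_contra h0
          exact hj (hc j (Finsupp.mem_support_iff.2 h0))
      obtain ⟨j, hj, hji⟩ := this
      rw [Finsupp.prod, Finset.prod_eq_zero hj, Polynomial.coeff_zero, mul_zero]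
      rw [if_neg hji, zero_pow (Finsupp.mem_support_iff.1 hj)]
  | add p q hp hq => simp [hp, hq]

/-- The line x - nα_i meets the sphere through x only at n = 0 and at n = m_i, where the group
elements 1 and s_i give the coefficients 1 and -1. -/
theorem edgeHom_schurPoly {k : Type*} [CommRing k] (b : P.Base) {x : weightLattice P}
    (hx : IsDominantRegular b x) (i : b.support) :
    edgeHom k i (schurPoly k b x) = 1 - Polynomial.X ^ (mult x i).toNat := by
  classical
  have hpos : 0 < mult x i := (hx.1 i i.2).lt_of_ne (hx.2 i i.2).symm
  ext n
  rw [coeff_edgeHom, Polynomial.coeff_sub, Polynomial.coeff_X_pow, Polynomial.coeff_one]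
  by_cases h0 : n = 0
  · subst h0
    rw [if_pos rfl, if_neg (by omega), Finsupp.single_zero, ← MvPolynomial.constantCoeff_eq,
      constantCoeff_schurPoly b hx, sub_zero]
  rw [if_neg h0]
  by_cases h1 : n = (mult x i).toNat
  · rw [if_pos h1, coeff_schurPoly b hx (w := refl P i), sign_refl]
    · simp
    · rw [refl_smul, coneVec_single, mult_spec, h1, Int.cast_smul_eq_zsmul,
        ← natCast_zsmul, Int.toNat_of_nonneg hpos.le]
  · rw [if_neg h1, sub_zero]
    by_contra hne
    have h2 := form_coneVec_eq b hx hne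
    rw [coneVec_single] at h2
    simp only [map_nsmul, LinearMap.smul_apply, nsmul_eq_mul] at h2
    have h6 := two_form_root (P := P) (x : M) (i : ι)
    rw [mult_spec] at h6
    have h3 := (rootNormSq_pos (P := P) i).ne'
    have h4 : (n : ℝ) = mult x i := by
      apply mul_right_cancel₀ h3
      apply mul_left_cancel₀ (Nat.cast_ne_zero.2 h0 : (n : ℝ) ≠ 0)
      rw [rootNormSq]
      linear_combination h2 + n * h6
    have h5 : (n : ℤ) = mult x i := by exact_mod_cast h4
    omega

/-- Equality of the degree sums cancels the top terms and leaves X^a + X^c = X^d + X^e. -/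
theorem one_sub_X_pow_mul_eq {a c d e : ℕ}
    (h : (1 - Polynomial.X ^ a : Polynomial ℤ) * (1 - Polynomial.X ^ c) =
      (1 - Polynomial.X ^ d) * (1 - Polynomial.X ^ e)) (hs : a + c = d + e) : a = d ∨ a = e := by
  by_contra! hc
  have h1 : (Polynomial.X ^ a + Polynomial.X ^ c : Polynomial ℤ) =
      Polynomial.X ^ d + Polynomial.X ^ e := by
    have h2 : (Polynomial.X ^ a * Polynomial.X ^ c : Polynomial ℤ) =
        Polynomial.X ^ d * Polynomial.X ^ e := by rw [← pow_add, ← pow_add, hs]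
    linear_combination h2 - h
  have h3 := congrArg (fun p => Polynomial.coeff p a) h1
  simp only [Polynomial.coeff_add, Polynomial.coeff_X_pow, if_true, if_neg hc.1,
    if_neg hc.2] at h3
  split_ifs at h3 <;> omega

end Quotients

/-! ### Coefficients along a path in the Dynkin diagram -/

section Path

variable [Fintype ι] {P : RootPairing ι ℝ M N} [P.IsRootSystem] [P.IsCrystallographic]
  [P.IsReduced]

/-- The exponent vector with the given exponents at the given vertices of a path. -/
def pathVec {σ : Type*} (v : ℕ → σ) (m : ℕ → ℕ) (S : Finset ℕ) : σ →₀ ℕ :=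
  ∑ t ∈ S, Finsupp.single (v t) (m t)

theorem pathVec_apply {σ : Type*} {v : ℕ → σ} {n : ℕ}
    (hv : ∀ s ≤ n, ∀ t ≤ n, v s = v t → s = t) (m : ℕ → ℕ) {S : Finset ℕ}
    (hS : ∀ t ∈ S, t ≤ n) {t : ℕ} (ht : t ≤ n) :
    pathVec v m S (v t) = if t ∈ S then m t else 0 := by
  classical
  rw [pathVec, Finsupp.finsetSum_apply]
  split_ifs with h
  · rw [Finset.sum_eq_single_of_mem t h, Finsupp.single_eq_same]
    intro s hs hst
    rw [Finsupp.single_eq_of_ne]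
    exact fun h' => hst (hv s (hS s hs) t ht h'.symm)
  · refine Finset.sum_eq_zero fun s hs => ?_
    rw [Finsupp.single_eq_of_ne]
    rintro h'
    exact h (hv s (hS s hs) t ht h'.symm ▸ hs)

theorem pathVec_of_ne {σ : Type*} {v : ℕ → σ} (m : ℕ → ℕ) {S : Finset ℕ} {i : σ}
    (hi : ∀ t ∈ S, v t ≠ i) : pathVec v m S i = 0 := by
  classical
  rw [pathVec, Finsupp.finsetSum_apply]
  refine Finset.sum_eq_zero fun s hs => ?_
  rw [Finsupp.single_eq_of_ne]
  exact fun h => hi s hs h.symm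

/-- An induced path in the Dynkin diagram. -/
structure IsDynkinPath (b : P.Base) (v : ℕ → b.support) (n : ℕ) : Prop where
  inj : ∀ s ≤ n, ∀ t ≤ n, v s = v t → s = t
  adj : ∀ t < n, P.RootForm (P.root (v t)) (P.root (v (t + 1))) ≠ 0
  nonadj : ∀ s t, t ≤ n → s + 1 < t → P.RootForm (P.root (v s)) (P.root (v t)) = 0

/-- On an induced path distinct vertices of equal parity are not adjacent, so their simple roots are
pairwise orthogonal and the monomial comes from the product of their reflections. -/
theorem coeff_pathVec_ne_zero (b : P.Base) {v : ℕ → b.support} {n : ℕ} (hv : IsDynkinPath b v n)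
    {x : weightLattice P} (hx : IsDominantRegular b x) (m : ℕ → ℕ) {S : Finset ℕ}
    (hS : ∀ t ∈ S, t ≤ n) (hm : ∀ t ∈ S, mult x (v t) = m t)
    (hpar : ∀ s ∈ S, ∀ t ∈ S, s % 2 = t % 2) :
    (schurPoly ℤ b x).coeff (pathVec v m S) ≠ 0 := by
  classical
  obtain ⟨w, hw⟩ := exists_smul_eq_of_orthogonal b x (S.image v) (by
    intro i hi j hj hij
    obtain ⟨s, hs, rfl⟩ := Finset.mem_image.1 hi
    obtain ⟨t, ht, rfl⟩ := Finset.mem_image.1 hj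
    have hst : s ≠ t := fun h => hij (h ▸ rfl)
    have := hpar s hs t ht
    rcases lt_or_gt_of_ne hst with h | h
    · exact hv.nonadj s t (hS t ht) (by omega)
    · rw [← P.rootForm_symmetric.eq]
      exact hv.nonadj t s (hS s hs) (by omega))
  rw [coeff_schurPoly b hx (w := w)]
  · intro h0
    have := sign_mul_self b w
    simp only [Int.cast_id] at h0
    simp [h0] at this
  · rw [hw, Finset.sum_image fun s hs t ht h => hv.inj s (hS s hs) t (hS t ht) h, pathVec, map_sum]
    congr 1
    refine Finset.sum_congr rfl fun t ht => ?_
    rw [coneVec_single, hm t ht, natCast_zsmul]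

variable {b : P.Base} {v : ℕ → b.support} {n : ℕ} {x y : weightLattice P} {m : ℕ → ℕ}

/-- Factorizations of the path monomial are alternating along the path. -/
theorem alternating_of_coeff_ne_zero (hv : IsDynkinPath b v n)
    (hx : IsDominantRegular b x) (hy : IsDominantRegular b y) (hm : ∀ t, 0 < m t)
    (hmx : ∀ t ≤ n, (m t : ℤ) ≤ mult x (v t)) (hmy : ∀ t ≤ n, (m t : ℤ) ≤ mult y (v t))
    (hy0 : (m 0 : ℤ) < mult y (v 0)) {u u' : b.support →₀ ℕ}
    (huu : u + u' = pathVec v m (Finset.range (n + 1)))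
    (hu : (schurPoly ℤ b x).coeff u ≠ 0) (hu' : (schurPoly ℤ b y).coeff u' ≠ 0) :
    ∀ t ≤ n, (t % 2 = 0 → u (v t) = m t ∧ mult x (v t) = m t ∧ u' (v t) = 0) ∧
      (t % 2 = 1 → u (v t) = 0 ∧ u' (v t) = m t ∧ mult y (v t) = m t) := by
  have hr : ∀ t ∈ Finset.range (n + 1), t ≤ n := fun t ht => by
    rw [Finset.mem_range] at ht
    omega
  have hN : ∀ t ≤ n, u (v t) + u' (v t) = m t := fun t ht => by
    rw [← Finsupp.add_apply, huu, pathVec_apply hv.inj m hr ht,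
      if_pos (Finset.mem_range.2 (by omega))]
  have hN' : ∀ i, (∀ t ≤ n, v t ≠ i) → u i = 0 ∧ u' i = 0 := fun i hi => by
    have : (u + u') i = 0 := by
      rw [huu, pathVec_of_ne m fun t ht => hi t (hr t ht)]
    rw [Finsupp.add_apply] at this
    omega
  have hux := coeff_schurPoly_of_le b hx hu fun i => by
    by_cases h : ∀ t ≤ n, v t ≠ i
    · rw [(hN' i h).1]
      exact hx.1 i i.2
    · push Not at h
      obtain ⟨t, ht, rfl⟩ := h
      have := hN t ht
      have := hmx t ht
      omega
  have huy := coeff_schurPoly_of_le b hy hu' fun i => by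
    by_cases h : ∀ t ≤ n, v t ≠ i
    · rw [(hN' i h).2]
      exact hy.1 i i.2
    · push Not at h
      obtain ⟨t, ht, rfl⟩ := h
      have := hN t ht
      have := hmy t ht
      omega
  intro t
  -- Each exponent goes entirely to one factor. At the start it cannot go to the second factor,
  -- whose coefficient there exceeds m 0. Afterwards no factor can use two adjacent vertices, so the
  -- factors take turns.
  induction t with
  | zero =>
    intro _
    refine ⟨fun _ => ?_, fun h => absurd h (by norm_num)⟩
    have h1 := hux.1 (v 0)
    have h2 := huy.1 (v 0)
    have h3 := hN 0 (Nat.zero_le n)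
    have h4 := hmx 0 (Nat.zero_le n)
    have h5 := hm 0
    omega
  | succ t ih =>
    intro ht
    have ih := ih (by omega)
    have h1 := hux.1 (v (t + 1))
    have h2 := huy.1 (v (t + 1))
    have h3 := hN (t + 1) ht
    have h4 := hmx (t + 1) ht
    have h4' := hmy (t + 1) ht
    have h5 := hm (t + 1)
    have h5' := hm t
    have hne : v t ≠ v (t + 1) := fun h => by
      have := hv.inj t (by omega) (t + 1) ht h
      omega
    have h6 : u (v t) = 0 ∨ u (v (t + 1)) = 0 := by
      by_contra! hc
      exact hv.adj t (by omega) (hux.2 _ _ hne hc.1 hc.2)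
    have h7 : u' (v t) = 0 ∨ u' (v (t + 1)) = 0 := by
      by_contra! hc
      exact hv.adj t (by omega) (huy.2 _ _ hne hc.1 hc.2)
    constructor
    · intro hpar
      have := ih.2 (by omega)
      omega
    · intro hpar
      have := ih.1 (by omega)
      omega

/-- The alternation would assign the last vertex to a factor whose coefficient there is too large.
-/
theorem coeff_mul_pathVec_eq_zero (hv : IsDynkinPath b v n)
    (hx : IsDominantRegular b x) (hy : IsDominantRegular b y) (hm : ∀ t, 0 < m t)
    (hmx : ∀ t ≤ n, (m t : ℤ) ≤ mult x (v t)) (hmy : ∀ t ≤ n, (m t : ℤ) ≤ mult y (v t))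
    (hy0 : (m 0 : ℤ) < mult y (v 0))
    (hend : n % 2 = 0 ∧ (m n : ℤ) < mult x (v n) ∨ n % 2 = 1 ∧ (m n : ℤ) < mult y (v n)) :
    (schurPoly ℤ b x * schurPoly ℤ b y).coeff (pathVec v m (Finset.range (n + 1))) = 0 := by
  classical
  rw [MvPolynomial.coeff_mul]
  refine Finset.sum_eq_zero fun p hp => ?_
  by_contra hne
  have h := alternating_of_coeff_ne_zero hv hx hy hm hmx hmy hy0 (Finset.HasAntidiagonal.mem_antidiagonal.1 hp)
    (left_ne_zero_of_mul hne) (right_ne_zero_of_mul hne) n le_rfl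
  rcases hend with ⟨h1, h2⟩ | ⟨h1, h2⟩
  · have := (h.1 h1).2.1
    omega
  · have := (h.2 h1).2.2
    omega

/-- Alternation leaves only the splitting into even and odd vertices, so there is one nonzero
summand and no cancellation. -/
theorem coeff_mul_pathVec_ne_zero (hv : IsDynkinPath b v n)
    (hx : IsDominantRegular b x) (hy : IsDominantRegular b y) (hm : ∀ t, 0 < m t)
    (hmx : ∀ t ≤ n, (m t : ℤ) ≤ mult x (v t)) (hmy : ∀ t ≤ n, (m t : ℤ) ≤ mult y (v t))
    (hy0 : (m 0 : ℤ) < mult y (v 0))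
    (heven : ∀ t ≤ n, t % 2 = 0 → mult x (v t) = m t)
    (hodd : ∀ t ≤ n, t % 2 = 1 → mult y (v t) = m t) :
    (schurPoly ℤ b x * schurPoly ℤ b y).coeff (pathVec v m (Finset.range (n + 1))) ≠ 0 := by
  classical
  set E := (Finset.range (n + 1)).filter (fun t => t % 2 = 0) with hE
  set O := (Finset.range (n + 1)).filter (fun t => ¬ t % 2 = 0) with hO
  have hEn : ∀ t ∈ E, t ≤ n ∧ t % 2 = 0 := fun t ht => by
    simp only [hE, Finset.mem_filter, Finset.mem_range] at ht
    omega
  have hOn : ∀ t ∈ O, t ≤ n ∧ t % 2 = 1 := fun t ht => by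
    simp only [hO, Finset.mem_filter, Finset.mem_range] at ht
    omega
  change MvPolynomial.coeff _ _ ≠ 0
  rw [MvPolynomial.coeff_mul, Finset.sum_eq_single (pathVec v m E, pathVec v m O)]
  · refine mul_ne_zero (coeff_pathVec_ne_zero b hv hx m (fun t ht => (hEn t ht).1)
      (fun t ht => heven t (hEn t ht).1 (hEn t ht).2) fun s hs t ht => ?_)
      (coeff_pathVec_ne_zero b hv hy m (fun t ht => (hOn t ht).1)
      (fun t ht => hodd t (hOn t ht).1 (hOn t ht).2) fun s hs t ht => ?_)
    · rw [(hEn s hs).2, (hEn t ht).2]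
    · rw [(hOn s hs).2, (hOn t ht).2]
  · rintro ⟨u, u'⟩ hp hne
    by_contra hc
    rw [Finset.HasAntidiagonal.mem_antidiagonal] at hp
    have h := alternating_of_coeff_ne_zero hv hx hy hm hmx hmy hy0 hp
      (left_ne_zero_of_mul hc) (right_ne_zero_of_mul hc)
    have hsum : pathVec v m E + pathVec v m O = pathVec v m (Finset.range (n + 1)) :=
      Finset.sum_filter_add_sum_filter_not _ _ _
    have huE : u = pathVec v m E := by
      ext i
      by_cases hi : ∀ t ≤ n, v t ≠ i
      · rw [pathVec_of_ne m fun t ht => hi t (hEn t ht).1]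
        have h1 : (u + u') i = 0 := by
          rw [show u + u' = _ from hp,
            pathVec_of_ne m fun t ht => hi t (by rw [Finset.mem_range] at ht; omega)]
        rw [Finsupp.add_apply] at h1
        omega
      · push Not at hi
        obtain ⟨t, ht, rfl⟩ := hi
        rw [pathVec_apply hv.inj m (fun t ht => (hEn t ht).1) ht]
        rcases Nat.mod_two_eq_zero_or_one t with h0 | h0
        · rw [if_pos (by simp only [hE, Finset.mem_filter, Finset.mem_range]; omega)]
          exact ((h t ht).1 h0).1
        · rw [if_neg (by simp only [hE, Finset.mem_filter, Finset.mem_range]; omega)]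
          exact ((h t ht).2 h0).1
    apply hne
    rw [Prod.mk.injEq]
    refine ⟨huE, ?_⟩
    rw [← hsum, huE] at hp
    exact add_left_cancel hp
  · intro h
    refine absurd (Finset.HasAntidiagonal.mem_antidiagonal.2 ?_) h
    exact Finset.sum_filter_add_sum_filter_not _ _ _

/-- Four weights which agree in the interior of a path in the Dynkin diagram and are
interchanged at the ends have no multiplicative relation. -/
theorem false_of_path (hv : IsDynkinPath b v n) (hn : 0 < n) {x₁ x₂ x₃ x₄ : weightLattice P}
    (h₁ : IsDominantRegular b x₁) (h₂ : IsDominantRegular b x₂) (h₃ : IsDominantRegular b x₃)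
    (h₄ : IsDominantRegular b x₄)
    (h : schurPoly ℤ b x₁ * schurPoly ℤ b x₂ = schurPoly ℤ b x₃ * schurPoly ℤ b x₄)
    (hint : ∀ t, 0 < t → t < n → mult x₂ (v t) = mult x₁ (v t) ∧ mult x₃ (v t) = mult x₁ (v t) ∧
      mult x₄ (v t) = mult x₁ (v t))
    (h0 : mult x₁ (v 0) < mult x₂ (v 0) ∧ mult x₃ (v 0) = mult x₁ (v 0) ∧
      mult x₁ (v 0) < mult x₄ (v 0))
    (hlast : mult x₁ (v n) < mult x₂ (v n) ∧ mult x₁ (v n) < mult x₃ (v n) ∧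
      mult x₄ (v n) = mult x₁ (v n)) : False := by
  have hpos : ∀ t, 0 < mult x₁ (v t) := fun t =>
    (h₁.1 _ (v t).2).lt_of_ne (h₁.2 _ (v t).2).symm
  -- Along the path `x₁` has the smallest coefficients of the four weights; these are the exponents
  -- of the monomial to be compared.
  set m : ℕ → ℕ := fun t => (mult x₁ (v t)).toNat with hm
  have hmz : ∀ t, (m t : ℤ) = mult x₁ (v t) := fun t => Int.toNat_of_nonneg (hpos t).le
  have hmp : ∀ t, 0 < m t := fun t => by
    have := hpos t
    have := hmz t
    omega
  have hcase : ∀ t ≤ n, t = 0 ∨ t = n ∨ (0 < t ∧ t < n) := fun t ht => by omega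
  have hle : ∀ t ≤ n, (m t : ℤ) ≤ mult x₁ (v t) ∧ (m t : ℤ) ≤ mult x₂ (v t) ∧
      (m t : ℤ) ≤ mult x₃ (v t) ∧ (m t : ℤ) ≤ mult x₄ (v t) := by
    intro t ht
    rw [hmz]
    rcases hcase t ht with rfl | rfl | h'
    · omega
    · omega
    · have := hint t h'.1 h'.2
      omega
  have h0' := hmz 0
  have hn' := hmz n
  have heq := congrArg (fun p => p.coeff (pathVec v m (Finset.range (n + 1)))) h
  -- The factor that starts the path also ends it exactly when n is even. So the monomial occurs
  -- only in the product of `x₁`, `x₂` for even n, and only in that of `x₃`, `x₄` for odd n.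
  rcases Nat.mod_two_eq_zero_or_one n with hpar | hpar
  · refine coeff_mul_pathVec_ne_zero hv h₁ h₂ hmp (fun t ht => (hle t ht).1)
      (fun t ht => (hle t ht).2.1) (by omega) (fun t ht _ => (hmz t).symm) (fun t ht ht2 => ?_)
      (heq.trans (coeff_mul_pathVec_eq_zero hv h₃ h₄ hmp (fun t ht => (hle t ht).2.2.1)
        (fun t ht => (hle t ht).2.2.2) (by omega) (Or.inl ⟨hpar, by omega⟩)))
    rw [hmz]
    exact (hint t (by omega) (by rcases hcase t ht with rfl | rfl | h' <;> omega)).1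
  · refine coeff_mul_pathVec_ne_zero hv h₃ h₄ hmp (fun t ht => (hle t ht).2.2.1)
      (fun t ht => (hle t ht).2.2.2) (by omega) (fun t ht ht2 => ?_) (fun t ht ht2 => ?_)
      (heq.symm.trans (coeff_mul_pathVec_eq_zero hv h₁ h₂ hmp (fun t ht => (hle t ht).1)
        (fun t ht => (hle t ht).2.1) (by omega) (Or.inr ⟨hpar, by omega⟩)))
    · rw [hmz]
      rcases hcase t ht with rfl | rfl | h'
      · exact h0.2.1
      · omega
      · exact (hint t h'.1 h'.2).2.1
    · rw [hmz]
      rcases hcase t ht with rfl | rfl | h'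
      · omega
      · exact hlast.2.2
      · exact (hint t h'.1 h'.2).2.2

end Path

/-- A shortest path between two sets is an induced path. -/
theorem exists_induced_path {σ : Type*} (r : σ → σ → Prop) (A B : σ → Prop)
    (h : ∃ n, ∃ v : ℕ → σ, A (v 0) ∧ B (v n) ∧ ∀ t < n, r (v t) (v (t + 1))) :
    ∃ n, ∃ v : ℕ → σ, A (v 0) ∧ B (v n) ∧ (∀ t < n, r (v t) (v (t + 1))) ∧
      (∀ t, 0 < t → t ≤ n → ¬ A (v t)) ∧ (∀ t < n, ¬ B (v t)) ∧
      (∀ s ≤ n, ∀ t ≤ n, v s = v t → s = t) ∧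
      ∀ s t, t ≤ n → s + 1 < t → ¬ r (v s) (v t) := by
  classical
  -- Minimality of the length gives all the properties: a later vertex in A, an earlier one in B, or
  -- a chord would yield a shorter path.
  obtain ⟨v, hA, hB, hr⟩ := Nat.find_spec h
  set n := Nat.find h with hn
  have hmin : ∀ m < n, ¬ ∃ v : ℕ → σ, A (v 0) ∧ B (v m) ∧ ∀ t < m, r (v t) (v (t + 1)) :=
    fun m hm => Nat.find_min h hm
  have hB' : ∀ t < n, ¬ B (v t) := fun t ht hb =>
    hmin t ht ⟨v, hA, hb, fun s hs => hr s (by omega)⟩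
  have hA' : ∀ t, 0 < t → t ≤ n → ¬ A (v t) := fun t ht htn ha => by
    refine hmin (n - t) (by omega) ⟨fun s => v (s + t), ?_, ?_, fun s hs => ?_⟩
    · simpa using ha
    · simpa [Nat.sub_add_cancel htn] using hB
    · have := hr (s + t) (by omega)
      rwa [add_right_comm] at this
  have hnon : ∀ s t, t ≤ n → s + 1 < t → ¬ r (v s) (v t) := fun s t ht hst hrt => by
    refine hmin (n - (t - s - 1)) (by omega)
      ⟨fun k => if k ≤ s then v k else v (k + (t - s - 1)), ?_, ?_, fun k hk => ?_⟩
    · simpa using hA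
    · change B (if _ then _ else _)
      rw [if_neg (by omega), Nat.sub_add_cancel (by omega)]
      exact hB
    · change r (if _ then _ else _) (if _ then _ else _)
      rcases lt_trichotomy k s with hks | rfl | hks
      · rw [if_pos (by omega), if_pos (by omega)]
        exact hr k (by omega)
      · rw [if_pos le_rfl, if_neg (by omega), show k + 1 + (t - k - 1) = t by omega]
        exact hrt
      · rw [if_neg (by omega), if_neg (by omega), add_right_comm]
        exact hr _ (by omega)
  -- A repeated vertex gives a chord to the successor of its second occurrence or, if that is the
  -- end, a premature point of B.
  have hlt : ∀ s t, t ≤ n → s < t → v s ≠ v t := fun s t ht hst heq => by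
    rcases ht.lt_or_eq with h' | rfl
    · refine hnon s (t + 1) (by omega) (by omega) ?_
      rw [heq]
      exact hr t h'
    · exact hB' s hst (heq ▸ hB)
  refine ⟨n, v, hA, hB, hr, hA', hB', fun s hs t ht heq => ?_, hnon⟩
  by_contra hne
  rcases lt_or_gt_of_ne hne with h' | h'
  · exact hlt s t ht h' heq
  · exact hlt t s hs h' heq.symm

/-! ### Quotients of Schur-Weyl elements determine the weights -/

section PartOne

variable [Fintype ι] {P : RootPairing ι ℝ M N} [P.IsRootSystem] [P.IsCrystallographic]
  [P.IsReduced]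

/-- Irreducibility enters here as connectedness of the Dynkin diagram, through the induction
principle for the Cartan matrix. -/
theorem exists_dynkin_chain [P.IsIrreducible] (b : P.Base) (i j : b.support) :
    ∃ n, ∃ v : ℕ → b.support, v 0 = i ∧ v n = j ∧
      ∀ t < n, P.RootForm (P.root (v t)) (P.root (v (t + 1))) ≠ 0 := by
  refine b.induction_on_cartanMatrix (fun j => ∃ n, ∃ v : ℕ → b.support, v 0 = i ∧ v n = j ∧
      ∀ t < n, P.RootForm (P.root (v t)) (P.root (v (t + 1))) ≠ 0)
    (i := i) (j := j) ⟨0, fun _ => i, rfl, rfl, by simp⟩ ?_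
  rintro k l ⟨n, v, h0, hn, hv⟩ hkl
  refine ⟨n + 1, fun t => if t ≤ n then v t else l, by simpa, by simp, fun t ht => ?_⟩
  rcases (Nat.lt_succ_iff.1 ht).lt_or_eq with h | rfl
  · simpa only [if_pos h.le, if_pos (Nat.succ_le_of_lt h)] using hv t h
  · simp only [le_refl, if_true, if_neg (Nat.lt_irrefl t), hn, Nat.succ_le_iff]
    intro h0
    apply hkl
    rw [b.cartanMatrix_apply_eq_zero_iff_pairing]
    have h1 := two_form_root (P := P) (P.root l) k
    rw [← P.rootForm_symmetric.eq, RingHom.id_apply, h0, mul_zero] at h1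
    exact (mul_eq_zero.1 h1.symm).resolve_right (rootNormSq_pos (P := P) k).ne'

theorem schurWeyl_ne_zero (b : P.Base) {x : weightLattice P} (hx : IsDominantRegular b x) :
    schurWeyl b x ≠ 0 := by
  intro h
  have h1 := congrArg (toAmbient P ℤ) h
  rw [toAmbient_schurWeyl, schurAmbient_eq ℤ b hx, map_zero] at h1
  have h2 := congrArg (fun f => AddMonoidAlgebra.coeff f (x : M)) h1
  simp only [coeff_single_mul'] at h2
  rw [sub_self] at h2
  have h3 := coeff_incl b (schurPoly ℤ b x) 0
  rw [map_zero, neg_zero] at h3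
  rw [h3] at h2
  have h4 := constantCoeff_schurPoly (k := ℤ) b hx
  rw [MvPolynomial.constantCoeff_eq] at h4
  rw [show (schurPoly ℤ b x).coeff 0 = 1 from h4] at h2
  simp at h2

/-- Quotients of two Schur-Weyl elements determine the two weights. -/
theorem eq_of_schurWeyl_mul_eq [P.IsIrreducible] (b : P.Base) {x₁ x₂ y₁ y₂ : weightLattice P}
    (hx₁ : IsDominantRegular b x₁) (hx₂ : IsDominantRegular b x₂) (hy₁ : IsDominantRegular b y₁)
    (hy₂ : IsDominantRegular b y₂)
    (h : schurWeyl b x₁ * schurWeyl b y₂ = schurWeyl b x₂ * schurWeyl b y₁) (hne : x₁ ≠ y₁) :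
    x₁ = x₂ ∧ y₁ = y₂ := by
  obtain ⟨hs, hp⟩ := schurPoly_mul_eq b hx₁ hy₂ hx₂ hy₁ h
  have hsum : ∀ i, mult x₁ i + mult y₂ i = mult x₂ i + mult y₁ i := fun i => by
    rw [← mult_add, ← mult_add, hs]
  have hpos : ∀ {x : weightLattice P}, IsDominantRegular b x → ∀ i : b.support, 0 < mult x i :=
    fun hx i => (hx.1 i i.2).lt_of_ne (hx.2 i i.2).symm
  have hcases : ∀ i : b.support, mult x₁ i = mult x₂ i ∨ mult x₁ i = mult y₁ i := fun i => by
    have h1 := congrArg (edgeHom ℤ i) hp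
    simp only [map_mul] at h1
    rw [edgeHom_schurPoly b hx₁, edgeHom_schurPoly b hx₂, edgeHom_schurPoly b hy₁,
      edgeHom_schurPoly b hy₂] at h1
    have := hsum i
    have := hpos hx₁ i
    have := hpos hx₂ i
    have := hpos hy₁ i
    have := hpos hy₂ i
    have := one_sub_X_pow_mul_eq h1 (by omega)
    omega
  by_cases hI : ∀ i : b.support, mult x₁ i = mult x₂ i
  · refine ⟨eq_of_mult_eq b fun i hi => hI ⟨i, hi⟩, eq_of_mult_eq b fun i hi => ?_⟩
    have := hsum i
    have := hI ⟨i, hi⟩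
    simp only at this
    omega
  by_cases hJ : ∀ i : b.support, mult x₁ i = mult y₁ i
  · exact absurd (eq_of_mult_eq b fun i hi => hJ ⟨i, hi⟩) hne
  exfalso
  push Not at hI hJ
  obtain ⟨i₀, hi₀⟩ := hI
  obtain ⟨j₀, hj₀⟩ := hJ
  obtain ⟨n₀, v₀, h0, hn, hadj⟩ := exists_dynkin_chain b i₀ j₀
  -- A shortest path from a vertex where `x₁`, `x₂` differ to one where `x₁`, `y₁` differ. In its
  -- interior all four weights agree, and at each end they agree in pairs.
  obtain ⟨n, v, hA, hB, hadj, hA', hB', hinj, hnon⟩ := exists_induced_path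
    (fun i j : b.support => P.RootForm (P.root i) (P.root j) ≠ 0)
    (fun i => mult x₁ i ≠ mult x₂ i) (fun i => mult x₁ i ≠ mult y₁ i)
    ⟨n₀, v₀, by rwa [h0], by rwa [hn], hadj⟩
  have hv : IsDynkinPath b v n := ⟨hinj, hadj, fun s t ht hst => not_not.1 (hnon s t ht hst)⟩
  have hn0 : 0 < n := by
    rcases Nat.eq_zero_or_pos n with rfl | h'
    · rcases hcases (v 0) with h' | h'
      · exact absurd h' hA
      · exact absurd h' hB
    · exact h'
  have hint : ∀ t, 0 < t → t < n → mult x₁ (v t) = mult x₂ (v t) ∧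
      mult x₁ (v t) = mult y₁ (v t) ∧ mult x₁ (v t) = mult y₂ (v t) := fun t ht htn => by
    have h1 := not_not.1 (hA' t ht htn.le)
    have h2 := not_not.1 (hB' t htn)
    have := hsum (v t)
    omega
  have e0 := hsum (v 0)
  have e1 := hcases (v 0)
  have e2 := hsum (v n)
  have e3 := hcases (v n)
  -- The directions of the two inequalities decide which of the four weights is smallest along the
  -- whole path and takes the first place.
  rcases lt_or_gt_of_ne hA with ha | ha <;> rcases lt_or_gt_of_ne hB with hb | hb
  · refine false_of_path hv hn0 hx₁ hy₂ hy₁ hx₂ (hp.trans (mul_comm _ _)) (fun t ht htn => ?_)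
      (by omega) (by omega)
    have := hint t ht htn
    omega
  · refine false_of_path hv hn0 hy₁ hx₂ hx₁ hy₂ ((mul_comm _ _).trans hp.symm)
      (fun t ht htn => ?_) (by omega) (by omega)
    have := hint t ht htn
    omega
  · refine false_of_path hv hn0 hx₂ hy₁ hy₂ hx₁ (hp.symm.trans (mul_comm _ _))
      (fun t ht htn => ?_) (by omega) (by omega)
    have := hint t ht htn
    omega
  · refine false_of_path hv hn0 hy₂ hx₁ hx₂ hy₁ ((mul_comm _ _).trans hp)
      (fun t ht htn => ?_) (by omega) (by omega)
    have := hint t ht htn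
    omega

theorem schurWeylQuot_eq_iff [P.IsIrreducible] (b : P.Base) {x₁ x₂ y₁ y₂ : weightLattice P}
    (hy₁ : IsDominantRegular b y₁) (hy₂ : IsDominantRegular b y₂) :
    schurWeylQuot b x₁ y₁ = schurWeylQuot b x₂ y₂ ↔
      schurWeyl b x₁ * schurWeyl b y₂ = schurWeyl b x₂ * schurWeyl b y₁ := by
  have hinj := IsFractionRing.injective (WeightAlgebra P) (WeightField P)
  rw [schurWeylQuot, schurWeylQuot, div_eq_div_iff, ← map_mul, ← map_mul, hinj.eq_iff]
  · exact (map_ne_zero_iff _ hinj).2 (schurWeyl_ne_zero b hy₁)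
  · exact (map_ne_zero_iff _ hinj).2 (schurWeyl_ne_zero b hy₂)

theorem ne_of_schurWeylQuot_ne_one (b : P.Base) {x y : weightLattice P}
    (hy : IsDominantRegular b y) (h : schurWeylQuot b x y ≠ 1) : x ≠ y := by
  rintro rfl
  have hinj := IsFractionRing.injective (WeightAlgebra P) (WeightField P)
  exact h (div_self ((map_ne_zero_iff _ hinj).2 (schurWeyl_ne_zero b hy)))

end PartOne

/-! ### The Weyl denominator formula for scaled root systems -/

section Denominator

variable [Fintype ι] {P : RootPairing ι ℝ M N} [P.IsRootSystem] [P.IsCrystallographic]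
  [P.IsReduced]

theorem refl_smul_self (i : ι) : refl P i • P.root i = -P.root i := by
  rw [refl_smul, P.root_coroot_two, two_smul]
  abel

theorem weyl_smul_nsmul (w : P.weylGroup) (n : ℕ) (x : M) : w • n • x = n • w • x :=
  map_nsmul (DistribSMul.toAddMonoidHom M w) n x

/-! ### The action of the Weyl group on the group algebra of the whole space -/

/-- The action of an element of the Weyl group on the group algebra of the whole space. -/
def weylHom (k : Type*) [CommRing k] (w : P.weylGroup) :
    AddMonoidAlgebra k M →+* AddMonoidAlgebra k M :=
  AddMonoidAlgebra.mapDomainRingHom k (DistribSMul.toAddMonoidHom M w)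

variable {k : Type*} [CommRing k]

theorem weylHom_single (w : P.weylGroup) (x : M) (c : k) :
    weylHom k w (AddMonoidAlgebra.single x c) = AddMonoidAlgebra.single (w • x) c :=
  AddMonoidAlgebra.mapDomain_single

theorem coeff_weylHom (w : P.weylGroup) (f : AddMonoidAlgebra k M) (x : M) :
    (weylHom k w f).coeff (w • x) = f.coeff x :=
  Finsupp.mapDomain_apply (f := fun x : M => w • x) (MulAction.injective w) _ _

theorem weylHom_mul (w w' : P.weylGroup) (f : AddMonoidAlgebra k M) :
    weylHom k (w * w') f = weylHom k w (weylHom k w' f) := by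
  induction f using AddMonoidAlgebra.induction_linear with
  | zero => simp only [map_zero]
  | add f g hf hg => simp only [map_add, hf, hg]
  | single x c => rw [weylHom_single, weylHom_single, weylHom_single, mul_smul]

theorem weylHom_one (f : AddMonoidAlgebra k M) : weylHom k (1 : P.weylGroup) f = f := by
  induction f using AddMonoidAlgebra.induction_linear with
  | zero => simp only [map_zero]
  | add f g hf hg => simp only [map_add, hf, hg]
  | single x c => rw [weylHom_single, one_smul]

theorem weylHom_eq_sign_smul (b : P.Base) {f : AddMonoidAlgebra k M}
    (hf : ∀ i ∈ b.support, weylHom k (refl P i) f = -f) (w : P.weylGroup) :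
    weylHom k w f = sign b w • f := by
  induction w using weyl_induction b with
  | one => rw [weylHom_one, sign_one, one_smul]
  | mul w i hi _ ih =>
    rw [weylHom_mul, hf i hi, map_neg, ih, sign_mul, sign_refl]
    simp

theorem weylHom_schurAmbient (b : P.Base) (x : M) (w : P.weylGroup) :
    weylHom k w (schurAmbient k b x) = sign b w • schurAmbient k b x := by
  rw [schurAmbient, map_sum, Finset.smul_sum]
  refine Fintype.sum_equiv (Equiv.mulLeft w) _ _ fun w' => ?_
  rw [weylHom_single, Equiv.coe_mulLeft, sign_mul, mul_smul, AddMonoidAlgebra.smul_single,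
    zsmul_eq_mul, ← Int.cast_mul, ← mul_assoc, sign_mul_self, one_mul]

/-- An alternating element is determined by its coefficients at dominant regular vectors. -/
theorem eq_zero_of_alternating [IsAddTorsionFree k] (b : P.Base) {f : AddMonoidAlgebra k M}
    (hf : ∀ w : P.weylGroup, weylHom k w f = sign b w • f)
    (h : ∀ y, (∀ i ∈ b.support, 0 < P.toLinearMap y (P.coroot i)) → f.coeff y = 0) : f = 0 := by
  by_contra hne
  have hs : f.coeff.support.Nonempty := by
    rw [Finsupp.support_nonempty_iff]
    exact fun h0 => hne (AddMonoidAlgebra.coeff_injective h0)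
  -- A simple reflection preserves the support and cannot raise the height of y, so y is dominant.
  -- On a wall the coefficient would equal its own negative, which torsion-freeness excludes.
  obtain ⟨y, hy, hmax⟩ := f.coeff.support.exists_max_image (ht b) hs
  rw [Finsupp.mem_support_iff] at hy
  refine hy (h y fun i hi => ?_)
  have h1 : f.coeff y = -f.coeff (refl P i • y) := by
    have h2 := coeff_weylHom (refl P i) f y
    rw [hf, sign_refl] at h2
    rw [← h2]
    simp
  have h3 : f.coeff (refl P i • y) ≠ 0 := fun h0 => hy (by rw [h1, h0, neg_zero])
  have h4 := hmax _ (Finsupp.mem_support_iff.2 h3)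
  rw [refl_smul, map_sub, map_smul, ← height_eq_ht, b.height_one_of_mem_support hi] at h4
  refine lt_of_le_of_ne (by simpa using h4) fun h5 => ?_
  rw [refl_smul, ← h5, zero_smul, sub_zero] at h1
  exact hy (self_eq_neg.1 h1)

/-! ### Positive roots -/

open Classical in
/-- The set of positive roots. -/
def posRoots (b : P.Base) : Finset ι := Finset.univ.filter b.IsPos

theorem mem_posRoots {b : P.Base} {i : ι} : i ∈ posRoots b ↔ b.IsPos i := by
  simp [posRoots]

theorem simple_mem_posRoots {b : P.Base} {i : ι} (hi : i ∈ b.support) : i ∈ posRoots b :=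
  mem_posRoots.2 (b.isPos_of_mem_support hi)

open Classical in
theorem map_erase_posRoots (b : P.Base) {i : ι} (hi : i ∈ b.support) :
    ((posRoots b).erase i).map (P.reflectionPerm i).toEmbedding = (posRoots b).erase i := by
  refine Finset.eq_of_subset_of_card_le ?_ (by rw [Finset.card_map])
  intro j hj
  rw [Finset.mem_map] at hj
  obtain ⟨l, hl, rfl⟩ := hj
  rw [Finset.mem_erase, mem_posRoots] at hl ⊢
  refine ⟨fun h => ?_, hl.2.reflectionPerm hi hl.1⟩
  have h1 : P.root l = -P.root i := by
    have := congrArg P.root h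
    rw [Equiv.coe_toEmbedding, ← refl_smul_root] at this
    rw [← refl_refl_smul (P := P) i (P.root l), this, refl_smul_self]
  have h2 := (isPos_iff_mem b l).1 hl.2
  have h3 := posCone_antisymm b h2 (by rw [h1, neg_neg]; exact simple_mem_posCone b hi)
  exact P.ne_zero l h3

/-- Families of integers indexed by the roots which are invariant under the Weyl group. -/
def IsWeylInvariant (P : RootPairing ι ℝ M N) (κ : ι → ℕ) : Prop :=
  ∀ (w : P.weylGroup) (i j : ι), w • P.root i = P.root j → κ i = κ j

/-- A Weyl group invariant family of positive integers such that the multiples of the roots by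
these integers form a crystallographic root system. -/
structure IsScaling (P : RootPairing ι ℝ M N) [P.IsCrystallographic] (κ : ι → ℕ) : Prop where
  pos : ∀ i, 0 < κ i
  invariant : IsWeylInvariant P κ
  dvd : ∀ i j, (κ i : ℤ) ∣ κ j * P.pairingIn ℤ j i

variable {κ : ι → ℕ}

theorem IsWeylInvariant.reflectionPerm (hκ : IsWeylInvariant P κ) (i j : ι) :
    κ (P.reflectionPerm i j) = κ j :=
  (hκ (refl P i) j _ (refl_smul_root P i j)).symm

theorem refl_smul_sum (hκ : IsWeylInvariant P κ) (b : P.Base) {i : ι} (hi : i ∈ b.support) :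
    refl P i • ∑ j ∈ posRoots b, κ j • P.root j =
      ∑ j ∈ posRoots b, κ j • P.root j - (2 * κ i) • P.root i := by
  classical
  have h1 := refl_smul_self (P := P) i
  rw [← Finset.add_sum_erase _ _ (simple_mem_posRoots hi), smul_add, weyl_smul_nsmul, h1,
    Finset.smul_sum]
  have h2 : ∑ j ∈ (posRoots b).erase i, refl P i • κ j • P.root j =
      ∑ j ∈ (posRoots b).erase i, κ j • P.root j := by
    conv_rhs => rw [← map_erase_posRoots b hi, Finset.sum_map]
    refine Finset.sum_congr rfl fun j _ => ?_
    rw [weyl_smul_nsmul, refl_smul_root, Equiv.coe_toEmbedding, hκ.reflectionPerm]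
  rw [h2, mul_smul, two_smul, smul_neg]
  abel

/-- The weight whose coefficients are given by a scaling is half the sum of the scaled positive
roots. -/
theorem eq_half_sum (hκ : IsWeylInvariant P κ) (b : P.Base) {x : weightLattice P}
    (hx : ∀ i ∈ b.support, mult x i = κ i) :
    (x : M) = (2⁻¹ : ℝ) • ∑ j ∈ posRoots b, κ j • P.root j := by
  apply P.toPerfPair.injective
  refine b.toCoweightBasis.ext fun i => ?_
  rw [RootPairing.Base.toCoweightBasis_apply]
  change P.toLinearMap x _ = P.toLinearMap _ _
  rw [mult_spec, hx i i.2]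
  -- The reflection s_i only reverses the summand at α_i, so the sum pairs to 2κ_i with the coroot
  -- of α_i.
  have h1 := refl_smul_sum hκ b i.2
  rw [refl_smul, sub_right_inj, ← Nat.cast_smul_eq_nsmul ℝ] at h1
  have h2 := smul_left_injective ℝ (P.ne_zero i) h1
  rw [map_smul, LinearMap.smul_apply, h2]
  simp

-- The factor at α_i changes sign, and the other factors are permuted because s_i permutes the
-- remaining positive roots.
open Classical in
theorem weylHom_prod (hκ : IsWeylInvariant P κ) (b : P.Base) {i : ι} (hi : i ∈ b.support) :
    weylHom k (refl P i) (∏ j ∈ posRoots b,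
      (AddMonoidAlgebra.single ((2⁻¹ : ℝ) • κ j • P.root j) 1 -
        AddMonoidAlgebra.single (-((2⁻¹ : ℝ) • κ j • P.root j)) 1)) =
    -(∏ j ∈ posRoots b,
      (AddMonoidAlgebra.single ((2⁻¹ : ℝ) • κ j • P.root j) 1 -
        AddMonoidAlgebra.single (-((2⁻¹ : ℝ) • κ j • P.root j)) 1)) := by
  have h1 := refl_smul_self (P := P) i
  rw [← Finset.mul_prod_erase _ _ (simple_mem_posRoots hi), map_mul, ← neg_mul, map_prod]
  congr 1
  · rw [map_sub, weylHom_single, weylHom_single, smul_neg, weyl_smul_smul, weyl_smul_nsmul, h1]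
    simp
  · conv_rhs => rw [← map_erase_posRoots b hi, Finset.prod_map]
    refine Finset.prod_congr rfl fun j _ => ?_
    rw [map_sub, weylHom_single, weylHom_single, smul_neg, weyl_smul_smul, weyl_smul_nsmul,
      refl_smul_root, Equiv.coe_toEmbedding, hκ.reflectionPerm]

theorem single_sum {σ : Type*} (s : Finset σ) (f : σ → M) :
    ∏ j ∈ s, AddMonoidAlgebra.single (f j) (1 : k) =
      AddMonoidAlgebra.single (∑ j ∈ s, f j) 1 := by
  classical
  induction s using Finset.induction with
  | empty => rfl
  | insert j s hj ih =>
    rw [Finset.prod_insert hj, Finset.sum_insert hj, ih, AddMonoidAlgebra.single_mul_single,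
      one_mul]

variable (k) in
/-- The product over the positive roots `γ` of the polynomials `1 - e ^ (-κ γ)`. -/
def denomPoly (b : P.Base) (κ : ι → ℕ) : MvPolynomial b.support k :=
  ∏ j ∈ posRoots b, (1 - MvPolynomial.monomial (κ j • coneCoeff b (P.root j)) 1)

theorem incl_denomPoly (b : P.Base) (κ : ι → ℕ) :
    incl k b (denomPoly k b κ) =
      ∏ j ∈ posRoots b, (1 - AddMonoidAlgebra.single (-(κ j • P.root j)) 1) := by
  rw [denomPoly, map_prod]
  refine Finset.prod_congr rfl fun j hj => ?_
  rw [map_sub, map_one, incl_monomial, map_nsmul,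
    coneVec_coneCoeff b ((isPos_iff_mem b j).1 (mem_posRoots.1 hj))]

/-- Since x is half the sum of the scaled positive roots, the element is ∏(e^{κγ/2} - e^{-κγ/2}).
The half roots need not be weights, so the identity is read in the group algebra of the whole space.
-/
theorem weylHom_denomPoly (hκ : IsWeylInvariant P κ) (b : P.Base) {x : weightLattice P}
    (hx : ∀ i ∈ b.support, mult x i = κ i) (w : P.weylGroup) :
    weylHom k w (AddMonoidAlgebra.single (x : M) 1 * incl k b (denomPoly k b κ)) =
      sign b w • (AddMonoidAlgebra.single (x : M) 1 * incl k b (denomPoly k b κ)) := by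
  have h : AddMonoidAlgebra.single (x : M) 1 * incl k b (denomPoly k b κ) =
      ∏ j ∈ posRoots b, (AddMonoidAlgebra.single ((2⁻¹ : ℝ) • κ j • P.root j) 1 -
        AddMonoidAlgebra.single (-((2⁻¹ : ℝ) • κ j • P.root j)) 1) := by
    rw [incl_denomPoly, eq_half_sum hκ b hx, Finset.smul_sum, ← single_sum,
      ← Finset.prod_mul_distrib]
    refine Finset.prod_congr rfl fun j _ => ?_
    rw [mul_sub, mul_one, AddMonoidAlgebra.single_mul_single, mul_one]
    congr 2
    module
  rw [h]
  exact weylHom_eq_sign_smul b (fun i hi => weylHom_prod hκ b hi) w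

theorem constantCoeff_denomPoly (hκ : ∀ i, 0 < κ i) (b : P.Base) :
    MvPolynomial.constantCoeff (denomPoly k b κ) = 1 := by
  classical
  rw [denomPoly, map_prod]
  refine Finset.prod_eq_one fun j hj => ?_
  rw [map_sub, map_one, MvPolynomial.constantCoeff_monomial, if_neg, sub_zero]
  intro h
  have h1 := congrArg (coneVec b) h
  rw [map_nsmul, coneVec_coneCoeff b ((isPos_iff_mem b j).1 (mem_posRoots.1 hj)), map_zero,
    ← Nat.cast_smul_eq_nsmul ℝ, smul_eq_zero, Nat.cast_eq_zero] at h1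
  exact h1.elim (hκ j).ne' (P.ne_zero j)

/-- The exponents are sums of vectors -κγ, and the crystallographic condition on the scaling makes
each pair to a multiple of κ_i. This gap is what rules out further dominant regular weights in the
product. -/
theorem dvd_of_coeff_denom_ne_zero (hκ : IsScaling P κ) (b : P.Base) {y : M}
    (hy : (incl k b (denomPoly k b κ)).coeff y ≠ 0) (i : ι) :
    ∃ m : ℤ, P.toLinearMap y (P.coroot i) = κ i * m := by
  classical
  rw [incl_denomPoly] at hy
  revert hy
  refine Finset.prod_induction _ (fun f : AddMonoidAlgebra k M => ∀ y, f.coeff y ≠ 0 →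
    ∃ m : ℤ, P.toLinearMap y (P.coroot i) = κ i * m) ?_ ?_ ?_ y
  · intro f g hf hg y hy
    have h1 := AddMonoidAlgebra.support_coeff_mul_subset f g (Finsupp.mem_support_iff.2 hy)
    obtain ⟨u, hu, v, hv, rfl⟩ := Finset.mem_add.1 h1
    obtain ⟨m, hm⟩ := hf u (Finsupp.mem_support_iff.1 hu)
    obtain ⟨n, hn⟩ := hg v (Finsupp.mem_support_iff.1 hv)
    exact ⟨m + n, by rw [map_add, LinearMap.add_apply, hm, hn]; push_cast; ring⟩
  · intro y hy
    have : y = 0 := by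
      by_contra h
      exact hy (Finsupp.single_eq_of_ne h)
    exact ⟨0, by simp [this]⟩
  · intro j _ y hy
    have : y = 0 ∨ y = -(κ j • P.root j) := by
      by_contra! h
      apply hy
      rw [AddMonoidAlgebra.coeff_sub, Finsupp.sub_apply]
      rw [show (AddMonoidAlgebra.coeff (1 : AddMonoidAlgebra k M)) y = 0 from
        Finsupp.single_eq_of_ne h.1]
      rw [AddMonoidAlgebra.coeff_single, Finsupp.single_eq_of_ne h.2, sub_zero]
    rcases this with rfl | rfl
    · exact ⟨0, by simp⟩
    · obtain ⟨m, hm⟩ := hκ.dvd i j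
      refine ⟨-m, ?_⟩
      have hm' : (κ j * P.pairingIn ℤ j i : ℝ) = κ i * m := by exact_mod_cast hm
      rw [map_neg, map_nsmul, LinearMap.neg_apply, LinearMap.smul_apply,
        P.root_coroot_eq_pairing, ← P.algebraMap_pairingIn ℤ, nsmul_eq_mul]
      simp only [eq_intCast]
      rw [hm']
      push_cast
      ring

/-- An antidominant element of the cone spanned by the simple roots vanishes. -/
theorem coneVec_eq_zero_of_nonpos (b : P.Base) {n : b.support →₀ ℕ}
    (h : ∀ i : b.support, P.toLinearMap (coneVec b n) (P.coroot i) ≤ 0) : coneVec b n = 0 := by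
  have hle : ∀ i : b.support, P.RootForm (P.root i) (coneVec b n) ≤ 0 := fun i => by
    have h1 := two_form_root (P := P) (coneVec b n) i
    rw [← P.rootForm_symmetric.eq, RingHom.id_apply] at h1
    have h2 := mul_nonpos_of_nonpos_of_nonneg (h i) (rootNormSq_pos (P := P) (i : ι)).le
    rw [rootNormSq] at h2
    linarith
  by_contra hne
  refine absurd (form_pos (P := P) hne) (not_lt.2 ?_)
  conv_lhs => enter [1]; rw [coneVec_apply]
  rw [map_sum, LinearMap.sum_apply]
  refine Finset.sum_nonpos fun i _ => ?_
  rw [map_nsmul, LinearMap.smul_apply, nsmul_eq_mul]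
  exact mul_nonpos_of_nonneg_of_nonpos (Nat.cast_nonneg _) (hle i)

variable (k) in
/-- The Weyl denominator formula for a scaled root system. -/
theorem schurPoly_eq_denomPoly (hκ : IsScaling P κ) (b : P.Base) {x : weightLattice P}
    (hx : ∀ i ∈ b.support, mult x i = κ i) : schurPoly k b x = denomPoly k b κ := by
  -- The comparison of alternating elements needs torsion-free coefficients; the general case
  -- follows by base change from ℤ.
  suffices h : schurPoly ℤ b x = denomPoly ℤ b κ by
    rw [← map_schurPoly ℤ (Int.castRingHom k) b x, h]
    simp [denomPoly]
  have hreg : IsDominantRegular b x := by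
    refine ⟨fun i hi => ?_, fun i hi => ?_⟩ <;> rw [hx i hi]
    · positivity
    · exact_mod_cast (hκ.pos i).ne'
  suffices h : schurAmbient ℤ b (x : M) -
      AddMonoidAlgebra.single (x : M) 1 * incl ℤ b (denomPoly ℤ b κ) = 0 by
    rw [schurAmbient_eq ℤ b hreg, sub_eq_zero] at h
    exact (leading_cancel b one_ne_zero (constantCoeff_schurPoly b hreg)
      (constantCoeff_denomPoly hκ.pos b) h).2.2
  -- The only dominant weight in the orbit of x is x.
  have hxx : ∀ {y : M}, (∀ i ∈ b.support, 0 < P.toLinearMap y (P.coroot i)) → y ≠ x →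
      (schurAmbient ℤ b (x : M)).coeff y = 0 := by
    intro y hy hne
    by_contra hc
    rw [schurAmbient_eq ℤ b hreg, coeff_single_mul', one_mul] at hc
    obtain ⟨n, hn⟩ := exists_of_coeff_incl_ne_zero b _ hc
    rw [hn, coeff_incl] at hc
    obtain ⟨w, hw⟩ := exists_of_coeff_schurPoly_ne_zero b hreg hc
    have hy' : y = w • (x : M) := by
      rw [hw, sub_eq_iff_eq_add.1 hn]
      abel
    have h1 := sub_smul_mem_posCone b x hreg.1 w
    have h2 := sub_smul_mem_posCone b (weylAct P w x) (fun i hi => ?_) w⁻¹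
    · change w • (x : M) - w⁻¹ • w • (x : M) ∈ _ at h2
      rw [inv_smul_smul] at h2
      have := posCone_antisymm b h1 (by rwa [neg_sub])
      rw [hy'] at hne
      exact hne (sub_eq_zero.1 this).symm
    · have := hy i hi
      rw [hy'] at this
      have h3 := mult_spec (weylAct P w x) i
      change P.toLinearMap (w • (x : M)) _ = _ at h3
      rw [h3] at this
      exact_mod_cast this.le
  -- If y occurs, then ⟨y, α_i*⟩ = κ_i(1 + m) with m an integer, and positivity gives m ≥ 0. So y -
  -- x is dominant, yet it lies in the negative cone, and therefore vanishes.
  have hdd : ∀ {y : M}, (∀ i ∈ b.support, 0 < P.toLinearMap y (P.coroot i)) → y ≠ x →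
      (AddMonoidAlgebra.single (x : M) 1 * incl ℤ b (denomPoly ℤ b κ)).coeff y = 0 := by
    intro y hy hne
    by_contra hc
    rw [coeff_single_mul', one_mul] at hc
    obtain ⟨n, hn⟩ := exists_of_coeff_incl_ne_zero b _ hc
    have hle : ∀ i : b.support, P.toLinearMap (coneVec b n) (P.coroot i) ≤ 0 := by
      intro i
      obtain ⟨m, hm⟩ := dvd_of_coeff_denom_ne_zero hκ b hc i
      have h1 := hy i i.2
      have h2 := mult_spec x i
      rw [hx i i.2] at h2
      rw [map_sub, LinearMap.sub_apply, h2] at hm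
      have hκi : (0 : ℝ) < κ i := by exact_mod_cast hκ.pos i
      have h3 : (0 : ℝ) < κ i * (1 + m) := by
        push_cast at hm
        linarith
      have h4 : (0 : ℝ) < 1 + m := (mul_pos_iff_of_pos_left hκi).1 h3
      have h5 : (0 : ℤ) ≤ m := by
        have : (0 : ℤ) < 1 + m := by exact_mod_cast h4
        omega
      have h6 : 0 ≤ P.toLinearMap (y - x) (P.coroot i) := by
        rw [map_sub, LinearMap.sub_apply, h2, hm]
        positivity
      rw [hn, map_neg, LinearMap.neg_apply] at h6
      linarith
    have h1 := coneVec_eq_zero_of_nonpos b hle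
    rw [h1, neg_zero, sub_eq_zero] at hn
    exact hne hn
  refine eq_zero_of_alternating b (fun w => ?_) fun y hy => ?_
  · rw [map_sub, weylHom_schurAmbient, weylHom_denomPoly hκ.invariant b hx, smul_sub]
  · rw [AddMonoidAlgebra.coeff_sub, Finsupp.sub_apply]
    by_cases h : y = x
    · have h1 := coeff_incl (k := ℤ) b (schurPoly ℤ b x) 0
      have h2 := coeff_incl (k := ℤ) b (denomPoly ℤ b κ) 0
      have h3 := constantCoeff_schurPoly (k := ℤ) b hreg
      have h4 := constantCoeff_denomPoly (k := ℤ) hκ.pos b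
      rw [map_zero, neg_zero] at h1 h2
      rw [MvPolynomial.constantCoeff_eq] at h3 h4
      rw [schurAmbient_eq ℤ b hreg, coeff_single_mul', coeff_single_mul', h, sub_self, h1, h2,
        one_mul, one_mul, sub_eq_zero]
      exact h3.trans h4.symm
    · rw [hxx hy h, hdd hy h, sub_zero]

end Denominator

/-! ### Long and short roots, and the weights of generalized denominator type -/

section Lengths

variable [Fintype ι] {P : RootPairing ι ℝ M N} [P.IsRootSystem] [P.IsCrystallographic]
  [P.IsReduced]

/-! ### Root lengths -/

theorem nonempty_index [P.IsIrreducible] : Nonempty ι := by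
  have := RootPairing.IsIrreducible.nontrivial (P := P)
  by_contra h
  rw [not_nonempty_iff] at h
  have h1 := RootPairing.IsRootSystem.span_root_eq_top (P := P)
  rw [Set.range_eq_empty, Submodule.span_empty] at h1
  exact bot_ne_top h1

theorem rootNormSq_eq_of_isLong {i j : ι} (hi : IsLong P i) (hj : IsLong P j) :
    rootNormSq P i = rootNormSq P j := le_antisymm (hj i) (hi j)

-- An irreducible crystallographic system has at most two lengths, with squared ratio 1, 2 or 3.
-- Primality of a ratio other than 1 is used later to find a largest divisor of denominator type.
variable (P) in
theorem exists_lengthRatio [P.IsIrreducible] : ∃ m : ℕ, (m = 1 ∨ m.Prime) ∧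
    lengthRatio P = m ∧
    (∀ i j, IsLong P i → ¬ IsLong P j → rootNormSq P i = m * rootNormSq P j) ∧
    (m = 1 → ∀ i, IsLong P i) ∧ ∃ i, IsLong P i := by
  have := nonempty_index (P := P)
  obtain ⟨i, hi⟩ := Finite.exists_max (rootNormSq P)
  obtain ⟨j, hj⟩ := Finite.exists_min (rootNormSq P)
  have hi0 := rootNormSq_pos (P := P) i
  have hj0 := rootNormSq_pos (P := P) j
  have hsup : ⨆ k, rootNormSq P k = rootNormSq P i :=
    le_antisymm (ciSup_le hi) (le_ciSup (Set.finite_range _).bddAbove i)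
  have hinf : ⨅ k, rootNormSq P k = rootNormSq P j :=
    le_antisymm (ciInf_le (Set.finite_range _).bddBelow j) (le_ciInf hj)
  have hlong : ∀ k, rootNormSq P k = rootNormSq P i ↔ IsLong P k := fun k =>
    ⟨fun h l => h ▸ hi l, fun h => rootNormSq_eq_of_isLong h hi⟩
  have key : ∃ m : ℕ, (m = 1 ∨ m.Prime) ∧ rootNormSq P i = m * rootNormSq P j := by
    have h1 := hi j
    rcases P.toInvariantForm.apply_eq_or i j with h | h | h | h | h <;>
      change rootNormSq P _ = _ at h
    · exact ⟨1, Or.inl rfl, by rw [Nat.cast_one, one_mul]; exact h⟩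
    · exact ⟨2, Or.inr Nat.prime_two, by exact_mod_cast h⟩
    · exact ⟨3, Or.inr Nat.prime_three, by exact_mod_cast h⟩
    · change _ = 2 * rootNormSq P i at h
      linarith
    · change _ = 3 * rootNormSq P i at h
      linarith
  obtain ⟨m, hm, hij⟩ := key
  refine ⟨m, hm, ?_, ?_, ?_, i, hi⟩
  · rw [lengthRatio, hsup, hinf, hij, mul_div_cancel_right₀ _ hj0.ne']
  · intro k l hk hl
    rw [← hlong] at hl
    have hne : rootNormSq P i ≠ rootNormSq P j := fun h =>
      hl (le_antisymm (hi l) (h ▸ hj l))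
    rcases P.toInvariantForm.apply_eq_or_of_apply_ne hne l with h | h
    · exact absurd h hl
    · change rootNormSq P l = rootNormSq P j at h
      rw [h, (hlong k).2 hk, hij]
  · rintro rfl k
    rw [← hlong]
    rw [Nat.cast_one, one_mul] at hij
    exact le_antisymm (hi k) (hij ▸ hj k)

variable (P) in
/-- The ratio of the squares of the lengths of a long root and of a short root, as a natural
number. -/
def ratio [P.IsIrreducible] : ℕ := (exists_lengthRatio P).choose

open Classical in
variable (P) in
/-- The coefficients of the dual Weyl weight. -/
def tildeScale [P.IsIrreducible] (i : ι) : ℕ := if IsLong P i then 1 else ratio P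

section Irreducible

variable [P.IsIrreducible]

theorem ratio_eq_or : ratio P = 1 ∨ (ratio P).Prime := (exists_lengthRatio P).choose_spec.1

theorem ratio_pos : 0 < ratio P := by
  rcases ratio_eq_or (P := P) with h | h
  · omega
  · exact h.pos

theorem lengthRatio_eq : lengthRatio P = ratio P := (exists_lengthRatio P).choose_spec.2.1

theorem rootNormSq_long {i j : ι} (hi : IsLong P i) (hj : ¬ IsLong P j) :
    rootNormSq P i = ratio P * rootNormSq P j :=
  (exists_lengthRatio P).choose_spec.2.2.1 i j hi hj

theorem isLong_of_ratio_eq_one (h : ratio P = 1) (i : ι) : IsLong P i :=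
  (exists_lengthRatio P).choose_spec.2.2.2.1 h i

theorem rootNormSq_short {i j : ι} (hi : ¬ IsLong P i) (hj : ¬ IsLong P j) :
    rootNormSq P i = rootNormSq P j := by
  obtain ⟨k, hk⟩ := (exists_lengthRatio P).choose_spec.2.2.2.2
  have h := rootNormSq_long hk hi
  rw [rootNormSq_long hk hj] at h
  exact (mul_left_cancel₀ (by exact_mod_cast (ratio_pos (P := P)).ne') h).symm

theorem rootNormSq_eq_iff {i j : ι} :
    rootNormSq P i = rootNormSq P j ↔ (IsLong P i ↔ IsLong P j) := by
  refine ⟨fun h => ⟨fun hi k => h ▸ hi k, fun hj k => h ▸ hj k⟩, fun h => ?_⟩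
  by_cases hi : IsLong P i
  · exact rootNormSq_eq_of_isLong hi (h.1 hi)
  · exact rootNormSq_short hi fun hj => hi (h.2 hj)

theorem tildeScale_pos (i : ι) : 0 < tildeScale P i := by
  rw [tildeScale]
  split_ifs
  · exact one_pos
  · exact ratio_pos

theorem tildeScale_dvd_ratio (i : ι) : tildeScale P i ∣ ratio P := by
  rw [tildeScale]
  split_ifs
  · exact one_dvd _
  · exact dvd_rfl

/-- The scaling is inversely proportional to the squared length, so it turns the roots into the
coroots up to a common factor: it gives the dual root system. -/
theorem tildeScale_mul_rootNormSq (i j : ι) :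
    tildeScale P i * rootNormSq P i = tildeScale P j * rootNormSq P j := by
  simp only [tildeScale]
  split_ifs with hi hj hj
  · rw [rootNormSq_eq_of_isLong hi hj]
  · rw [rootNormSq_long hi hj, Nat.cast_one, one_mul]
  · rw [rootNormSq_long hj hi, Nat.cast_one, one_mul]
  · rw [rootNormSq_short hi hj]

end Irreducible

theorem pairingIn_mul_rootNormSq (i j : ι) :
    P.pairingIn ℤ i j * rootNormSq P j = P.pairingIn ℤ j i * rootNormSq P i := by
  have h1 := two_form_root (P := P) (P.root i) j
  have h2 := two_form_root (P := P) (P.root j) i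
  rw [P.root_coroot_eq_pairing, ← P.algebraMap_pairingIn ℤ] at h1 h2
  rw [← P.rootForm_symmetric.eq, RingHom.id_apply] at h1
  exact h1.symm.trans h2

theorem isScaling_const {d : ℕ} (hd : 0 < d) : IsScaling P fun _ => d :=
  ⟨fun _ => hd, fun _ _ _ _ => rfl, fun _ _ => dvd_mul_right _ _⟩

theorem isScaling_tildeScale [P.IsIrreducible] {d : ℕ} (hd : 0 < d) :
    IsScaling P fun i => d * tildeScale P i := by
  refine ⟨fun i => Nat.mul_pos hd (tildeScale_pos i), fun w i j h => ?_, fun i j => ?_⟩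
  · have h1 := rootNormSq_eq_iff.1 (rootNormSq_eq h)
    simp only [tildeScale]
    by_cases hi : IsLong P i
    · rw [if_pos hi, if_pos (h1.2 hi)]
    · rw [if_neg hi, if_neg fun hj => hi (h1.1 hj)]
  · have h1 := pairingIn_mul_rootNormSq (P := P) i j
    have h2 := tildeScale_mul_rootNormSq (P := P) i j
    have h3 : (tildeScale P j * P.pairingIn ℤ j i : ℝ) = tildeScale P i * P.pairingIn ℤ i j := by
      apply mul_right_cancel₀ (mul_pos (rootNormSq_pos (P := P) i) (rootNormSq_pos (P := P) j)).ne'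
      linear_combination (-rootNormSq P j * tildeScale P j) * h1 -
        P.pairingIn ℤ i j * rootNormSq P j * h2
    have h4 : (tildeScale P j * P.pairingIn ℤ j i : ℤ) = tildeScale P i * P.pairingIn ℤ i j := by
      exact_mod_cast h3
    refine ⟨P.pairingIn ℤ i j, ?_⟩
    push_cast
    linear_combination (d : ℤ) * h4

/-! ### Weights with prescribed coefficients -/

theorem mem_weightLattice_of_simple (b : P.Base) {x : M}
    (h : ∀ i ∈ b.support, ∃ n : ℤ, P.toLinearMap x (P.coroot i) = n) : x ∈ weightLattice P := by
  have key : ∀ y ∈ AddSubmonoid.closure (P.coroot '' b.support),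
      ∃ n : ℤ, P.toLinearMap x y = n := by
    intro y hy
    induction hy using AddSubmonoid.closure_induction with
    | mem y hy =>
      obtain ⟨i, hi, rfl⟩ := hy
      exact h i hi
    | zero => exact ⟨0, by simp⟩
    | add y z _ _ hy hz =>
      obtain ⟨m, hm⟩ := hy
      obtain ⟨n, hn⟩ := hz
      exact ⟨m + n, by rw [map_add, hm, hn, Int.cast_add]⟩
  intro i
  rcases b.coroot_mem_or_neg_mem i with hi | hi
  · exact key _ hi
  · obtain ⟨n, hn⟩ := key _ hi
    exact ⟨-n, by rw [Int.cast_neg, ← hn, map_neg, neg_neg]⟩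

theorem toLinearMap_sum_fundamentalWeight (b : P.Base) (c : b.support → ℝ) (j : b.support) :
    P.toLinearMap (∑ i, c i • fundamentalWeight b i) (P.coroot j) = c j := by
  classical
  rw [map_sum, LinearMap.sum_apply, Finset.sum_eq_single j]
  · rw [map_smul, LinearMap.smul_apply, fundamentalWeight_spec, if_pos rfl, smul_eq_mul, mul_one]
  · intro i _ hi
    rw [map_smul, LinearMap.smul_apply, fundamentalWeight_spec, if_neg hi.symm, smul_zero]
  · intro h
    exact absurd (Finset.mem_univ j) h

theorem exists_weight (b : P.Base) (c : ι → ℤ) :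
    ∃ x : weightLattice P, ∀ i ∈ b.support, mult x i = c i := by
  have hx := fun j => toLinearMap_sum_fundamentalWeight b (fun i => (c i : ℝ)) j
  refine ⟨⟨_, mem_weightLattice_of_simple b fun i hi => ⟨c i, hx ⟨i, hi⟩⟩⟩, fun i hi => ?_⟩
  have h1 := mult_spec (⟨_, mem_weightLattice_of_simple b fun i hi => ⟨c i, hx ⟨i, hi⟩⟩⟩ :
    weightLattice P) i
  have h2 := hx ⟨i, hi⟩
  exact_mod_cast h1.symm.trans h2

theorem ext_of_simple (b : P.Base) {x y : M}
    (h : ∀ i ∈ b.support, P.toLinearMap x (P.coroot i) = P.toLinearMap y (P.coroot i)) :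
    x = y := by
  apply P.toPerfPair.injective
  refine b.toCoweightBasis.ext fun i => ?_
  rw [RootPairing.Base.toCoweightBasis_apply]
  exact h i i.2

theorem eq_zsmul_rho_iff (b : P.Base) (x : weightLattice P) (d : ℤ) :
    (x : M) = d • rho b ↔ ∀ i ∈ b.support, mult x i = d := by
  have hr : ∀ i ∈ b.support, P.toLinearMap (d • rho b) (P.coroot i) = d := fun i hi => by
    have := toLinearMap_sum_fundamentalWeight b (fun _ => 1) ⟨i, hi⟩
    simp only [one_smul] at this
    rw [map_zsmul, LinearMap.smul_apply, rho, this]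
    simp
  constructor
  · intro h i hi
    have h1 := mult_spec x i
    rw [h, hr i hi] at h1
    exact_mod_cast h1.symm
  · intro h
    refine ext_of_simple b fun i hi => ?_
    rw [mult_spec, h i hi, hr i hi]

theorem eq_zsmul_rhoTilde_iff [P.IsIrreducible] (b : P.Base) (x : weightLattice P) (d : ℤ) :
    (x : M) = d • rhoTilde b ↔ ∀ i ∈ b.support, mult x i = d * tildeScale P i := by
  classical
  have hr : ∀ i ∈ b.support,
      P.toLinearMap (d • rhoTilde b) (P.coroot i) = d * tildeScale P i := fun i hi => by
    have := toLinearMap_sum_fundamentalWeight b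
      (fun i => if IsLong P i then 1 else lengthRatio P) ⟨i, hi⟩
    rw [map_zsmul, LinearMap.smul_apply, rhoTilde, this, tildeScale, lengthRatio_eq]
    split_ifs <;> simp
  constructor
  · intro h i hi
    have h1 := mult_spec x i
    rw [h, hr i hi] at h1
    exact_mod_cast h1.symm
  · intro h
    refine ext_of_simple b fun i hi => ?_
    rw [mult_spec, h i hi, hr i hi]
    push_cast
    ring

theorem isDominantRegular_iff (b : P.Base) (x : weightLattice P) :
    IsDominantRegular b x ↔ ∀ i ∈ b.support, 0 < mult x i := by
  constructor
  · exact fun h i hi => (h.1 i hi).lt_of_ne (h.2 i hi).symm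
  · exact fun h => ⟨fun i hi => (h i hi).le, fun i hi => (h i hi).ne'⟩

theorem support_nonempty [P.IsIrreducible] (b : P.Base) : b.support.Nonempty := by
  obtain ⟨j⟩ := nonempty_index (P := P)
  obtain ⟨i, hi, -⟩ := exists_simple_smul_eq b j
  exact ⟨i, hi⟩

/-- The scalings belonging to the weights of generalized Weyl denominator type. -/
def IsWeylScaling [P.IsIrreducible] (κ : ι → ℕ) : Prop :=
  ∃ d, 0 < d ∧ ((κ = fun _ => d) ∨ κ = fun i => d * tildeScale P i)

theorem IsWeylScaling.isScaling [P.IsIrreducible] {κ : ι → ℕ} (h : IsWeylScaling (P := P) κ) :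
    IsScaling P κ := by
  obtain ⟨d, hd, rfl | rfl⟩ := h
  · exact isScaling_const hd
  · exact isScaling_tildeScale hd

theorem weylDenominator_iff [P.IsIrreducible] (b : P.Base) (x : weightLattice P) :
    IsDominantRegular b x ∧ IsWeylDenominatorType b x ↔
      ∃ κ, IsWeylScaling (P := P) κ ∧ ∀ i ∈ b.support, mult x i = κ i := by
  constructor
  · rintro ⟨h1, h2⟩
    obtain ⟨i, hi⟩ := support_nonempty b
    have h3 := (isDominantRegular_iff b x).1 h1 i hi
    rcases h2 with ⟨d, hd⟩ | ⟨d, hd⟩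
    · rw [eq_zsmul_rho_iff] at hd
      rw [hd i hi] at h3
      lift d to ℕ using h3.le
      exact ⟨fun _ => d, ⟨d, by exact_mod_cast h3, Or.inl rfl⟩, hd⟩
    · rw [eq_zsmul_rhoTilde_iff] at hd
      rw [hd i hi] at h3
      have h4 : 0 < d := pos_of_mul_pos_left h3 (Nat.cast_nonneg _)
      lift d to ℕ using h4.le
      exact ⟨fun i => d * tildeScale P i, ⟨d, by exact_mod_cast h4, Or.inr rfl⟩,
        fun i hi => by rw [hd i hi]; push_cast; rfl⟩
  · rintro ⟨κ, hκ, hx⟩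
    refine ⟨(isDominantRegular_iff b x).2 fun i hi => ?_, ?_⟩
    · rw [hx i hi]
      exact_mod_cast hκ.isScaling.pos i
    · obtain ⟨d, hd, rfl | rfl⟩ := hκ
      · exact Or.inl ⟨d, (eq_zsmul_rho_iff b x d).2 hx⟩
      · refine Or.inr ⟨d, (eq_zsmul_rhoTilde_iff b x d).2 fun i hi => ?_⟩
        rw [hx i hi]
        push_cast
        rfl

/-- Among the weights of generalized Weyl denominator type which divide a given dominant regular
weight, one is divisible by all the others. -/
theorem exists_maximal_weylScaling [P.IsIrreducible] (b : P.Base) {x : weightLattice P}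
    (hx : IsDominantRegular b x) :
    ∃ κ, IsWeylScaling (P := P) κ ∧ (∀ i ∈ b.support, (κ i : ℤ) ∣ mult x i) ∧
      ∀ κ', IsWeylScaling (P := P) κ' → (∀ i ∈ b.support, (κ' i : ℤ) ∣ mult x i) →
        ∀ i ∈ b.support, κ' i ∣ κ i := by
  have hpos := (isDominantRegular_iff b x).1 hx
  set m : ι → ℕ := fun i => (mult x i).toNat with hm
  have hmz : ∀ i ∈ b.support, mult x i = m i := fun i hi =>
    (Int.toNat_of_nonneg (hpos i hi).le).symm
  have hdvd : ∀ κ : ι → ℕ, (∀ i ∈ b.support, (κ i : ℤ) ∣ mult x i) ↔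
      ∀ i ∈ b.support, κ i ∣ m i := fun κ => by
    refine forall₂_congr fun i hi => ?_
    rw [hmz i hi, Int.natCast_dvd_natCast]
  simp only [hdvd]
  set g := b.support.gcd m with hg
  have hgm : ∀ i ∈ b.support, g ∣ m i := fun i hi => Finset.gcd_dvd hi
  have hg0 : 0 < g := by
    obtain ⟨i, hi⟩ := support_nonempty b
    refine Nat.pos_of_dvd_of_pos (hgm i hi) ?_
    have := hpos i hi
    rw [hmz i hi] at this
    exact_mod_cast this
  have hdg : ∀ {d : ℕ}, (∀ i ∈ b.support, d ∣ m i) → d ∣ g := fun h => Finset.dvd_gcd h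
  -- With g the gcd of all coefficients, the largest divisor is gρ̃ if that divides x, and gρ
  -- otherwise.
  by_cases hA : ∀ i ∈ b.support, g * tildeScale P i ∣ m i
  · refine ⟨fun i => g * tildeScale P i, ⟨g, hg0, Or.inr rfl⟩, hA, ?_⟩
    rintro κ' ⟨d, hd, rfl | rfl⟩ h i hi
    · exact (hdg h).mul_right _
    · exact Nat.mul_dvd_mul_right (hdg fun j hj => (dvd_mul_right _ _).trans (h j hj)) _
  · refine ⟨fun _ => g, ⟨g, hg0, Or.inl rfl⟩, hgm, ?_⟩
    rintro κ' ⟨d, hd, rfl | rfl⟩ h i hi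
    · exact hdg h
    · obtain ⟨e, he⟩ := hdg fun j hj => (dvd_mul_right _ _).trans (h j hj)
      rcases ratio_eq_or (P := P) with hr | hr
      · have : tildeScale P i = 1 := Nat.dvd_one.1 (hr ▸ tildeScale_dvd_ratio i)
        change d * tildeScale P i ∣ g
        rw [this, mul_one, he]
        exact dvd_mul_right _ _
      by_cases hre : ratio P ∣ e
      · change d * tildeScale P i ∣ g
        rw [he]
        exact Nat.mul_dvd_mul_left _ ((tildeScale_dvd_ratio i).trans hre)
      -- Here g = de and the prime ratio does not divide e, so e is coprime to the scale. Both
      -- divide the coefficient of x divided by d, hence so does their product, and gρ̃ would divide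
      -- x.
      exfalso
      refine hA fun j hj => ?_
      have hcop : Nat.Coprime e (tildeScale P j) :=
        ((Nat.Prime.coprime_iff_not_dvd hr).2 hre).symm.coprime_dvd_right (tildeScale_dvd_ratio j)
      obtain ⟨u, hu⟩ := h j hj
      have h1 := hgm j hj
      rw [he, hu, mul_assoc] at h1
      have h2 := hcop.mul_dvd_of_dvd_of_dvd (Nat.dvd_of_mul_dvd_mul_left hd h1)
        (dvd_mul_right (tildeScale P j) u)
      rw [he, hu, mul_assoc, mul_assoc]
      exact Nat.mul_dvd_mul_left _ h2

end Lengths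

/-- Units of the group algebra of a group with two unique sums are monomials. -/
theorem exists_eq_single_of_mul_eq_one {R A : Type*} [CommRing R] [IsDomain R] [AddCommGroup A]
    [TwoUniqueSums A] {f g : AddMonoidAlgebra R A} (h : f * g = 1) :
    ∃ x c, f = AddMonoidAlgebra.single x c := by
  classical
  have hf : f ≠ 0 := by
    rintro rfl
    rw [zero_mul] at h
    exact zero_ne_one h
  have hg : g ≠ 0 := by
    rintro rfl
    rw [mul_zero] at h
    exact zero_ne_one h
  have hsupp : ∀ {f : AddMonoidAlgebra R A}, f ≠ 0 → f.coeff.support.Nonempty := fun h0 => by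
    rw [Finsupp.support_nonempty_iff]
    exact fun h1 => h0 (AddMonoidAlgebra.coeff_injective h1)
  have hcf := (hsupp hf).card_pos
  have hcg := (hsupp hg).card_pos
  have hcard : f.coeff.support.card = 1 := by
    by_contra hne
    -- If f had several terms, two different pairs of exponents would have a unique sum. Such sums
    -- survive in the product 1, so both are zero, and uniqueness makes the pairs equal.
    obtain ⟨p, hp, q, hq, hpq, hu, hu'⟩ := TwoUniqueSums.uniqueAdd_of_one_lt_card
      (A := f.coeff.support) (B := g.coeff.support)
      (lt_of_lt_of_le (by omega : 1 < f.coeff.support.card) (Nat.le_mul_of_pos_right _ hcg))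
    rw [Finset.mem_product] at hp hq
    have key : ∀ p : A × A, p.1 ∈ f.coeff.support → p.2 ∈ g.coeff.support →
        UniqueAdd f.coeff.support g.coeff.support p.1 p.2 → p.1 + p.2 = 0 := by
      intro p h1 h2 hu
      have h3 := AddMonoidAlgebra.coeff_mul_add_of_uniqueAdd hu
      by_contra h0
      rw [h, show (AddMonoidAlgebra.coeff (1 : AddMonoidAlgebra R A)) (p.1 + p.2) = 0 from
        Finsupp.single_eq_of_ne h0] at h3
      exact mul_ne_zero (Finsupp.mem_support_iff.1 h1) (Finsupp.mem_support_iff.1 h2) h3.symm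
    have h1 := key p hp.1 hp.2 hu
    have h2 := key q hq.1 hq.2 hu'
    have h3 := hu' hp.1 hp.2 (h1.trans h2.symm)
    exact hpq (Prod.ext h3.1 h3.2)
  obtain ⟨x, c, -, hx⟩ := Finsupp.card_support_eq_one'.1 hcard
  exact ⟨x, c, AddMonoidAlgebra.coeff_injective hx⟩

/-! ### Divisibility over the invariants and the normalized least common multiple -/

section Lcm

variable [Fintype ι] {P : RootPairing ι ℝ M N} [P.IsRootSystem] [P.IsCrystallographic]
  [P.IsReduced]

theorem weylActAlg_mul (w : P.weylGroup) (f g : WeightAlgebra P) :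
    weylActAlg P w (f * g) = weylActAlg P w f * weylActAlg P w g :=
  AddMonoidAlgebra.mapDomain_mul _ _ _

theorem weylActAlg_single (w : P.weylGroup) (x : weightLattice P) (c : ℤ) :
    weylActAlg P w (AddMonoidAlgebra.single x c) =
      AddMonoidAlgebra.single (weylAct P w x) c :=
  AddMonoidAlgebra.mapDomain_single

theorem isAlternating_schurWeyl (b : P.Base) (x : weightLattice P) :
    IsAlternating b (schurWeyl b x) := by
  intro w
  rw [schurWeyl]
  refine (map_sum (AddMonoidAlgebra.mapDomainRingHom ℤ (weylAct P w)) _ _).trans ?_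
  rw [Finset.smul_sum]
  refine Fintype.sum_equiv (Equiv.mulLeft w) _ _ fun w' => ?_
  rw [AddMonoidAlgebra.mapDomainRingHom_apply, AddMonoidAlgebra.mapDomain_single, Equiv.coe_mulLeft, sign_mul, AddMonoidAlgebra.smul_single,
    smul_eq_mul, ← mul_assoc, sign_mul_self, one_mul]
  rfl

theorem coeff_toAmbient {k : Type*} [CommRing k] (f : WeightAlgebra P) (x : weightLattice P) :
    (toAmbient P k f).coeff (x : M) = f.coeff x := by
  induction f using AddMonoidAlgebra.induction_linear with
  | zero => simp
  | add f g hf hg => simp [hf, hg]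
  | single y c =>
    classical
    rw [toAmbient_single, AddMonoidAlgebra.coeff_single, AddMonoidAlgebra.coeff_single,
      Finsupp.single_apply, Finsupp.single_apply]
    by_cases h : y = x
    · rw [if_pos h, if_pos (by rw [h])]
    · rw [if_neg h, if_neg fun h' => h (Subtype.ext h'), Int.cast_zero]

theorem hasLeadingCoeffOne_schurWeyl (b : P.Base) {x : weightLattice P}
    (hx : IsDominantRegular b x) : HasLeadingCoeffOne b (schurWeyl b x) := by
  have h1 : ∀ y : weightLattice P, (schurWeyl b x).coeff y =
      (incl ℤ b (schurPoly ℤ b x)).coeff ((y : M) - x) := fun y => by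
    rw [← one_mul ((incl ℤ b (schurPoly ℤ b x)).coeff _), ← coeff_single_mul',
      ← schurAmbient_eq ℤ b hx, ← toAmbient_schurWeyl, coeff_toAmbient, Int.cast_id]
  refine ⟨x, ?_, fun y hy => ?_⟩
  · have h2 := coeff_incl b (schurPoly ℤ b x) 0
    have h3 := constantCoeff_schurPoly (k := ℤ) b hx
    rw [map_zero, neg_zero] at h2
    rw [MvPolynomial.constantCoeff_eq] at h3
    rw [h1, sub_self, h2]
    exact h3
  · rw [Finsupp.mem_support_iff, h1] at hy
    obtain ⟨n, hn⟩ := exists_of_coeff_incl_ne_zero b _ hy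
    rw [← neg_sub, hn, neg_neg]
    exact (mem_posCone_iff b _).2 ⟨n, rfl⟩

/-- A root as an element of the weight lattice. -/
def rootWeight (P : RootPairing ι ℝ M N) [P.IsCrystallographic] (i : ι) : weightLattice P :=
  ⟨P.root i, fun j => ⟨P.pairingIn ℤ i j, by
    rw [P.root_coroot_eq_pairing, ← P.algebraMap_pairingIn ℤ]; rfl⟩⟩

theorem schurWeyl_eq_prod {κ : ι → ℕ} (hκ : IsScaling P κ) (b : P.Base) {x : weightLattice P}
    (hx : ∀ i ∈ b.support, mult x i = κ i) :
    schurWeyl b x = AddMonoidAlgebra.single x 1 *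
      ∏ j ∈ posRoots b, (1 - AddMonoidAlgebra.single (-(κ j • rootWeight P j)) 1) := by
  have hreg : IsDominantRegular b x := (isDominantRegular_iff b x).2 fun i hi => by
    rw [hx i hi]
    exact_mod_cast hκ.pos i
  apply toAmbient_injective (P := P) ℤ
  rw [toAmbient_schurWeyl, schurAmbient_eq ℤ b hreg, schurPoly_eq_denomPoly ℤ hκ b hx,
    incl_denomPoly, map_mul, map_prod, toAmbient_single, Int.cast_one]
  congr 1
  refine Finset.prod_congr rfl fun j _ => ?_
  rw [map_sub, map_one, toAmbient_single, Int.cast_one]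
  rfl

/-- The signs of two alternating elements cancel in their quotient, so in a domain it is
automatically invariant. -/
theorem invDvd_of_mul_eq (b : P.Base) {x y : weightLattice P} (hx : IsDominantRegular b x)
    {q : WeightAlgebra P} (h : schurWeyl b y = q * schurWeyl b x) :
    InvDvd (schurWeyl b x) (schurWeyl b y) := by
  refine ⟨q, fun w => ?_, h⟩
  have h1 := congrArg (weylActAlg P w) h
  rw [weylActAlg_mul, isAlternating_schurWeyl b x w, isAlternating_schurWeyl b y w, h,
    mul_smul_comm] at h1
  have h2 : (sign b w • schurWeyl b x : WeightAlgebra P) ≠ 0 := by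
    refine smul_ne_zero (fun h0 => ?_) (schurWeyl_ne_zero b hx)
    have := sign_mul_self b w
    simp [h0] at this
  rw [← mul_smul_comm, ← mul_smul_comm] at h1
  exact (mul_right_cancel₀ h2 h1).symm

/-- Divisibility of the scales spreads from simple roots to all roots by conjugacy. In the product
formula each factor 1 - e^{-κγ} then divides 1 - e^{-κ'γ}, with a geometric sum as quotient. -/
theorem invDvd_of_dvd {κ κ' : ι → ℕ} (hκ : IsScaling P κ) (hκ' : IsScaling P κ') (b : P.Base)
    {x y : weightLattice P} (hx : ∀ i ∈ b.support, mult x i = κ i)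
    (hy : ∀ i ∈ b.support, mult y i = κ' i) (h : ∀ i ∈ b.support, κ i ∣ κ' i) :
    InvDvd (schurWeyl b x) (schurWeyl b y) := by
  have hreg : IsDominantRegular b x := (isDominantRegular_iff b x).2 fun i hi => by
    rw [hx i hi]
    exact_mod_cast hκ.pos i
  have hdvd : ∀ j, κ j ∣ κ' j := fun j => by
    obtain ⟨i, hi, w, hw⟩ := exists_simple_smul_eq b j
    rw [← hκ.invariant w i j hw, ← hκ'.invariant w i j hw]
    exact h i hi
  choose n hn using hdvd
  set e : ι → WeightAlgebra P := fun j => AddMonoidAlgebra.single (-(κ j • rootWeight P j)) 1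
    with he
  refine invDvd_of_mul_eq b hreg (q := AddMonoidAlgebra.single (y - x) 1 *
    ∏ j ∈ posRoots b, ∑ t ∈ Finset.range (n j), e j ^ t) ?_
  rw [schurWeyl_eq_prod hκ b hx, schurWeyl_eq_prod hκ' b hy, mul_mul_mul_comm,
    AddMonoidAlgebra.single_mul_single, sub_add_cancel, one_mul, ← Finset.prod_mul_distrib]
  congr 1
  refine Finset.prod_congr rfl fun j _ => ?_
  rw [geom_sum_mul_neg, he, AddMonoidAlgebra.single_pow, one_pow, hn j, smul_neg, ← mul_smul,
    mul_comm (κ j)]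

/-- Two such elements differ by a unit, hence by a monomial. Invariance under all reflections makes
its exponent zero, and the normalization makes its coefficient 1. -/
theorem isWeylLcm_unique (b : P.Base) {x : weightLattice P} {f g : WeightAlgebra P}
    (hf : IsWeylLcm b x f) (hg : IsWeylLcm b x g) : f = g := by
  obtain ⟨q, hq, h1⟩ := hf.2.2.1 g hg.1 hg.2.1
  obtain ⟨q', -, h2⟩ := hg.2.2.1 f hf.1 hf.2.1
  obtain ⟨u, hu, hu'⟩ := hf.2.2.2
  obtain ⟨v, hv, hv'⟩ := hg.2.2.2
  have hf0 : f ≠ 0 := by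
    rintro rfl
    simp at hu
  have h3 : q * q' = 1 := by
    apply mul_right_cancel₀ hf0
    rw [one_mul, mul_comm q, mul_assoc, ← h1, ← h2]
  obtain ⟨y, c, rfl⟩ := exists_eq_single_of_mul_eq_one h3
  have hc0 : c ≠ 0 := by
    rintro rfl
    simp at h3
  have hy : y = 0 := by
    apply Subtype.ext
    refine ext_of_simple b fun i _ => ?_
    have h4 := hq (refl P i)
    rw [weylActAlg_single] at h4
    have h5 := congrArg (fun f => AddMonoidAlgebra.coeff f y) h4
    simp only [AddMonoidAlgebra.coeff_single, Finsupp.single_eq_same] at h5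
    have h6 : weylAct P (refl P i) y = y := by
      by_contra hne
      rw [Finsupp.single_eq_of_ne (Ne.symm hne)] at h5
      exact hc0 h5.symm
    have h7 : refl P i • (y : M) = y := congrArg Subtype.val h6
    rw [refl_smul, sub_eq_self, smul_eq_zero] at h7
    rw [h7.resolve_right (P.ne_zero i)]
    simp
  subst hy
  have hgc : ∀ z, g.coeff z = c * f.coeff z := fun z => by
    rw [h1, AddMonoidAlgebra.coeff_single_mul_eq_mul_coeff z]
    simp
  have huv : u = v := by
    apply Subtype.ext
    rw [← sub_eq_zero]
    refine posCone_antisymm b (hu' v ?_) ?_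
    · rw [Finsupp.mem_support_iff]
      intro h0
      rw [hgc, h0, mul_zero] at hv
      exact zero_ne_one hv
    · rw [neg_sub]
      refine hv' u ?_
      rw [Finsupp.mem_support_iff, hgc, hu, mul_one]
      exact hc0
  have hc : c = 1 := by
    rw [← huv, hgc, hu, mul_one] at hv
    exact hv
  rw [h1, hc]
  exact (one_mul f).symm

/-- The normalized least common multiple for a weight which is not of generalized Weyl
denominator type is itself a Schur-Weyl element. -/
theorem exists_weylLcm_eq [P.IsIrreducible] (b : P.Base) {x : weightLattice P}
    (hx : IsDominantRegular b x) (hnot : ¬ IsWeylDenominatorType b x) :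
    ∃ (κ : ι → ℕ) (y : weightLattice P), IsWeylScaling (P := P) κ ∧
      (∀ i ∈ b.support, mult y i = κ i) ∧ IsDominantRegular b y ∧ y ≠ x ∧
      weylLcm b x = schurWeyl b y := by
  obtain ⟨κ, hκ, hdvd, hmax⟩ := exists_maximal_weylScaling b hx
  obtain ⟨y, hy⟩ := exists_weight b fun i => (κ i : ℤ)
  obtain ⟨hyreg, hytype⟩ := (weylDenominator_iff b y).2 ⟨κ, hκ, hy⟩
  have hne : y ≠ x := by
    rintro rfl
    exact hnot hytype
  -- Since x is not of denominator type, the largest divisor y is itself one of the proper factors,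
  -- and all the others divide it.
  have hlcm : IsWeylLcm b x (schurWeyl b y) := by
    refine ⟨isAlternating_schurWeyl b y, fun z hz => ?_, fun g _ hg => ?_,
      hasLeadingCoeffOne_schurWeyl b hyreg⟩
    · obtain ⟨κ', hκ', hz'⟩ := (weylDenominator_iff b z).1 ⟨hz.1, hz.2.1⟩
      refine invDvd_of_dvd hκ'.isScaling hκ.isScaling b hz' hy (hmax κ' hκ' fun i hi => ?_)
      rw [← hz' i hi]
      exact hz.2.2.1 i hi
    · exact hg y ⟨hyreg, hytype, fun i hi => by rw [hy i hi]; exact hdvd i hi, hne⟩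
  refine ⟨κ, y, hκ, hy, hyreg, hne, ?_⟩
  have h : ∃ f, IsWeylLcm b x f := ⟨_, hlcm⟩
  rw [weylLcm, dif_pos h]
  exact isWeylLcm_unique b h.choose_spec hlcm

end Lcm

/-! ### Primes of the group algebra of a lattice -/

section Prime

variable {k A : Type*} [Field k] [AddCommGroup A]

/-- The endomorphism of the group algebra which replaces `e ^ γ` by `ζ`, where `φ γ = 1`. -/
def retraction (φ : A →+ ℤ) (γ : A) (ζ : kˣ) : AddMonoidAlgebra k A →ₐ[k] AddMonoidAlgebra k A :=
  AddMonoidAlgebra.lift k (AddMonoidAlgebra k A) A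
    { toFun := fun x => AddMonoidAlgebra.single (x.toAdd - φ x.toAdd • γ)
        ((ζ ^ φ x.toAdd : kˣ) : k)
      map_one' := by simp [AddMonoidAlgebra.one_def]
      map_mul' := fun x y => by
        rw [AddMonoidAlgebra.single_mul_single, toAdd_mul, map_add, zpow_add, Units.val_mul]
        congr 1
        rw [add_smul]
        abel }

theorem retraction_single (φ : A →+ ℤ) (γ : A) (ζ : kˣ) (x : A) (c : k) :
    retraction φ γ ζ (AddMonoidAlgebra.single x c) =
      AddMonoidAlgebra.single (x - φ x • γ) (c * ((ζ ^ φ x : kˣ) : k)) := by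
  rw [retraction, AddMonoidAlgebra.lift_single]
  change c • AddMonoidAlgebra.single _ _ = _
  rw [AddMonoidAlgebra.smul_single, smul_eq_mul]
  rfl

/-- Modulo 1 - ζe^{-γ} one has e^γ = ζ, so the retraction induces the identity on the quotient; its
kernel is therefore the ideal generated by this element. -/
theorem retraction_eq_zero_iff (φ : A →+ ℤ) {γ : A} (hγ : φ γ = 1) (ζ : kˣ)
    (f : AddMonoidAlgebra k A) :
    retraction φ γ ζ f = 0 ↔ 1 - AddMonoidAlgebra.single (-γ) (ζ : k) ∣ f := by
  set p : AddMonoidAlgebra k A := 1 - AddMonoidAlgebra.single (-γ) (ζ : k) with hp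
  have hp0 : retraction φ γ ζ p = 0 := by
    rw [hp, map_sub, map_one, retraction_single, map_neg, hγ, sub_eq_zero]
    simp [AddMonoidAlgebra.one_def]
  constructor
  · intro h
    let mk := Ideal.Quotient.mk (Ideal.span {p})
    let ψ : Multiplicative ℤ →* AddMonoidAlgebra k A ⧸ Ideal.span {p} :=
      (mk : _ →* _).comp
        { toFun := fun n => AddMonoidAlgebra.single (-(n.toAdd • γ)) ((ζ ^ n.toAdd : kˣ) : k)
          map_one' := by simp [AddMonoidAlgebra.one_def]
          map_mul' := fun x y => by
            rw [AddMonoidAlgebra.single_mul_single, toAdd_mul, zpow_add, Units.val_mul]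
            congr 1
            rw [add_smul]
            abel }
    have hψ : ψ = 1 := by
      apply MonoidHom.ext_mint
      change mk (AddMonoidAlgebra.single (-((1 : ℤ) • γ)) ((ζ ^ (1 : ℤ) : kˣ) : k)) = 1
      rw [one_smul, zpow_one, ← map_one mk, ← sub_eq_zero, ← map_sub,
        Ideal.Quotient.eq_zero_iff_mem, Ideal.mem_span_singleton, ← neg_sub, dvd_neg]
    have hmk : ∀ g, mk (retraction φ γ ζ g) = mk g := by
      intro g
      induction g using AddMonoidAlgebra.induction_linear with
      | zero => simp
      | add f g hf hg => simp only [map_add, hf, hg]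
      | single x c =>
        have h1 : ψ (Multiplicative.ofAdd (φ x)) = 1 := by rw [hψ]; rfl
        have h2 : retraction φ γ ζ (AddMonoidAlgebra.single x c) =
            AddMonoidAlgebra.single x c *
              AddMonoidAlgebra.single (-(φ x • γ)) ((ζ ^ φ x : kˣ) : k) := by
          rw [retraction_single, AddMonoidAlgebra.single_mul_single, sub_eq_add_neg]
        rw [h2, map_mul]
        exact (congrArg (mk (AddMonoidAlgebra.single x c) * ·) h1).trans (mul_one _)
    have h1 := hmk f
    rw [h, map_zero, eq_comm, Ideal.Quotient.eq_zero_iff_mem, Ideal.mem_span_singleton] at h1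
    exact h1
  · rintro ⟨q, rfl⟩
    rw [map_mul, hp0, zero_mul]

/-- It generates the kernel of a homomorphism into a domain. -/
theorem prime_one_sub_single [TwoUniqueSums A] (φ : A →+ ℤ) {γ : A} (hγ : φ γ = 1) (ζ : kˣ) :
    Prime (1 - AddMonoidAlgebra.single (-γ) (ζ : k) : AddMonoidAlgebra k A) := by
  have hd := fun f => retraction_eq_zero_iff φ hγ ζ f
  refine ⟨fun h => ?_, fun h => ?_, fun f g h => ?_⟩
  · have h1 := congrArg (fun f => AddMonoidAlgebra.coeff f 0) h
    have hne : (0 : A) ≠ -γ := fun h0 => by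
      rw [zero_eq_neg] at h0
      rw [h0, map_zero] at hγ
      exact zero_ne_one hγ
    simp only [AddMonoidAlgebra.coeff_sub, Finsupp.sub_apply, AddMonoidAlgebra.coeff_single,
      Finsupp.single_eq_of_ne hne, AddMonoidAlgebra.coeff_zero, Finsupp.zero_apply, sub_zero] at h1
    rw [show (AddMonoidAlgebra.coeff (1 : AddMonoidAlgebra k A)) 0 = 1 from
      Finsupp.single_eq_same] at h1
    exact one_ne_zero h1
  · have h1 := (hd 1).2 h.dvd
    rw [map_one] at h1
    exact one_ne_zero h1
  · rw [← hd, ← hd, ← mul_eq_zero, ← map_mul]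
    exact (hd _).2 h

/-- The retraction must send the second monomial to 1, which forces γ' to be a multiple of γ; as γ'
is primitive, the multiplier is ±1. -/
theorem eq_of_one_sub_single_dvd [TwoUniqueSums A] {φ φ' : A →+ ℤ} {γ γ' : A} (hγ : φ γ = 1)
    (hγ' : φ' γ' = 1) {ζ ζ' : kˣ}
    (h : (1 - AddMonoidAlgebra.single (-γ) (ζ : k) : AddMonoidAlgebra k A) ∣
      1 - AddMonoidAlgebra.single (-γ') (ζ' : k)) :
    γ = γ' ∧ ζ = ζ' ∨ γ' = -γ := by
  classical
  rw [← retraction_eq_zero_iff φ hγ, map_sub, map_one, retraction_single, sub_eq_zero,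
    AddMonoidAlgebra.one_def] at h
  have h0 := congrArg (fun f => AddMonoidAlgebra.coeff f 0) h
  simp only [AddMonoidAlgebra.coeff_single, Finsupp.single_eq_same, Finsupp.single_apply] at h0
  split_ifs at h0 with h1
  · rw [map_neg, neg_smul, sub_neg_eq_add, neg_add_eq_zero] at h1
    have h2 := congrArg φ' h1
    rw [hγ', map_zsmul, smul_eq_mul, eq_comm, mul_comm] at h2
    rcases Int.eq_one_or_neg_one_of_mul_eq_one' h2 with h3 | h3
    · left
      rw [h3.2, one_smul] at h1
      subst h1
      refine ⟨rfl, ?_⟩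
      rw [map_neg, hγ] at h0
      have h4 : (1 : kˣ) = ζ' * ζ ^ (-1 : ℤ) := Units.ext h0
      rw [zpow_neg_one, eq_mul_inv_iff_mul_eq, one_mul] at h4
      exact h4
    · right
      rw [h1, h3.2, neg_one_smul]
  · exact absurd h0 one_ne_zero

theorem one_sub_pow_eq_prod {R : Type*} [CommRing R] [IsDomain R] [Algebra ℂ R] {n : ℕ}
    (hn : 0 < n) (y : R) :
    1 - y ^ n = ∏ ζ ∈ Polynomial.nthRootsFinset n (1 : ℂ), (1 - algebraMap ℂ R ζ * y) := by
  classical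
  have hζ := Complex.isPrimitiveRoot_exp n hn.ne'
  have hinj : Function.Injective (algebraMap ℂ R) := FaithfulSMul.algebraMap_injective ℂ R
  have h := (hζ.map_of_injective hinj).pow_sub_pow_eq_prod_sub_mul 1 y hn
  have himg : Polynomial.nthRootsFinset n (1 : R) =
      (Polynomial.nthRootsFinset n (1 : ℂ)).image (algebraMap ℂ R) := by
    symm
    refine Finset.eq_of_subset_of_card_le (fun x hx => ?_) ?_
    · obtain ⟨ζ, hζ, rfl⟩ := Finset.mem_image.1 hx
      exact Polynomial.map_mem_nthRootsFinset_one hζ _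
    · rw [Finset.card_image_of_injective _ hinj, hζ.card_nthRootsFinset,
        (hζ.map_of_injective hinj).card_nthRootsFinset]
  rw [one_pow, himg, Finset.prod_image fun _ _ _ _ h => hinj h] at h
  exact h

end Prime

/-! ### The group algebra of the root lattice -/

section RootLattice

variable [Fintype ι] {P : RootPairing ι ℝ M N} [P.IsRootSystem] [P.IsCrystallographic]
  [P.IsReduced]

variable (P) in
/-- The lattice generated by the roots. -/
def rootLattice : AddSubgroup M := AddSubgroup.closure (Set.range P.root)

variable (P) in
instance twoUniqueSums_rootLattice : TwoUniqueSums (rootLattice P) :=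
  TwoUniqueSums.of_injective_addHom (rootLattice P).subtype.toAddHom Subtype.val_injective
    inferInstance

variable (P) in
/-- The complex group algebra of the root lattice. -/
abbrev RootAlgebra : Type _ := AddMonoidAlgebra ℂ (rootLattice P)

theorem smul_mem_rootLattice (w : P.weylGroup) {x : M} (hx : x ∈ rootLattice P) :
    w • x ∈ rootLattice P := by
  induction hx using AddSubgroup.closure_induction with
  | mem x hx =>
    obtain ⟨i, rfl⟩ := hx
    obtain ⟨j, hj⟩ := exists_smul_root w i
    rw [hj]
    exact AddSubgroup.subset_closure ⟨j, rfl⟩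
  | zero => rw [smul_zero]; exact zero_mem _
  | add x y _ _ hx hy => rw [smul_add]; exact add_mem hx hy
  | neg x _ hx => rw [smul_neg]; exact neg_mem hx

/-- The action of an element of the Weyl group on the root lattice. -/
def latticeAct (w : P.weylGroup) : rootLattice P →+ rootLattice P where
  toFun x := ⟨w • (x : M), smul_mem_rootLattice w x.2⟩
  map_zero' := by ext; simp
  map_add' x y := by ext; simp

/-- The action of an element of the Weyl group on the group algebra of the root lattice. -/
def latticeHom (w : P.weylGroup) : RootAlgebra P →+* RootAlgebra P :=
  AddMonoidAlgebra.mapDomainRingHom ℂ (latticeAct w)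

theorem latticeHom_single (w : P.weylGroup) (x : rootLattice P) (c : ℂ) :
    latticeHom w (AddMonoidAlgebra.single x c) = AddMonoidAlgebra.single (latticeAct w x) c :=
  AddMonoidAlgebra.mapDomain_single

variable (P) in
/-- The embedding of the group algebra of the root lattice into that of the whole space. -/
def latticeToAmbient : RootAlgebra P →+* AddMonoidAlgebra ℂ M :=
  AddMonoidAlgebra.mapDomainRingHom ℂ (rootLattice P).subtype

theorem latticeToAmbient_single (x : rootLattice P) (c : ℂ) :
    latticeToAmbient P (AddMonoidAlgebra.single x c) = AddMonoidAlgebra.single (x : M) c :=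
  AddMonoidAlgebra.mapDomain_single

theorem latticeToAmbient_injective : Function.Injective (latticeToAmbient P) :=
  AddMonoidAlgebra.mapDomain_injective Subtype.val_injective

theorem latticeToAmbient_latticeHom (w : P.weylGroup) (f : RootAlgebra P) :
    latticeToAmbient P (latticeHom w f) = weylHom ℂ w (latticeToAmbient P f) := by
  induction f using AddMonoidAlgebra.induction_linear with
  | zero => simp only [map_zero]
  | add f g hf hg => simp only [map_add, hf, hg]
  | single x c =>
    rw [latticeHom_single, latticeToAmbient_single, latticeToAmbient_single, weylHom_single]
    rfl

variable (P) in
/-- A root as an element of the root lattice. -/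
def latticeRoot (i : ι) : rootLattice P := ⟨P.root i, AddSubgroup.subset_closure ⟨i, rfl⟩⟩

theorem latticeAct_latticeRoot {w : P.weylGroup} {i j : ι} (h : w • P.root i = P.root j) :
    latticeAct w (latticeRoot P i) = latticeRoot P j := Subtype.ext h

theorem exists_coord_eq (b : P.Base) (i : b.support) {x : M} (hx : x ∈ rootLattice P) :
    ∃ n : ℤ, coord b i x = n := by
  have hcone : ∀ y ∈ posCone b, ∃ n : ℤ, coord b i y = n := fun y hy => by
    obtain ⟨n, rfl⟩ := (mem_posCone_iff b y).1 hy
    exact ⟨n i, by rw [coord_coneVec]; rfl⟩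
  induction hx using AddSubgroup.closure_induction with
  | mem x hx =>
    obtain ⟨j, rfl⟩ := hx
    rcases b.root_mem_or_neg_mem j with h | h
    · exact hcone _ h
    · obtain ⟨n, hn⟩ := hcone _ h
      exact ⟨-n, by rw [Int.cast_neg, ← hn, map_neg, neg_neg]⟩
  | zero => exact ⟨0, by rw [map_zero, Int.cast_zero]⟩
  | add x y _ _ hx hy =>
    obtain ⟨m, hm⟩ := hx
    obtain ⟨n, hn⟩ := hy
    exact ⟨m + n, by rw [map_add, hm, hn, Int.cast_add]⟩
  | neg x _ hx =>
    obtain ⟨m, hm⟩ := hx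
    exact ⟨-m, by rw [map_neg, hm, Int.cast_neg]⟩

/-- The coefficient of an element of the root lattice at a simple root. -/
def latticeCoord (b : P.Base) (i : b.support) : rootLattice P →+ ℤ :=
  AddMonoidHom.mk' (fun x => (exists_coord_eq b i x.2).choose) fun x y => by
    have h : ∀ z : rootLattice P, coord b i (z : M) = ((exists_coord_eq b i z.2).choose : ℝ) :=
      fun z => (exists_coord_eq b i z.2).choose_spec
    have h1 := (h (x + y)).symm.trans ((map_add _ _ _).trans (congrArg₂ (· + ·) (h x) (h y)))
    exact_mod_cast h1

theorem cast_latticeCoord (b : P.Base) (i : b.support) (x : rootLattice P) :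
    (latticeCoord b i x : ℝ) = coord b i (x : M) := (exists_coord_eq b i x.2).choose_spec.symm

/-- Conjugate the root to a simple one and take the coordinate there. Roots are thus primitive in
the root lattice, while in the weight lattice they can be divisible (twice the fundamental weight in
type A₁); hence the change of lattice. -/
theorem exists_lattice_functional (b : P.Base) (j : ι) :
    ∃ φ : rootLattice P →+ ℤ, φ (latticeRoot P j) = 1 := by
  classical
  obtain ⟨i, hi, w, hw⟩ := exists_simple_smul_eq b j
  refine ⟨(latticeCoord b ⟨i, hi⟩).comp (latticeAct w⁻¹), ?_⟩
  have h1 : w⁻¹ • P.root j = P.root i := by rw [← hw, inv_smul_smul]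
  have h2 := cast_latticeCoord b ⟨i, hi⟩ (latticeRoot P i)
  rw [AddMonoidHom.comp_apply, latticeAct_latticeRoot h1]
  have h3 := coord_root b ⟨i, hi⟩ ⟨i, hi⟩
  rw [if_pos rfl] at h3
  have h4 : (latticeCoord b ⟨i, hi⟩ (latticeRoot P i) : ℝ) = 1 := h2.trans h3
  exact_mod_cast h4

theorem coneVec_mem_rootLattice (b : P.Base) (n : b.support →₀ ℕ) :
    coneVec b n ∈ rootLattice P := by
  rw [coneVec_apply]
  exact sum_mem fun i _ => nsmul_mem (AddSubgroup.subset_closure (Set.mem_range_self (i : ι))) _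

/-- The embedding of the polynomial ring into the group algebra of the root lattice. -/
def latticeIncl (b : P.Base) : MvPolynomial b.support ℂ →+* RootAlgebra P :=
  AddMonoidAlgebra.mapDomainRingHom ℂ
    (-((coneVec b).codRestrict (rootLattice P) (coneVec_mem_rootLattice b)))

theorem latticeToAmbient_latticeIncl (b : P.Base) (p : MvPolynomial b.support ℂ) :
    latticeToAmbient P (latticeIncl b p) = incl ℂ b p := by
  induction p using MvPolynomial.induction_on' with
  | monomial n c =>
    rw [incl_monomial]
    refine (congrArg (latticeToAmbient P) AddMonoidAlgebra.mapDomain_single).trans ?_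
    rw [latticeToAmbient_single]
    rfl
  | add p q hp hq => simp only [map_add, hp, hq]

/-- The linear polynomials `1 - ζ e ^ (-γ)`. -/
def linPoly (b : P.Base) (j : ι) (ζ : ℂ) : MvPolynomial b.support ℂ :=
  1 - MvPolynomial.monomial (coneCoeff b (P.root j)) ζ

theorem latticeIncl_linPoly (b : P.Base) {j : ι} (hj : j ∈ posRoots b) (ζ : ℂ) :
    latticeIncl b (linPoly b j ζ) = 1 - AddMonoidAlgebra.single (-latticeRoot P j) ζ := by
  apply latticeToAmbient_injective
  rw [latticeToAmbient_latticeIncl, linPoly, map_sub, map_one, incl_monomial,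
    coneVec_coneCoeff b ((isPos_iff_mem b j).1 (mem_posRoots.1 hj)), map_sub, map_one,
    latticeToAmbient_single]
  rfl

theorem prime_latticeIncl_linPoly (b : P.Base) {j : ι} (hj : j ∈ posRoots b) {ζ : ℂ}
    (hζ : ζ ≠ 0) : Prime (latticeIncl b (linPoly b j ζ)) := by
  obtain ⟨φ, hφ⟩ := exists_lattice_functional b j
  rw [latticeIncl_linPoly b hj]
  exact prime_one_sub_single φ hφ (Units.mk0 ζ hζ)

theorem eq_of_linPoly_dvd (b : P.Base) {i j : ι} (hi : i ∈ posRoots b) (hj : j ∈ posRoots b)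
    {ζ η : ℂ} (hζ : ζ ≠ 0) (hη : η ≠ 0)
    (h : latticeIncl b (linPoly b i ζ) ∣ latticeIncl b (linPoly b j η)) : i = j ∧ ζ = η := by
  obtain ⟨φ, hφ⟩ := exists_lattice_functional b i
  obtain ⟨φ', hφ'⟩ := exists_lattice_functional b j
  rw [latticeIncl_linPoly b hi, latticeIncl_linPoly b hj] at h
  rcases eq_of_one_sub_single_dvd (ζ := Units.mk0 ζ hζ) (ζ' := Units.mk0 η hη) hφ hφ' h with
    ⟨h1, h2⟩ | h1
  · exact ⟨P.root.injective (congrArg Subtype.val h1), congrArg Units.val h2⟩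
  · exfalso
    have h2 : P.root j = -P.root i := congrArg Subtype.val h1
    rw [mem_posRoots, isPos_iff_mem] at hi hj
    exact P.ne_zero i (posCone_antisymm b hi (h2 ▸ hj))

/-- The group element w multiplies the Schur-Weyl polynomial by the unit ε(w)e^{x - wx}, whose
exponent lies in the root lattice, so it permutes the divisors. -/
theorem linPoly_dvd_of_smul_eq (b : P.Base) {x : weightLattice P} (hx : IsDominantRegular b x)
    {w : P.weylGroup} {i j : ι} (hi : i ∈ posRoots b) (hj : j ∈ posRoots b)
    (hw : w • P.root i = P.root j) {ζ : ℂ}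
    (h : latticeIncl b (linPoly b i ζ) ∣ latticeIncl b (schurPoly ℂ b x)) :
    latticeIncl b (linPoly b j ζ) ∣ latticeIncl b (schurPoly ℂ b x) := by
  have hmem : (x : M) - w • (x : M) ∈ rootLattice P := by
    obtain ⟨n, hn⟩ := (mem_posCone_iff b _).1 (sub_smul_mem_posCone b x hx.1 w)
    rw [← hn]
    exact coneVec_mem_rootLattice b n
  have h1 : latticeHom w (latticeIncl b (schurPoly ℂ b x)) =
      AddMonoidAlgebra.single (⟨_, hmem⟩ : rootLattice P) (sign b w : ℂ) *
        latticeIncl b (schurPoly ℂ b x) := by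
    apply latticeToAmbient_injective
    rw [latticeToAmbient_latticeHom, map_mul, latticeToAmbient_single,
      latticeToAmbient_latticeIncl]
    have h2 := weylHom_schurAmbient (k := ℂ) b (x : M) w
    rw [schurAmbient_eq ℂ b hx, map_mul, weylHom_single] at h2
    have h3 := congrArg (AddMonoidAlgebra.single (-(w • (x : M))) (1 : ℂ) * ·) h2
    rw [← mul_assoc, AddMonoidAlgebra.single_mul_single, neg_add_cancel, mul_one,
      ← AddMonoidAlgebra.one_def, one_mul] at h3
    rw [h3, ← smul_mul_assoc, ← mul_assoc, AddMonoidAlgebra.smul_single,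
      AddMonoidAlgebra.single_mul_single, neg_add_eq_sub, one_mul, zsmul_eq_mul, mul_one]
  obtain ⟨q, hq⟩ := h
  have h2 := congrArg (latticeHom w) hq
  rw [h1, map_mul, latticeIncl_linPoly b hi, map_sub, map_one, latticeHom_single, map_neg,
    latticeAct_latticeRoot hw, ← latticeIncl_linPoly b hj] at h2
  have hs : (sign b w : ℂ) * sign b w = 1 := by
    rw [← Int.cast_mul, sign_mul_self, Int.cast_one]
  refine ⟨AddMonoidAlgebra.single (-(⟨_, hmem⟩ : rootLattice P)) (sign b w : ℂ) *
    latticeHom w q, ?_⟩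
  rw [mul_left_comm, ← h2, ← mul_assoc, AddMonoidAlgebra.single_mul_single, neg_add_cancel, hs,
    ← AddMonoidAlgebra.one_def, one_mul]

end RootLattice

/-! ### Schur-Weyl polynomials that split into linear factors -/

section Factorization

variable [Fintype ι] {P : RootPairing ι ℝ M N} [P.IsRootSystem] [P.IsCrystallographic]
  [P.IsReduced]

theorem constantCoeff_linPoly (b : P.Base) {j : ι} (hj : j ∈ posRoots b) (ζ : ℂ) :
    MvPolynomial.constantCoeff (linPoly b j ζ) = 1 := by
  classical
  rw [linPoly, map_sub, map_one, MvPolynomial.constantCoeff_monomial, if_neg, sub_zero]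
  intro h
  have h1 := congrArg (coneVec b) h
  rw [coneVec_coneCoeff b ((isPos_iff_mem b j).1 (mem_posRoots.1 hj)), map_zero] at h1
  exact P.ne_zero j h1

theorem coneCoeff_simple (b : P.Base) (i : b.support) :
    coneCoeff b (P.root i) = Finsupp.single i 1 := by
  apply coneVec_injective b
  rw [coneVec_coneCoeff b (simple_mem_posCone b i.2), coneVec_single, one_smul]

theorem eq_of_coneCoeff_eq_single (b : P.Base) {j : ι} (hj : j ∈ posRoots b) {i : b.support}
    {n : ℕ} (h : coneCoeff b (P.root j) = Finsupp.single i n) : j = i ∧ n = 1 := by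
  have hcone := coneVec_coneCoeff b ((isPos_iff_mem b j).1 (mem_posRoots.1 hj))
  rw [h, coneVec_single] at hcone
  obtain ⟨φ, hφ⟩ := exists_lattice_functional b j
  have h2 : latticeRoot P j = n • latticeRoot P i := Subtype.ext hcone.symm
  rw [h2, map_nsmul, nsmul_eq_mul] at hφ
  have h3 : n = 1 := by
    have := Int.eq_one_or_neg_one_of_mul_eq_one hφ
    omega
  rw [h3, one_smul] at hcone
  exact ⟨P.root.injective hcone.symm, h3⟩

open Classical in
theorem eval_edgeHom_linPoly (b : P.Base) (i : b.support) {j : ι} (hj : j ∈ posRoots b)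
    (z η : ℂ) : (edgeHom ℂ i (linPoly b j η)).eval z = if j = i then 1 - η * z else 1 := by
  have key : edgeHom ℂ i (MvPolynomial.monomial (coneCoeff b (P.root j)) η) =
      if j = i then Polynomial.C η * Polynomial.X else 0 := by
    ext n
    rw [coeff_edgeHom]
    refine (MvPolynomial.coeff_monomial _ _ _).trans ?_
    by_cases h : j = i
    · rw [if_pos h, h, coneCoeff_simple, Polynomial.coeff_C_mul_X]
      by_cases hn : n = 1
      · rw [if_pos hn, if_pos (by rw [hn])]
      · rw [if_neg hn, if_neg fun h' => hn (Finsupp.single_injective i h').symm]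
    · rw [if_neg h, Polynomial.coeff_zero, if_neg]
      exact fun h1 => h (eq_of_coneCoeff_eq_single b hj h1).1
  rw [linPoly, map_sub, map_one, key]
  split_ifs <;> simp

/-- The pairs of a positive root `γ` and of a root of unity of order dividing `κ γ`. -/
def rootPairs (b : P.Base) (κ : ι → ℕ) : Finset (Σ _ : ι, ℂ) :=
  (posRoots b).sigma fun j => Polynomial.nthRootsFinset (κ j) 1

theorem mem_rootPairs {b : P.Base} {κ : ι → ℕ} (hκ : ∀ i, 0 < κ i) {p : Σ _ : ι, ℂ} :
    p ∈ rootPairs b κ ↔ p.1 ∈ posRoots b ∧ p.2 ^ κ p.1 = 1 := by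
  rw [rootPairs, Finset.mem_sigma, Polynomial.mem_nthRootsFinset (hκ p.1)]

theorem denomPoly_eq_prod (b : P.Base) {κ : ι → ℕ} (hκ : ∀ i, 0 < κ i) :
    denomPoly ℂ b κ = ∏ p ∈ rootPairs b κ, linPoly b p.1 p.2 := by
  rw [rootPairs, Finset.prod_sigma, denomPoly]
  refine Finset.prod_congr rfl fun j _ => ?_
  have h := one_sub_pow_eq_prod (hκ j)
    (MvPolynomial.monomial (coneCoeff b (P.root j)) (1 : ℂ))
  rw [MvPolynomial.monomial_pow, one_pow] at h
  rw [h]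
  refine Finset.prod_congr rfl fun ζ _ => ?_
  rw [linPoly, MvPolynomial.algebraMap_eq, MvPolynomial.C_mul_monomial, mul_one]

/-- A Weyl group invariant polynomial in the exponentials of negative roots is constant. -/
theorem eq_one_of_weylHom_eq (b : P.Base) {h : MvPolynomial b.support ℂ}
    (hc : MvPolynomial.constantCoeff h = 1)
    (hinv : ∀ w : P.weylGroup, weylHom ℂ w (incl ℂ b h) = incl ℂ b h) : h = 1 := by
  classical
  have key : ∀ n, n ≠ 0 → h.coeff n = 0 := by
    intro n hn
    by_contra hne
    rw [← coeff_incl] at hne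
    have horb : ∀ w : P.weylGroup, ∃ m, w • coneVec b n = coneVec b m := fun w => by
      have h1 := coeff_weylHom w (incl ℂ b h) (-coneVec b n)
      rw [hinv] at h1
      obtain ⟨m, hm⟩ := exists_of_coeff_incl_ne_zero b h (by rwa [h1])
      exact ⟨m, by rw [smul_neg] at hm; exact neg_injective hm⟩
    -- The orbit stays in the cone. Its element of least height is antidominant, hence zero.
    obtain ⟨w, hw⟩ := Finite.exists_min fun w : P.weylGroup => ht b (w • coneVec b n)
    obtain ⟨m, hm⟩ := horb w
    have h0 : coneVec b m = 0 := by
      refine coneVec_eq_zero_of_nonpos b fun i => ?_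
      have h2 := hw (refl P i * w)
      rw [mul_smul, hm, refl_smul, map_sub, map_smul, ← height_eq_ht,
        b.height_one_of_mem_support i.2] at h2
      simpa using h2
    rw [h0, ← smul_zero w] at hm
    apply hn
    apply coneVec_injective b
    rw [map_zero]
    exact MulAction.injective w hm
  ext n
  by_cases hn : n = 0
  · rw [hn]
    exact hc.trans (map_one MvPolynomial.constantCoeff).symm
  · rw [show MvPolynomial.coeff n h = 0 from key n hn, MvPolynomial.coeff_one,
      if_neg (Ne.symm hn)]

theorem eq_of_pow_eq_one_iff {m n : ℕ} (hm : 0 < m) (hn : 0 < n)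
    (h : ∀ ζ : ℂ, ζ ≠ 0 → (ζ ^ m = 1 ↔ ζ ^ n = 1)) : m = n := by
  have h1 := Complex.isPrimitiveRoot_exp m hm.ne'
  have h2 := Complex.isPrimitiveRoot_exp n hn.ne'
  exact Nat.dvd_antisymm
    (h1.dvd_of_pow_eq_one _ ((h _ (h1.ne_zero hm.ne')).1 h1.pow_eq_one))
    (h2.dvd_of_pow_eq_one _ ((h _ (h2.ne_zero hn.ne')).2 h2.pow_eq_one))

/-- A product of linear polynomials which is a Schur-Weyl polynomial is the denominator of a
scaled root system. -/
theorem exists_eq_denomPoly_of_eq_prod (b : P.Base) {x : weightLattice P}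
    (hx : IsDominantRegular b x) {σ : Type*} (t : Finset σ) (e : σ → Σ _ : ι, ℂ)
    (he : ∀ p ∈ t, (e p).1 ∈ posRoots b ∧ (e p).2 ≠ 0)
    (hs : schurPoly ℂ b x = ∏ p ∈ t, linPoly b (e p).1 (e p).2) :
    ∃ a : ι → ℕ, IsWeylInvariant P a ∧ (∀ i ∈ b.support, mult x i = a i) ∧
      schurPoly ℂ b x = denomPoly ℂ b a := by
  classical
  have hdvd : ∀ j ∈ posRoots b, ∀ ζ ≠ 0,
      latticeIncl b (linPoly b j ζ) ∣ latticeIncl b (schurPoly ℂ b x) → ∃ p ∈ t, e p = ⟨j, ζ⟩ := by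
    intro j hj ζ hζ h
    rw [hs, map_prod] at h
    obtain ⟨p, hp, h1⟩ := (prime_latticeIncl_linPoly b hj hζ).exists_mem_finset_dvd h
    obtain ⟨h2, h3⟩ := eq_of_linPoly_dvd b hj (he p hp).1 hζ (he p hp).2 h1
    exact ⟨p, hp, by rw [h2, h3]⟩
  have hdvd' : ∀ p ∈ t, linPoly b (e p).1 (e p).2 ∣ schurPoly ℂ b x := fun p hp => by
    rw [hs]
    exact Finset.dvd_prod_of_mem _ hp
  have hpos := (isDominantRegular_iff b x).1 hx
  have hedge : ∀ (i : b.support) (z : ℂ), (edgeHom ℂ i (schurPoly ℂ b x)).eval z =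
      1 - z ^ (mult x i).toNat := fun i z => by
    rw [edgeHom_schurPoly b hx]
    simp
  -- In the variable of α_i alone the polynomial is 1 - z^{m_i}, and only factors at α_i stay
  -- nonconstant. The values ζ at a simple root are thus the m_i-th roots of unity.
  have hsimple : ∀ (i : b.support) (ζ : ℂ), ζ ≠ 0 →
      ((∃ p ∈ t, e p = ⟨i, ζ⟩) ↔ ζ ^ (mult x i).toNat = 1) := by
    intro i ζ hζ
    constructor
    · rintro ⟨p, hp, hep⟩
      have h1 := hdvd' p hp
      rw [hep] at h1
      have h2 := (Polynomial.evalRingHom ζ⁻¹).map_dvd ((edgeHom ℂ i).toRingHom.map_dvd h1)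
      change (edgeHom ℂ i (linPoly b i ζ)).eval ζ⁻¹ ∣ (edgeHom ℂ i (schurPoly ℂ b x)).eval ζ⁻¹
        at h2
      rw [eval_edgeHom_linPoly b i (simple_mem_posRoots i.2), if_pos rfl, mul_inv_cancel₀ hζ,
        sub_self, zero_dvd_iff, hedge, sub_eq_zero, inv_pow, eq_comm, inv_eq_one] at h2
      exact h2
    · intro h
      have h1 : (edgeHom ℂ i (schurPoly ℂ b x)).eval ζ⁻¹ = 0 := by
        rw [hedge, inv_pow, h, inv_one, sub_self]
      rw [hs, map_prod, Polynomial.eval_prod, Finset.prod_eq_zero_iff] at h1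
      obtain ⟨p, hp, h2⟩ := h1
      refine ⟨p, hp, ?_⟩
      rw [eval_edgeHom_linPoly b i (he p hp).1] at h2
      split_ifs at h2 with h3
      · rw [sub_eq_zero, eq_comm, mul_inv_eq_one₀ hζ] at h2
        exact Sigma.ext h3 (heq_of_eq h2)
      · exact absurd h2 one_ne_zero
  have hconj : ∀ (w : P.weylGroup) (i j : ι), i ∈ posRoots b → j ∈ posRoots b →
      w • P.root i = P.root j → ∀ ζ ≠ 0, (∃ p ∈ t, e p = ⟨i, ζ⟩) → ∃ p ∈ t, e p = ⟨j, ζ⟩ := by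
    rintro w i j hi hj hw ζ hζ ⟨p, hp, hep⟩
    have h1 := hdvd' p hp
    rw [hep] at h1
    exact hdvd j hj ζ hζ (linPoly_dvd_of_smul_eq b hx hi hj hw ((latticeIncl b).map_dvd h1))
  have hmult : ∀ (w : P.weylGroup) (i j : ι), i ∈ b.support → j ∈ b.support →
      w • P.root i = P.root j → (mult x i).toNat = (mult x j).toNat := by
    intro w i j hi hj hw
    have h1 := hpos i hi
    have h2 := hpos j hj
    refine eq_of_pow_eq_one_iff (by omega) (by omega) fun ζ hζ => ?_
    rw [← hsimple ⟨i, hi⟩ ζ hζ, ← hsimple ⟨j, hj⟩ ζ hζ]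
    refine ⟨hconj w i j (simple_mem_posRoots hi) (simple_mem_posRoots hj) hw ζ hζ,
      hconj w⁻¹ j i (simple_mem_posRoots hj) (simple_mem_posRoots hi) ?_ ζ hζ⟩
    rw [← hw, inv_smul_smul]
  -- The scale of a root is read off at a conjugate simple root; `hmult` makes it independent of the
  -- choice.
  choose r hr w hw using exists_simple_smul_eq b
  set a : ι → ℕ := fun j => (mult x (r j)).toNat with ha
  have hainv : IsWeylInvariant P a := by
    intro v i j hv
    refine hmult ((w j)⁻¹ * v * w i) _ _ (hr i) (hr j) ?_
    rw [mul_smul, mul_smul, hw, hv, ← hw j, inv_smul_smul]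
  have hasimple : ∀ i ∈ b.support, mult x i = a i := fun i hi => by
    have h1 := hmult (w i) (r i) i (hr i) hi (hw i)
    have h2 := hpos i hi
    simp only [ha]
    omega
  have hapos : ∀ j, 0 < a j := fun j => by
    have := hpos (r j) (hr j)
    simp only [ha]
    omega
  refine ⟨a, hainv, hasimple, ?_⟩
  have hex : ∀ p : Σ _ : ι, ℂ, p ∈ rootPairs b a → ∃ q ∈ t, e q = p := by
    rintro ⟨j, ζ⟩ hp
    rw [mem_rootPairs hapos] at hp
    have hζ : ζ ≠ 0 := by
      rintro rfl
      rw [zero_pow (hapos j).ne'] at hp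
      exact zero_ne_one hp.2
    exact hconj (w j) (r j) j (simple_mem_posRoots (hr j)) hp.1 (hw j) ζ hζ
      ((hsimple ⟨r j, hr j⟩ ζ hζ).2 hp.2)
  -- The family may contain repetitions, so one representative of each expected factor is selected.
  -- The product of the rest is a quotient of two alternating elements, hence invariant, hence 1.
  obtain ⟨t', ht', hinj, himg⟩ := Finset.exists_subset_injOn_image_eq_of_surjOn (t : Set σ)
    (rootPairs b a) (f := e) fun p hp => hex p hp
  have hsub : t' ⊆ t := Finset.coe_subset.1 ht'
  set h' := ∏ p ∈ t \ t', linPoly b (e p).1 (e p).2 with hh'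
  have hs' : schurPoly ℂ b x = h' * denomPoly ℂ b a := by
    rw [hs, ← Finset.prod_sdiff hsub, denomPoly_eq_prod b hapos, ← himg, Finset.prod_image hinj]
  have hh1 : h' = 1 := by
    have : IsDomain (AddMonoidAlgebra ℂ M) := NoZeroDivisors.to_isDomain _
    refine eq_one_of_weylHom_eq b ?_ fun v => ?_
    · rw [hh', map_prod]
      exact Finset.prod_eq_one fun p hp =>
        constantCoeff_linPoly b (he p (Finset.mem_sdiff.1 hp).1).1 _
    · have h1 := weylHom_schurAmbient (k := ℂ) b (x : M) v
      rw [schurAmbient_eq ℂ b hx, hs', map_mul (incl ℂ b), mul_left_comm, map_mul,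
        weylHom_denomPoly hainv b hasimple,
        ← mul_smul_comm (sign b v) (incl ℂ b h')] at h1
      refine mul_right_cancel₀ ?_ h1
      intro h0
      have h2 := sign_mul_self b v
      have h3 := congrArg (fun f => sign b v • f) h0
      simp only [← mul_smul, h2, one_smul, smul_zero] at h3
      have h4 := congrArg (fun f => AddMonoidAlgebra.coeff f (x : M)) h3
      simp only [coeff_single_mul', sub_self, one_mul] at h4
      have h5 := coeff_incl b (denomPoly ℂ b a) 0
      have h6 := constantCoeff_denomPoly (k := ℂ) hapos b
      rw [map_zero, neg_zero, h4] at h5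
      rw [MvPolynomial.constantCoeff_eq] at h6
      exact zero_ne_one (h5.trans h6)
  rw [hs', hh1, one_mul]

/-- A Schur-Weyl polynomial which divides a product of two denominators is itself the denominator
of a scaled root system. -/
theorem exists_eq_denomPoly_of_mul_eq (b : P.Base) {x : weightLattice P}
    (hx : IsDominantRegular b x) {κ κ' : ι → ℕ} (hκ : ∀ i, 0 < κ i) (hκ' : ∀ i, 0 < κ' i)
    {f : MvPolynomial b.support ℂ}
    (h : schurPoly ℂ b x * f = denomPoly ℂ b κ * denomPoly ℂ b κ') :
    ∃ a : ι → ℕ, IsWeylInvariant P a ∧ (∀ i ∈ b.support, mult x i = a i) ∧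
      schurPoly ℂ b x = denomPoly ℂ b a := by
  classical
  -- The disjoint union keeps factors common to both denominators apart.
  set s := (rootPairs b κ).disjSum (rootPairs b κ') with hs
  set e : (Σ _ : ι, ℂ) ⊕ (Σ _ : ι, ℂ) → Σ _ : ι, ℂ := Sum.elim id id with he
  have hes : ∀ p ∈ s, (e p).1 ∈ posRoots b ∧ (e p).2 ≠ 0 := by
    have key : ∀ {κ : ι → ℕ}, (∀ i, 0 < κ i) → ∀ p ∈ rootPairs b κ,
        p.1 ∈ posRoots b ∧ p.2 ≠ 0 := fun hκ p hp => by
      rw [mem_rootPairs hκ] at hp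
      refine ⟨hp.1, fun h0 => ?_⟩
      rw [h0, zero_pow (hκ _).ne'] at hp
      exact zero_ne_one hp.2
    intro p hp
    rcases Finset.mem_disjSum.1 hp with ⟨q, hq, rfl⟩ | ⟨q, hq, rfl⟩
    · exact key hκ q hq
    · exact key hκ' q hq
  have h1 : latticeIncl b (schurPoly ℂ b x) * latticeIncl b f =
      1 * ∏ p ∈ s, latticeIncl b (linPoly b (e p).1 (e p).2) := by
    rw [← map_mul, h, denomPoly_eq_prod b hκ, denomPoly_eq_prod b hκ', ← map_prod, hs,
      Finset.prod_disjSum, one_mul]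
    rfl
  obtain ⟨t, u, c, d, htu, -, hcd, h2, -⟩ := mul_eq_mul_prime_prod
    (fun p hp => prime_latticeIncl_linPoly b (hes p hp).1 (hes p hp).2) h1
  have het : ∀ p ∈ t, (e p).1 ∈ posRoots b ∧ (e p).2 ≠ 0 := fun p hp =>
    hes p (htu ▸ Finset.mem_union_left _ hp)
  -- A divisor of a product of primes is a subproduct up to a unit. The unit is a monomial, which
  -- comparison of leading terms removes.
  obtain ⟨y, c, rfl⟩ := exists_eq_single_of_mul_eq_one hcd.symm
  have hc : c ≠ 0 := by
    rintro rfl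
    rw [AddMonoidAlgebra.single_zero, zero_mul] at hcd
    exact one_ne_zero hcd
  have h3 := congrArg (latticeToAmbient P) h2
  rw [← map_prod, map_mul, latticeToAmbient_single, latticeToAmbient_latticeIncl,
    latticeToAmbient_latticeIncl] at h3
  have h4 := leading_cancel b hc (x := (y : M)) (y := 0)
    (p := ∏ p ∈ t, linPoly b (e p).1 (e p).2) (q := schurPoly ℂ b x)
    (by rw [map_prod]; exact Finset.prod_eq_one fun p hp => constantCoeff_linPoly b (het p hp).1 _)
    (constantCoeff_schurPoly b hx)
    (by rw [← AddMonoidAlgebra.one_def, one_mul, h3])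
  exact exists_eq_denomPoly_of_eq_prod b hx t e het h4.2.2.symm

end Factorization

/-! ### Adjacent simple roots of different lengths -/

section Adjacent

variable [Fintype ι] {P : RootPairing ι ℝ M N} [P.IsRootSystem] [P.IsCrystallographic]
  [P.IsReduced] [P.IsIrreducible]

/-- The pairings are z and mz with z < 0, where m ≥ 2 is the ratio. Their product mz² is at most 4,
which leaves z = -1. -/
theorem two_form_of_long_short (b : P.Base) {i j : b.support} (hi : IsLong P i)
    (hj : ¬ IsLong P j) (hij : P.RootForm (P.root i) (P.root j) ≠ 0) :
    2 * P.RootForm (P.root i) (P.root j) = -(ratio P * rootNormSq P j) := by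
  have hne : i ≠ j := by
    rintro rfl
    exact hj hi
  have hm : 2 ≤ ratio P := by
    rcases ratio_eq_or (P := P) with h | h
    · exact absurd (isLong_of_ratio_eq_one h j) hj
    · exact h.two_le
  have h1 := two_form_root (P := P) (P.root i) j
  have h2 := two_form_root (P := P) (P.root j) i
  have h3 := simple_form_nonpos b hne
  have h4 := rootNormSq_long hi hj
  have h5 := rootNormSq_pos (P := P) (j : ι)
  have hm' : (2 : ℝ) ≤ ratio P := by exact_mod_cast hm
  rw [P.root_coroot_eq_pairing, ← P.algebraMap_pairingIn ℤ] at h1 h2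
  rw [← P.rootForm_symmetric.eq, RingHom.id_apply] at h2
  change _ = (P.pairingIn ℤ i j : ℝ) * rootNormSq P j at h1
  change _ = (P.pairingIn ℤ j i : ℝ) * rootNormSq P i at h2
  rw [h4] at h2
  set y := P.pairingIn ℤ i j with hy
  set z := P.pairingIn ℤ j i with hz
  have hyz : (y : ℝ) = z * ratio P := by
    apply mul_right_cancel₀ h5.ne'
    rw [← h1, h2]
    ring
  have hyz' : y = z * ratio P := by exact_mod_cast hyz
  have hz0 : z < 0 := by
    have : (z : ℝ) < 0 := by
      by_contra! hc
      have h6 : 0 ≤ (z : ℝ) * (ratio P * rootNormSq P j) := by positivity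
      exact hij (le_antisymm h3 (by linarith))
    exact_mod_cast this
  have hw := P.coxeterWeightIn_mem_set_of_isCrystallographic (i : ι) j
  rw [RootPairing.coxeterWeightIn, ← hy, ← hz, hyz'] at hw
  simp only [Set.mem_insert_iff, Set.mem_singleton_iff] at hw
  have hz1 : z = -1 := by
    by_contra hz1
    have hz2 : z ≤ -2 := by omega
    have hm2 : (2 : ℤ) ≤ ratio P := by exact_mod_cast hm
    have h6 : 4 ≤ z * z := by nlinarith
    have h7 : z * ratio P * z = ratio P * (z * z) := by ring
    have h8 : 8 ≤ z * ratio P * z := by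
      rw [h7]
      nlinarith
    omega
  rw [h2, hz1]
  push_cast
  ring

variable {a : ι → ℕ}

/-- Any other T contains a mixed root pα_i + qα_j with p, q > 0. If it is long, its scale is a_i, so
p = 1, and its length gives q = m. If it is short, its scale is a_j, so q = 1, and its length gives
p = 1. The remaining roots of T have no room to contribute to the coordinate that is still open. -/
theorem eq_or_eq_of_sum_eq (b : P.Base) (ha : ∀ i, 0 < a i) (hinv : IsWeylInvariant P a)
    {i j : b.support} (hi : IsLong P i) (hj : ¬ IsLong P j)
    (hij : P.RootForm (P.root i) (P.root j) ≠ 0) {T : Finset ι} (hT : T ⊆ posRoots b)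
    (hsum : ∑ l ∈ T, a l • coneCoeff b (P.root l) =
      Finsupp.single i (a i) + Finsupp.single j (a j)) :
    (∀ l, l ∈ T ↔ l = i ∨ l = j) ∨ a i = a j ∨ a j = ratio P * a i := by
  classical
  have hne : i ≠ j := by
    rintro rfl
    exact hj hi
  set c : ι → b.support →₀ ℕ := fun l => coneCoeff b (P.root l) with hc
  have hsi : ∑ l ∈ T, a l * c l i = a i := by
    have := DFunLike.congr_fun hsum i
    rw [Finsupp.finsetSum_apply, Finsupp.add_apply, Finsupp.single_eq_same,
      Finsupp.single_eq_of_ne hne, add_zero] at this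
    exact this
  have hsj : ∑ l ∈ T, a l * c l j = a j := by
    have := DFunLike.congr_fun hsum j
    rw [Finsupp.finsetSum_apply, Finsupp.add_apply, Finsupp.single_eq_same,
      Finsupp.single_eq_of_ne hne.symm, zero_add] at this
    exact this
  have hsk : ∀ l ∈ T, ∀ k, k ≠ i → k ≠ j → c l k = 0 := by
    intro l hl k hki hkj
    have := DFunLike.congr_fun hsum k
    rw [Finsupp.finsetSum_apply, Finsupp.add_apply, Finsupp.single_eq_of_ne hki,
      Finsupp.single_eq_of_ne hkj, add_zero, Finset.sum_eq_zero_iff] at this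
    exact (Nat.mul_eq_zero.1 (this l hl)).resolve_left (ha l).ne'
  have hcl : ∀ l ∈ T, c l = Finsupp.single i (c l i) + Finsupp.single j (c l j) := by
    intro l hl
    ext k
    rw [Finsupp.add_apply]
    by_cases hki : k = i
    · rw [hki, Finsupp.single_eq_same, Finsupp.single_eq_of_ne hne, add_zero]
    by_cases hkj : k = j
    · rw [hkj, Finsupp.single_eq_same, Finsupp.single_eq_of_ne hne.symm, zero_add]
    · rw [Finsupp.single_eq_of_ne hki, Finsupp.single_eq_of_ne hkj, hsk l hl k hki hkj,
        add_zero]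
  have hli : ∀ l ∈ T, c l j = 0 → l = i ∧ c l i = 1 := fun l hl h0 => by
    have h1 := hcl l hl
    rw [h0, Finsupp.single_zero, add_zero] at h1
    exact eq_of_coneCoeff_eq_single b (hT hl) h1
  have hlj : ∀ l ∈ T, c l i = 0 → l = j ∧ c l j = 1 := fun l hl h0 => by
    have h1 := hcl l hl
    rw [h0, Finsupp.single_zero, zero_add] at h1
    exact eq_of_coneCoeff_eq_single b (hT hl) h1
  by_cases hmix : ∃ l ∈ T, c l i ≠ 0 ∧ c l j ≠ 0
  · right
    obtain ⟨l, hl, hp, hq⟩ := hmix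
    set p := c l i with hpdef
    set q := c l j with hqdef
    have hnorm : rootNormSq P l = rootNormSq P j *
        (ratio P * p ^ 2 + q ^ 2 - ratio P * p * q) := by
      have h1 : P.root l = (p : ℝ) • P.root i + (q : ℝ) • P.root j := by
        rw [← coneVec_coneCoeff b ((isPos_iff_mem b l).1 (mem_posRoots.1 (hT hl))),
          show coneCoeff b (P.root l) = _ from hcl l hl, map_add, coneVec_single, coneVec_single,
          Nat.cast_smul_eq_nsmul, Nat.cast_smul_eq_nsmul]
      have h2 := two_form_of_long_short b hi hj hij
      have h3 := rootNormSq_long hi hj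
      have h4 := P.rootForm_symmetric.eq (P.root j) (P.root i)
      rw [RingHom.id_apply] at h4
      rw [rootNormSq, h1]
      simp only [map_add, map_smul, LinearMap.add_apply, LinearMap.smul_apply, smul_eq_mul]
      rw [h4]
      rw [rootNormSq, rootNormSq] at h3
      rw [rootNormSq] at h2 ⊢
      linear_combination (p : ℝ) * q * h2 + (p : ℝ) ^ 2 * h3
    have hBpos := rootNormSq_pos (P := P) (j : ι)
    have hri := Finset.add_sum_erase T (fun l => a l * c l i) hl
    have hrj := Finset.add_sum_erase T (fun l => a l * c l j) hl
    simp only [hsi, hsj] at hri hrj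
    rw [← hpdef] at hri
    rw [← hqdef] at hrj
    by_cases hlong : IsLong P l
    · right
      obtain ⟨w, hw⟩ := exists_smul_eq_of_rootNormSq_eq (rootNormSq_eq_of_isLong hlong hi)
      have hal := hinv w l i hw
      rw [hal] at hri hrj
      have hp1 : p = 1 := by
        have h1 : a i * p ≤ a i * 1 := by omega
        have := Nat.le_of_mul_le_mul_left h1 (ha i)
        omega
      have hqm : q = ratio P := by
        have h1 := rootNormSq_long hlong hj
        rw [hnorm, hp1, mul_comm _ (rootNormSq P (j : ι))] at h1
        have h2 := mul_left_cancel₀ hBpos.ne' h1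
        have h3 : (q : ℝ) * q = ratio P * q := by
          push_cast at h2
          linear_combination h2
        have h4 := mul_right_cancel₀ (Nat.cast_ne_zero.2 hq) h3
        exact_mod_cast h4
      rw [hp1, mul_one] at hri
      have h0 : ∑ x ∈ T.erase l, a x * c x i = 0 := by omega
      rw [Finset.sum_eq_zero_iff] at h0
      have hrest : ∑ x ∈ T.erase l, a x * c x j = 0 := by
        refine Finset.sum_eq_zero fun k hk => ?_
        exfalso
        have h1 := (Nat.mul_eq_zero.1 (h0 k hk)).resolve_left (ha k).ne'
        have h2 := hlj k (Finset.mem_of_mem_erase hk) h1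
        have h3 := Finset.single_le_sum (f := fun x => a x * c x j)
          (fun x _ => Nat.zero_le _) hk
        rw [h2.2, h2.1, mul_one] at h3
        have h4 := Nat.mul_pos (ha i) (Nat.pos_of_ne_zero hq)
        omega
      rw [hrest, add_zero, hqm] at hrj
      rw [← hrj, mul_comm]
    · left
      obtain ⟨w, hw⟩ := exists_smul_eq_of_rootNormSq_eq (rootNormSq_short hlong hj)
      have hal := hinv w l j hw
      rw [hal] at hri hrj
      have hq1 : q = 1 := by
        have h1 : a j * q ≤ a j * 1 := by omega
        have := Nat.le_of_mul_le_mul_left h1 (ha j)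
        omega
      have hp1 : p = 1 := by
        have h1 := rootNormSq_short hlong hj
        rw [hnorm, hq1, mul_eq_left₀ hBpos.ne'] at h1
        have h3 : (ratio P * p : ℝ) * p = ratio P * p * 1 := by
          push_cast at h1
          linarith
        have h4 := mul_left_cancel₀ (mul_ne_zero (Nat.cast_ne_zero.2 (ratio_pos (P := P)).ne')
          (Nat.cast_ne_zero.2 hp)) h3
        exact_mod_cast h4
      rw [hq1, mul_one] at hrj
      rw [hp1, mul_one] at hri
      have h0 : ∑ x ∈ T.erase l, a x * c x j = 0 := by omega
      rw [Finset.sum_eq_zero_iff] at h0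
      have hrest : ∑ x ∈ T.erase l, a x * c x i = 0 := by
        refine Finset.sum_eq_zero fun k hk => ?_
        exfalso
        have h1 := (Nat.mul_eq_zero.1 (h0 k hk)).resolve_left (ha k).ne'
        have h2 := hli k (Finset.mem_of_mem_erase hk) h1
        have h3 := Finset.single_le_sum (f := fun x => a x * c x i)
          (fun x _ => Nat.zero_le _) hk
        rw [h2.2, h2.1, mul_one] at h3
        have h4 := ha j
        omega
      omega
  · left
    push Not at hmix
    have hmem : ∀ l ∈ T, l = i ∨ l = j := fun l hl => by
      by_cases h0 : c l i = 0
      · exact Or.inr (hlj l hl h0).1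
      · exact Or.inl (hli l hl (hmix l hl h0)).1
    have hiT : (i : ι) ∈ T := by
      by_contra h
      have h0 : ∑ l ∈ T, a l * c l i = 0 := Finset.sum_eq_zero fun l hl => by
        by_cases h0 : c l i = 0
        · rw [h0, mul_zero]
        · exact absurd ((hli l hl (hmix l hl h0)).1 ▸ hl) h
      have := ha i
      omega
    have hjT : (j : ι) ∈ T := by
      by_contra h
      have h0 : ∑ l ∈ T, a l * c l j = 0 := Finset.sum_eq_zero fun l hl => by
        by_cases h0 : c l i = 0
        · exact absurd ((hlj l hl h0).1 ▸ hl) h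
        · rw [hmix l hl h0, mul_zero]
      have := ha j
      omega
    intro l
    refine ⟨hmem l, ?_⟩
    rintro (rfl | rfl)
    · exact hiT
    · exact hjT

theorem denomPoly_eq_sum (b : P.Base) (a : ι → ℕ) :
    denomPoly ℂ b a = ∑ T ∈ (posRoots b).powerset,
      MvPolynomial.monomial (∑ l ∈ T, a l • coneCoeff b (P.root l)) ((-1) ^ T.card) := by
  classical
  have h : denomPoly ℂ b a =
      ∏ l ∈ posRoots b, (1 + MvPolynomial.monomial (a l • coneCoeff b (P.root l)) (-1)) := by
    refine Finset.prod_congr rfl fun l _ => ?_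
    rw [sub_eq_add_neg, ← map_neg]
  rw [h, Finset.prod_one_add]
  refine Finset.sum_congr rfl fun T hT => ?_
  clear hT
  induction T using Finset.induction with
  | empty => simp
  | insert l T hl ih =>
    rw [Finset.prod_insert hl, ih, MvPolynomial.monomial_mul, Finset.sum_insert hl,
      Finset.card_insert_of_notMem hl, pow_succ']

/-- The coefficients of a denominator which is a Schur-Weyl polynomial at adjacent simple roots
of different lengths. -/
theorem scale_eq_or_of_adjacent (b : P.Base) (ha : ∀ i, 0 < a i) (hinv : IsWeylInvariant P a)
    {x : weightLattice P} (hx : IsDominantRegular b x) (hxa : ∀ i ∈ b.support, mult x i = a i)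
    (h : schurPoly ℂ b x = denomPoly ℂ b a) {i j : b.support} (hi : IsLong P i)
    (hj : ¬ IsLong P j) (hij : P.RootForm (P.root i) (P.root j) ≠ 0) :
    a i = a j ∨ a j = ratio P * a i := by
  classical
  have hne : i ≠ j := by
    rintro rfl
    exact hj hi
  have hne' : (i : ι) ≠ j := fun h => hne (Subtype.ext h)
  by_contra hcon
  -- At this exponent the Schur-Weyl polynomial has coefficient 0, since the two roots are not
  -- orthogonal. In the product the pair {α_i, α_j} contributes 1, which can only be cancelled in
  -- the two permitted cases.
  set n : b.support →₀ ℕ := Finsupp.single i (a i) + Finsupp.single j (a j) with hn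
  have hni : n i = a i := by
    rw [hn, Finsupp.add_apply, Finsupp.single_eq_same, Finsupp.single_eq_of_ne hne, add_zero]
  have hnj : n j = a j := by
    rw [hn, Finsupp.add_apply, Finsupp.single_eq_same, Finsupp.single_eq_of_ne hne.symm, zero_add]
  have h0 : (schurPoly ℂ b x).coeff n = 0 := by
    by_contra hc
    refine hij ((coeff_schurPoly_of_le b hx hc fun k => ?_).2 i j hne ?_ ?_)
    · rw [hxa k k.2]
      by_cases hki : k = i
      · rw [hki, hni]
      by_cases hkj : k = j
      · rw [hkj, hnj]
      · rw [hn, Finsupp.add_apply, Finsupp.single_eq_of_ne hki, Finsupp.single_eq_of_ne hkj]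
        positivity
    · rw [hni]
      exact (ha i).ne'
    · rw [hnj]
      exact (ha j).ne'
  have h1 : MvPolynomial.coeff n (denomPoly ℂ b a) = 1 := by
    rw [denomPoly_eq_sum, MvPolynomial.coeff_sum, Finset.sum_eq_single {(i : ι), (j : ι)}]
    · rw [Finset.sum_pair hne', coneCoeff_simple, coneCoeff_simple, Finset.card_pair hne',
        Finsupp.smul_single, Finsupp.smul_single, smul_eq_mul, smul_eq_mul, mul_one, mul_one,
        MvPolynomial.coeff_monomial, if_pos hn.symm]
      norm_num
    · intro T hT hTne
      rw [MvPolynomial.coeff_monomial, if_neg]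
      intro hsum
      rcases eq_or_eq_of_sum_eq b ha hinv hi hj hij (Finset.mem_powerset.1 hT) hsum with h2 | h2
      · exact hTne (Finset.ext fun l => by
          rw [h2, Finset.mem_insert, Finset.mem_singleton])
      · exact hcon h2
    · intro hT
      refine absurd (Finset.mem_powerset.2 fun l hl => ?_) hT
      rw [Finset.mem_insert, Finset.mem_singleton] at hl
      rcases hl with rfl | rfl
      · exact simple_mem_posRoots i.2
      · exact simple_mem_posRoots j.2
  rw [← h] at h1
  exact zero_ne_one (h0.symm.trans h1)

/-- An invariant scale depends only on the length, so when both lengths occur a single long-short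
edge of the diagram decides between multiples of ρ and of ρ̃. -/
theorem isWeylDenominatorType_of_eq_denomPoly (b : P.Base) (hinv : IsWeylInvariant P a)
    {x : weightLattice P} (hx : IsDominantRegular b x) (hxa : ∀ i ∈ b.support, mult x i = a i)
    (h : schurPoly ℂ b x = denomPoly ℂ b a) : IsWeylDenominatorType b x := by
  have ha : ∀ i, 0 < a i := fun j => by
    obtain ⟨i, hi, w, hw⟩ := exists_simple_smul_eq b j
    have h1 := (isDominantRegular_iff b x).1 hx i hi
    rw [hxa i hi, hinv w i j hw] at h1
    exact_mod_cast h1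
  have hlen : ∀ i j, (IsLong P i ↔ IsLong P j) → a i = a j := fun i j hij => by
    obtain ⟨w, hw⟩ := exists_smul_eq_of_rootNormSq_eq (rootNormSq_eq_iff.2 hij)
    exact hinv w i j hw
  by_cases hmix : ∃ i j : b.support, IsLong P i ∧ ¬ IsLong P j
  · obtain ⟨i₀, j₀, hi₀, hj₀⟩ := hmix
    obtain ⟨n₀, v₀, h0, hn, hadj⟩ := exists_dynkin_chain b i₀ j₀
    obtain ⟨n, v, hA, hB, hadj, hA', -⟩ := exists_induced_path
      (fun i j : b.support => P.RootForm (P.root i) (P.root j) ≠ 0)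
      (fun i => IsLong P i) (fun i => ¬ IsLong P i) ⟨n₀, v₀, by rwa [h0], by rwa [hn], hadj⟩
    have hn0 : 0 < n := by
      rcases Nat.eq_zero_or_pos n with rfl | h'
      · exact absurd hA hB
      · exact h'
    -- A shortest path from the long to the short simple roots leaves the long ones at once, so its
    -- first edge is the required one.
    have hs := hA' 1 one_pos hn0
    rcases scale_eq_or_of_adjacent b ha hinv hx hxa h hA hs (hadj 0 hn0) with h1 | h1
    · refine Or.inl ⟨a (v 0), (eq_zsmul_rho_iff b x _).2 fun k hk => ?_⟩
      rw [hxa k hk]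
      by_cases hkl : IsLong P k
      · rw [hlen k (v 0) (iff_of_true hkl hA)]
      · rw [hlen k (v 1) (iff_of_false hkl hs), h1]
    · refine Or.inr ⟨a (v 0), (eq_zsmul_rhoTilde_iff b x _).2 fun k hk => ?_⟩
      rw [hxa k hk, tildeScale]
      by_cases hkl : IsLong P k
      · rw [hlen k (v 0) (iff_of_true hkl hA), if_pos hkl]
        simp
      · rw [hlen k (v 1) (iff_of_false hkl hs), if_neg hkl, h1, mul_comm]
        push_cast
        rfl
  · push Not at hmix
    obtain ⟨i, hi⟩ := support_nonempty b
    refine Or.inl ⟨a i, (eq_zsmul_rho_iff b x _).2 fun k hk => ?_⟩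
    rw [hxa k hk, hlen k i ⟨fun hl => hmix ⟨k, hk⟩ ⟨i, hi⟩ hl, fun hl => hmix ⟨i, hi⟩ ⟨k, hk⟩ hl⟩]

end Adjacent

/-! ### Generalized characters determine the weights -/

section PartTwo

variable [Fintype ι] {P : RootPairing ι ℝ M N} [P.IsRootSystem] [P.IsCrystallographic]
  [P.IsReduced]

/-- For D(λ₂) with λ₂ of denominator type the argument uses only the normalization, and this
suffices to compare leading terms. -/
theorem exists_poly_of_hasLeadingCoeffOne (b : P.Base) {f : WeightAlgebra P}
    (hf : HasLeadingCoeffOne b f) :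
    ∃ (x : weightLattice P) (p : MvPolynomial b.support ℂ), MvPolynomial.constantCoeff p = 1 ∧
      toAmbient P ℂ f = AddMonoidAlgebra.single (x : M) 1 * incl ℂ b p := by
  classical
  obtain ⟨x, hx, hsupp⟩ := hf
  set p : MvPolynomial b.support ℂ := ∑ y ∈ f.coeff.support,
    MvPolynomial.monomial (coneCoeff b ((x : M) - y)) (f.coeff y : ℂ) with hp
  have h1 : toAmbient P ℂ f = AddMonoidAlgebra.single (x : M) 1 * incl ℂ b p := by
    have h2 : f = ∑ y ∈ f.coeff.support, AddMonoidAlgebra.single y (f.coeff y) :=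
      (AddMonoidAlgebra.sum_coeff_single f).symm
    conv_lhs => rw [h2]
    rw [map_sum, hp, map_sum, Finset.mul_sum]
    refine Finset.sum_congr rfl fun y hy => ?_
    rw [toAmbient_single, incl_monomial, coneVec_coneCoeff b (hsupp y hy),
      AddMonoidAlgebra.single_mul_single, one_mul, neg_sub, add_sub_cancel]
  refine ⟨x, p, ?_, h1⟩
  have h3 := coeff_toAmbient (k := ℂ) f x
  rw [h1, coeff_single_mul', one_mul, sub_self, hx, Int.cast_one] at h3
  have h4 := coeff_incl b p 0
  rw [map_zero, neg_zero, h3] at h4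
  exact h4.symm

theorem isWeylDenominatorType_of_schurWeyl_mul_eq [P.IsIrreducible] (b : P.Base)
    {x y z : weightLattice P} (hx : IsDominantRegular b x)
    (hy : IsDominantRegular b y ∧ IsWeylDenominatorType b y)
    (hz : IsDominantRegular b z ∧ IsWeylDenominatorType b z) {f : WeightAlgebra P}
    (hf : HasLeadingCoeffOne b f) (h : schurWeyl b x * f = schurWeyl b y * schurWeyl b z) :
    IsWeylDenominatorType b x := by
  obtain ⟨κ, hκ, hyκ⟩ := (weylDenominator_iff b y).1 hy
  obtain ⟨κ', hκ', hzκ⟩ := (weylDenominator_iff b z).1 hz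
  obtain ⟨u, p, hp, hfp⟩ := exists_poly_of_hasLeadingCoeffOne b hf
  have h1 := congrArg (toAmbient P ℂ) h
  simp only [map_mul, toAmbient_schurWeyl, schurAmbient_eq ℂ b hx, schurAmbient_eq ℂ b hy.1,
    schurAmbient_eq ℂ b hz.1, hfp] at h1
  rw [mul_mul_mul_comm, mul_mul_mul_comm (AddMonoidAlgebra.single (y : M) 1),
    AddMonoidAlgebra.single_mul_single, AddMonoidAlgebra.single_mul_single, one_mul,
    ← map_mul, ← map_mul] at h1
  have h2 := (leading_cancel b one_ne_zero
    (by rw [map_mul, constantCoeff_schurPoly b hx, hp, one_mul])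
    (by rw [map_mul, constantCoeff_schurPoly b hy.1, constantCoeff_schurPoly b hz.1, one_mul])
    h1).2.2
  rw [schurPoly_eq_denomPoly ℂ hκ.isScaling b hyκ,
    schurPoly_eq_denomPoly ℂ hκ'.isScaling b hzκ] at h2
  obtain ⟨a, hinv, hxa, ha⟩ :=
    exists_eq_denomPoly_of_mul_eq b hx hκ.isScaling.pos hκ'.isScaling.pos h2
  exact isWeylDenominatorType_of_eq_denomPoly b hinv hx hxa ha

theorem eq_of_genCharacter_eq [P.IsIrreducible] (b : P.Base) {x₁ x₂ : weightLattice P}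
    (hx₁ : IsDominantRegular b x₁) (hx₂ : IsDominantRegular b x₂)
    (hnot : ¬ IsWeylDenominatorType b x₁) (h : genCharacter b x₁ = genCharacter b x₂) :
    x₁ = x₂ := by
  have hinj := IsFractionRing.injective (WeightAlgebra P) (WeightField P)
  have hne : ∀ {f : WeightAlgebra P}, f ≠ 0 → algebraMap (WeightAlgebra P) (WeightField P) f ≠ 0 :=
    fun hf => (map_ne_zero_iff _ hinj).2 hf
  obtain ⟨κ, y₁, hκ, hy₁, hyreg, hyne, hlcm⟩ := exists_weylLcm_eq b hx₁ hnot
  have hS₁ := schurWeyl_ne_zero b hx₁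
  have hT₁ := schurWeyl_ne_zero b hyreg
  rw [genCharacter, genCharacter, hlcm] at h
  -- This covers the default value 0: the quotient would then be 0, whereas the one for `x₁` is not.
  by_cases hD : weylLcm b x₂ = 0
  · rw [hD, map_zero, div_zero] at h
    exact absurd h (div_ne_zero (hne hS₁) (hne hT₁))
  rw [div_eq_div_iff (hne hT₁) (hne hD), ← map_mul, ← map_mul, hinj.eq_iff] at h
  -- If `x₂` is of denominator type, S(x₁) divides a product of two denominators and `x₁` would be
  -- of that type too. Otherwise both least common multiples are Schur-Weyl elements, and the
  -- uniqueness of quotients applies.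
  by_cases hnot₂ : IsWeylDenominatorType b x₂
  · have hex : ∃ f, IsWeylLcm b x₂ f := by
      by_contra hc
      exact hD (dif_neg hc)
    have hspec : IsWeylLcm b x₂ (weylLcm b x₂) := by
      rw [weylLcm, dif_pos hex]
      exact hex.choose_spec
    exact absurd (isWeylDenominatorType_of_schurWeyl_mul_eq b hx₁ ⟨hx₂, hnot₂⟩
      ((weylDenominator_iff b y₁).2 ⟨κ, hκ, hy₁⟩) hspec.2.2.2 h) hnot
  · obtain ⟨κ', y₂, hκ', hy₂, hyreg₂, -, hlcm₂⟩ := exists_weylLcm_eq b hx₂ hnot₂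
    rw [hlcm₂] at h
    exact (eq_of_schurWeyl_mul_eq b hx₁ hx₂ hyreg hyreg₂ h hyne.symm).1

end PartTwo

end SchurWeyl

end

theorem theorem2 {ι M N : Type*} [Fintype ι] [AddCommGroup M] [Module ℝ M]
    [AddCommGroup N] [Module ℝ N] (P : RootPairing ι ℝ M N) [P.IsRootSystem]
    [P.IsCrystallographic] [P.IsReduced] [P.IsIrreducible] (b : P.Base) :
    (∀ lam₁ lam₂ μ₁ μ₂ : SchurWeyl.weightLattice P,
      SchurWeyl.IsDominantRegular b lam₁ → SchurWeyl.IsDominantRegular b lam₂ →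
      SchurWeyl.IsDominantRegular b μ₁ → SchurWeyl.IsDominantRegular b μ₂ →
      SchurWeyl.IsWeylDenominatorType b μ₁ → SchurWeyl.IsWeylDenominatorType b μ₂ →
      SchurWeyl.WeightDvd b μ₁ lam₁ → SchurWeyl.WeightDvd b μ₂ lam₂ →
      SchurWeyl.schurWeylQuot b lam₁ μ₁ = SchurWeyl.schurWeylQuot b lam₂ μ₂ →
      SchurWeyl.schurWeylQuot b lam₁ μ₁ ≠ 1 →
      lam₁ = lam₂ ∧ μ₁ = μ₂) ∧
    (∀ lam₁ lam₂ : SchurWeyl.weightLattice P,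
      SchurWeyl.IsDominantRegular b lam₁ → SchurWeyl.IsDominantRegular b lam₂ →
      (lam₂ : M) ≠ SchurWeyl.rho b →
      ¬ SchurWeyl.IsWeylDenominatorType b lam₁ →
      SchurWeyl.genCharacter b lam₁ = SchurWeyl.genCharacter b lam₂ →
      lam₁ = lam₂) := by
  refine ⟨fun lam₁ lam₂ μ₁ μ₂ h₁ h₂ h₃ h₄ _ _ _ _ h hne => ?_, fun lam₁ lam₂ h₁ h₂ _ hnot h =>
    SchurWeyl.eq_of_genCharacter_eq b h₁ h₂ hnot h⟩
  exact SchurWeyl.eq_of_schurWeyl_mul_eq b h₁ h₂ h₃ h₄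
    ((SchurWeyl.schurWeylQuot_eq_iff b h₃ h₄).1 h) (SchurWeyl.ne_of_schurWeylQuot_ne_one b h₃ hne)
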